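/- Let $(S_1,X_1),(S_2,X_2),\ldots$ be independent and identically distributed random vectors on a probability space $(\Omega,\mathcal F,\mathbb P)$, where the $S_i$ take positive real values and the $X_i$ take values in a real separable Banach space $(\mathcal X,\|\cdot\|)$ with its Borel $\sigma$-field $\mathcal B(\mathcal X)$; $S_i$ and $X_i$ may depend on each other, and no moment is assumed finite. Put $T_i:=S_1+\cdots+S_i$ and $W_t:=\sum_{i\ge 1}X_i\,\mathbf 1_{\{T_i\le t\}}$ for $t\ge 0$ (almost surely a finite sum, since $T_i\to+\infty$ almost surely). Let $\mathcal X^\star$ be the topological dual of $\mathcal X$ and, for $(s,w)\in\mathbb R\times\mathcal X$, let $$J(s,w):=\sup_{(\zeta,\varphi)\in\mathbb R\times\mathcal X^\star}\Big\{s\zeta+\varphi(w)-\ln\mathbb E\big[e^{\zeta S_1+\varphi(X_1)}\big]\Big\},$$ $$\Upsilon(\beta,w):=\lim_{\delta\downarrow 0}\ \inf_{s\in(\beta-\delta,\beta+\delta)}\ \inf_{\|v-w\|<\delta}\ \inf_{\gamma>0}\big\{\gamma J(s/\gamma,v/\gamma)\big\}.$$ Let $\ell_{\mathrm i}:=-\liminf_{s\uparrow+\infty}\frac1s\ln\mathbb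 P[S_1>s]$ and $\ell_{\mathrm s}:=-\limsup_{s\uparrow+\infty}\frac1s\ln\mathbb P[S_1>s]$, so that $0\le\ell_{\mathrm s}\le\ell_{\mathrm i}\le+\infty$, and for $\ast\in\{\mathrm i,\mathrm s\}$ let $I_\ast:=\inf_{\beta\in[0,1]}\{\Upsilon(\beta,\cdot)+(1-\beta)\ell_\ast\}$ if $\ell_\ast<+\infty$ and $I_\ast:=\Upsilon(1,\cdot)$ if $\ell_\ast=+\infty$. (Conventions: $\ln 0=-\infty$, $\ln(+\infty)=+\infty$, $\inf\emptyset=+\infty$.) Then: (a) $I_{\mathrm i}$ and $I_{\mathrm s}$ take values in $[0,+\infty]$ and are lower semicontinuous and convex. (b) If $G\subseteq\mathcal X$ is open, then $$\liminf_{t\uparrow+\infty}\frac1t\ln\mathbb P\Big[\frac{W_t}{t}\in G\Big]\ge-\inf_{w\in G}I_{\mathrm i}(w).$$ (c) If $F\subseteq\mathcal X$ is compact, then $$\limsup_{t\uparrow+\infty}\frac1t\ln\mathbb P\Big[\frac{W_t}{t}\in F\Big]\le-\inf_{w\in F}I_{\mathrm s}(w).$$ (d) If $\ell_{\mathrm s}<+\infty$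 or $I_{\mathrm s}(0)<+\infty$, then the bound in (c) holds for every $F\in\mathcal B(\mathcal X)$ that is open convex or closed convex, and for every convex $F\in\mathcal B(\mathcal X)$ when $\mathcal X$ is finite-dimensional. (e) If $\mathcal X$ is finite-dimensional and $\mathbb E[e^{\zeta S_1+\sigma\|X_1\|}]<+\infty$ for some $\zeta\le 0$ and $\sigma>0$, then the law of $W_t/t$ is exponentially tight (for every $\lambda>0$ there is a compact $K\subseteq\mathcal X$ with $\limsup_{t\uparrow+\infty}\frac1t\ln\mathbb P[W_t/t\notin K]\le-\lambda$), $I_{\mathrm i}$ and $I_{\mathrm s}$ have compact level sets $\{I_\ast\le a\}$, $a\in\mathbb R$, and the bound in (c) holds for every closed $F\subseteq\mathcal X$. (f) If $\mathcal X$ is infinite-dimensional and $\mathbb E[e^{\sigma S_1+\sigma\|X_1\|}]<+\infty$ for all $\sigma>0$, then $I_{\mathrm i}=I_{\mathrm s}=\Upsilon(1,\cdot)$, $\Upsilon(1,\cdot)$ has compact level sets, and the bound in (c) holds for every closed $F\subseteq\mathcal X$; together with (b), the full large deviation principle holds with good rate function $\Upsilon(1,\cdot)$. -/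

import Mathlib

open MeasureTheory ProbabilityTheory Filter Topology

noncomputable section

namespace RenewalReward

/-- The renewal time `T_{n+1} = S_1 + ⋯ + S_{n+1}`; sequences are indexed from `0`, so that `S n`
is the `(n+1)`-st waiting time. -/
def renewalTime {Ω : Type*} (S : ℕ → Ω → ℝ) (n : ℕ) (ω : Ω) : ℝ :=
  ∑ j ∈ Finset.range (n + 1), S j ω

/-- The cumulative reward `W_t = ∑_{i ≥ 1} X_i 1_{T_i ≤ t}`. The sum has finitely many nonzero
terms wherever the renewal times tend to infinity, which happens almost surely. -/
def cumulativeReward {Ω E : Type*} [NormedAddCommGroup E]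
    (S : ℕ → Ω → ℝ) (X : ℕ → Ω → E) (t : ℝ) (ω : Ω) : E :=
  ∑' i, Set.indicator {ω' | renewalTime S i ω' ≤ t} (X i) ω

/-- The joint moment generating function `𝔼[exp (ζ s + φ x)]`, with values in `[0, ∞]`. -/
def jointMgf {Ω E : Type*} [MeasurableSpace Ω] [NormedAddCommGroup E] [NormedSpace ℝ E]
    (P : Measure Ω) (s : Ω → ℝ) (x : Ω → E) (ζ : ℝ) (φ : StrongDual ℝ E) : ENNReal :=
  ∫⁻ ω, ENNReal.ofReal (Real.exp (ζ * s ω + φ (x ω))) ∂P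

/-- Cramér's rate function `J` of the pair `(s, x)`, with `ln (+∞) = +∞`. -/
def cramerRate {Ω E : Type*} [MeasurableSpace Ω] [NormedAddCommGroup E] [NormedSpace ℝ E]
    (P : Measure Ω) (s : Ω → ℝ) (x : Ω → E) (b : ℝ) (w : E) : EReal :=
  ⨆ (ζ : ℝ) (φ : StrongDual ℝ E),
    ((b * ζ + φ w : ℝ) : EReal) - ENNReal.log (jointMgf P s x ζ φ)

/-- The infimum over `γ > 0` of the perspectives `γ J(b / γ, w / γ)`. -/
def infPerspective {Ω E : Type*} [MeasurableSpace Ω] [NormedAddCommGroup E] [NormedSpace ℝ E]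
    (P : Measure Ω) (s : Ω → ℝ) (x : Ω → E) (b : ℝ) (w : E) : EReal :=
  ⨅ (γ : ℝ) (_ : 0 < γ), (γ : EReal) * cramerRate P s x (b / γ) (γ⁻¹ • w)

/-- The lower semicontinuous regularization `Υ` of `infPerspective`. The inner infimum increases
as `δ` decreases to `0`, so its limit is the supremum over `δ > 0`. -/
def upsilon {Ω E : Type*} [MeasurableSpace Ω] [NormedAddCommGroup E] [NormedSpace ℝ E]
    (P : Measure Ω) (s : Ω → ℝ) (x : Ω → E) (β : ℝ) (w : E) : EReal :=
  ⨆ (δ : ℝ) (_ : 0 < δ), ⨅ b ∈ Set.Ioo (β - δ) (β + δ), ⨅ v ∈ Metric.ball w δ,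
    infPerspective P s x b v

/-- `ℓ_i = - liminf_{r → +∞} (1 / r) ln P[s > r]`. -/
def ellInf {Ω : Type*} [MeasurableSpace Ω] (P : Measure Ω) (s : Ω → ℝ) : EReal :=
  - liminf (fun r : ℝ => ((r⁻¹ : ℝ) : EReal) * ENNReal.log (P {ω | r < s ω})) atTop

/-- `ℓ_s = - limsup_{r → +∞} (1 / r) ln P[s > r]`. -/
def ellSup {Ω : Type*} [MeasurableSpace Ω] (P : Measure Ω) (s : Ω → ℝ) : EReal :=
  - limsup (fun r : ℝ => ((r⁻¹ : ℝ) : EReal) * ENNReal.log (P {ω | r < s ω})) atTop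

/-- The rate function built from `Υ` and a decay rate `ℓ`. -/
def rateOf {Ω E : Type*} [MeasurableSpace Ω] [NormedAddCommGroup E] [NormedSpace ℝ E]
    (P : Measure Ω) (s : Ω → ℝ) (x : Ω → E) (ℓ : EReal) (w : E) : EReal :=
  open Classical in
  if ℓ < ⊤ then ⨅ β ∈ Set.Icc (0 : ℝ) 1, upsilon P s x β w + ((1 - β : ℝ) : EReal) * ℓ
  else upsilon P s x 1 w

/-- The rate function `I_i` of the lower bound. -/
def rateInf {Ω E : Type*} [MeasurableSpace Ω] [NormedAddCommGroup E] [NormedSpace ℝ E]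
    (P : Measure Ω) (s : Ω → ℝ) (x : Ω → E) : E → EReal :=
  rateOf P s x (ellInf P s)

/-- The rate function `I_s` of the upper bound. -/
def rateSup {Ω E : Type*} [MeasurableSpace Ω] [NormedAddCommGroup E] [NormedSpace ℝ E]
    (P : Measure Ω) (s : Ω → ℝ) (x : Ω → E) : E → EReal :=
  rateOf P s x (ellSup P s)

/-- `(1 / t) ln P[W_t / t ∈ A]`, with `ln 0 = -∞`. -/
def logProb {Ω E : Type*} [MeasurableSpace Ω] [NormedAddCommGroup E] [NormedSpace ℝ E]
    (P : Measure Ω) (S : ℕ → Ω → ℝ) (X : ℕ → Ω → E) (A : Set E) (t : ℝ) : EReal :=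
  ((t⁻¹ : ℝ) : EReal) * ENNReal.log (P {ω | t⁻¹ • cumulativeReward S X t ω ∈ A})

/-- The large deviation upper bound with rate function `I` for the set `F`. -/
def UpperBound {Ω E : Type*} [MeasurableSpace Ω] [NormedAddCommGroup E] [NormedSpace ℝ E]
    (P : Measure Ω) (S : ℕ → Ω → ℝ) (X : ℕ → Ω → E) (I : E → EReal) (F : Set E) : Prop :=
  limsup (logProb P S X F) atTop ≤ - ⨅ w ∈ F, I w

/-- The large deviation lower bound with rate function `I` for the set `G`. -/
def LowerBound {Ω E : Type*} [MeasurableSpace Ω] [NormedAddCommGroup E] [NormedSpace ℝ E]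
    (P : Measure Ω) (S : ℕ → Ω → ℝ) (X : ℕ → Ω → E) (I : E → EReal) (G : Set E) : Prop :=
  - (⨅ w ∈ G, I w) ≤ liminf (logProb P S X G) atTop

/-- Exponential tightness of the law of `W_t / t`. -/
def ExpTight {Ω E : Type*} [MeasurableSpace Ω] [NormedAddCommGroup E] [NormedSpace ℝ E]
    (P : Measure Ω) (S : ℕ → Ω → ℝ) (X : ℕ → Ω → E) : Prop :=
  ∀ a : ℝ, 0 < a → ∃ K : Set E, IsCompact K ∧
    limsup (logProb P S X Kᶜ) atTop ≤ ((-a : ℝ) : EReal)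

/-- Convexity of an extended-real-valued function; used for functions that are nonnegative, so
that the right-hand side is never of the form `∞ - ∞`. -/
def ERealConvex {E : Type*} [NormedAddCommGroup E] [NormedSpace ℝ E] (I : E → EReal) : Prop :=
  ∀ w₁ w₂ : E, ∀ a b : ℝ, 0 ≤ a → 0 ≤ b → a + b = 1 →
    I (a • w₁ + b • w₂) ≤ (a : EReal) * I w₁ + (b : EReal) * I w₂

/-- Goodness: all level sets `{I ≤ a}` with `a` real are compact. -/
def CompactLevelSets {E : Type*} [TopologicalSpace E] (I : E → EReal) : Prop :=
  ∀ a : ℝ, IsCompact {w | I w ≤ (a : EReal)}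

end RenewalReward

end

set_option linter.unusedSectionVars false

/-! Let μ be the law of (S_1, X_1) on ℝ × E, Λ(g) = ln ∫ e^g dμ for continuous linear g, and
consider the random walk with coordinates (T_n, X_1 + ⋯ + X_n). If t lies between the renewals n and
n + 1, then W_t is the second coordinate of the walk at step n. Hence W_t / t ≈ w means that for
some n the rescaled walk is near (β, w) with β ≤ 1 and the next waiting time exceeds about (1 - β)t.
These two events are independent. The first, for the best n, has exponential cost Υ(β, w); the
second costs (1 - β)ℓ.

The cost Υ is handled by duality: it is the support function of {Λ ≤ 0} (`upsilon_eq_dualRate`). To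
see this, `cramerEpi` is defined through probabilities of visiting balls, with no reference to Λ,
and is convex because independent blocks of steps can be concatenated. If an affine function g - c
lies below it, then Λ(g) ≤ c (`lintegral_eexp_le`): tightness reduces this to compact convex sets,
where finitely many balls and an n-th root suffice. Hahn–Banach then gives Cramér's theorem
(`mem_cramerEpi_iff`) and, applied to the cone of all rescaled epigraph points, the formula for Υ.

Upper bounds: P is at most a finite sum, over strips of values of β, of an expected number of visits
times a tail of S (`measure_cumulativeReward_le`). If Λ(g) ≤ 0 and g(z) > r, a small negative tilt
of g in the time direction makes Λ strictly negative, so Chernoff's bounds can be summed over all n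
near z, hence on compact sets. On convex sets, repeating blocks removes the constant from the bound
at each fixed n, and only linearly many n matter.

Lower bounds: for β < 1 the walk reaches t(β, w) and one long waiting time follows. For β = 1 the
walk is stopped slightly before t and the gap is filled with steps of bounded reward, at small cost.

Exponential tightness extends the compact bound to closed sets. In finite dimension it is a Chernoff
bound for norms; in general the compact set is an intersection of shrinking neighborhoods of compact
convex sets. -/

noncomputable section

namespace RenewalReward

/-! ### Exponentials with values in `[0, ∞]` and asymptotic comparisons -/

section Eexp

/-- The real exponential with values in `[0, ∞]`. -/
def eexp (x : ℝ) : ENNReal := ENNReal.ofReal (Real.exp x)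

lemma eexp_add (x y : ℝ) : eexp (x + y) = eexp x * eexp y := by
  rw [eexp, Real.exp_add, ENNReal.ofReal_mul (Real.exp_pos x).le]; rfl

@[simp] lemma eexp_zero : eexp 0 = 1 := by simp [eexp]

lemma eexp_pos (x : ℝ) : 0 < eexp x := by simp [eexp, Real.exp_pos]

lemma eexp_ne_zero (x : ℝ) : eexp x ≠ 0 := (eexp_pos x).ne'

lemma eexp_ne_top (x : ℝ) : eexp x ≠ ⊤ := by simp [eexp]

lemma eexp_le_eexp {x y : ℝ} : eexp x ≤ eexp y ↔ x ≤ y := by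
  rw [eexp, eexp, ENNReal.ofReal_le_ofReal_iff (Real.exp_pos y).le, Real.exp_le_exp]

lemma eexp_lt_eexp {x y : ℝ} : eexp x < eexp y ↔ x < y := by
  rw [← not_le, ← not_le, eexp_le_eexp]

lemma eexp_le_one {x : ℝ} : eexp x ≤ 1 ↔ x ≤ 0 := by
  rw [← eexp_zero, eexp_le_eexp]

lemma eexp_nat_mul (n : ℕ) (x : ℝ) : eexp (n * x) = eexp x ^ n := by
  rw [eexp, Real.exp_nat_mul, ENNReal.ofReal_pow (Real.exp_pos x).le]; rfl

lemma eexp_neg_mul_self (x : ℝ) : eexp (-x) * eexp x = 1 := by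
  rw [← eexp_add]; simp

lemma continuous_eexp : Continuous eexp :=
  ENNReal.continuous_ofReal.comp Real.continuous_exp

lemma measurable_eexp : Measurable eexp := continuous_eexp.measurable

lemma log_eexp (x : ℝ) : ENNReal.log (eexp x) = x := by
  rw [eexp, ENNReal.log_ofReal_of_pos (Real.exp_pos x), Real.log_exp]

lemma exists_eexp_eq {p : ENNReal} (h0 : p ≠ 0) (ht : p ≠ ⊤) : ∃ x : ℝ, p = eexp x :=
  ⟨Real.log p.toReal, by
    rw [eexp, Real.exp_log (ENNReal.toReal_pos h0 ht), ENNReal.ofReal_toReal ht]⟩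

lemma le_eexp_of_forall_lt {p : ENNReal} {x : ℝ} (h : ∀ y, x < y → p ≤ eexp y) : p ≤ eexp x := by
  have h1 : Tendsto eexp (𝓝[>] x) (𝓝 (eexp x)) :=
    (continuous_eexp.tendsto x).mono_left nhdsWithin_le_nhds
  exact ge_of_tendsto h1 (eventually_mem_nhdsWithin.mono h)

lemma eexp_le_of_forall_lt {p : ENNReal} {x : ℝ} (h : ∀ y, y < x → eexp y ≤ p) : eexp x ≤ p := by
  have h1 : Tendsto eexp (𝓝[<] x) (𝓝 (eexp x)) :=
    (continuous_eexp.tendsto x).mono_left nhdsWithin_le_nhds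
  exact le_of_tendsto h1 (eventually_mem_nhdsWithin.mono h)

lemma tendsto_eexp_atTop : Tendsto eexp atTop (𝓝 ⊤) :=
  ENNReal.tendsto_ofReal_nhds_top.2 Real.tendsto_exp_atTop

lemma tendsto_eexp_atBot : Tendsto eexp atBot (𝓝 0) := by
  have := ENNReal.tendsto_ofReal Real.tendsto_exp_atBot
  rwa [ENNReal.ofReal_zero] at this

lemma eventually_le_eexp_mul {C : ENNReal} (hC : C ≠ ⊤) {a : ℝ} (ha : 0 < a) :
    ∀ᶠ t : ℝ in atTop, C ≤ eexp (a * t) := by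
  have h := tendsto_eexp_atTop.comp (tendsto_id.const_mul_atTop ha)
  exact (h.eventually (lt_mem_nhds (lt_top_iff_ne_top.2 hC))).mono fun t ht => ht.le

lemma eventually_const_mul_eexp_le {C : ENNReal} (hC : C ≠ ⊤) {a b : ℝ} (hab : a < b) :
    ∀ᶠ t : ℝ in atTop, C * eexp (a * t) ≤ eexp (b * t) := by
  filter_upwards [eventually_le_eexp_mul hC (sub_pos.2 hab)] with t ht
  calc C * eexp (a * t) ≤ eexp ((b - a) * t) * eexp (a * t) := by gcongr
    _ = eexp (b * t) := by rw [← eexp_add]; ring_nf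

lemma eventually_linear_mul_eexp_le (C D : ℝ) {a b : ℝ} (hab : a < b) :
    ∀ᶠ t : ℝ in atTop, ENNReal.ofReal (C * t + D) * eexp (a * t) ≤ eexp (b * t) := by
  have h0 : Tendsto (fun t : ℝ => (C * t + D) / Real.exp ((b - a) * t)) atTop (𝓝 0) := by
    have h2 : Tendsto (fun t : ℝ => t ^ 1 * Real.exp (-(b - a) * t)) atTop (𝓝 0) := by
      have := Real.tendsto_pow_mul_exp_neg_atTop_nhds_zero 1
      have h3 := (this.comp (tendsto_id.const_mul_atTop (sub_pos.2 hab))).const_mul (b - a)⁻¹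
      rw [mul_zero] at h3
      refine h3.congr fun t => ?_
      have : b - a ≠ 0 := (sub_pos.2 hab).ne'
      simp only [Function.comp, id, pow_one, neg_mul]
      field_simp
    have h4 : Tendsto (fun t : ℝ => Real.exp (-(b - a) * t)) atTop (𝓝 0) :=
      Real.tendsto_exp_atBot.comp
        (tendsto_id.const_mul_atTop_of_neg (neg_lt_zero.2 (sub_pos.2 hab)))
    have h5 := (h2.const_mul C).add (h4.const_mul D)
    simp only [mul_zero, add_zero] at h5
    refine h5.congr fun t => ?_
    rw [div_eq_mul_inv, ← Real.exp_neg]; ring_nf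
  filter_upwards [h0.eventually (gt_mem_nhds one_pos)] with t ht
  rw [div_lt_one (Real.exp_pos _)] at ht
  calc ENNReal.ofReal (C * t + D) * eexp (a * t) ≤ eexp ((b - a) * t) * eexp (a * t) := by
        gcongr; exact ENNReal.ofReal_le_ofReal ht.le
    _ = eexp (b * t) := by rw [← eexp_add]; ring_nf

/-- The n-th root trick: a constant independent of n disappears in the limit. -/
lemma le_of_forall_pow_le {x y C : ENNReal} (hC : C ≠ ⊤) (hy0 : y ≠ 0) (hy : y ≠ ⊤)
    (h : ∀ n : ℕ, x ^ n ≤ C * y ^ n) : x ≤ y := by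
  by_contra! hlt
  have h1 : 1 < x / y := (ENNReal.lt_div_iff_mul_lt (Or.inl hy0) (Or.inl hy)).2 (by simpa)
  have h2 := (ENNReal.tendsto_pow_atTop_nhds_top_iff.2 h1).eventually
    (lt_mem_nhds (lt_top_iff_ne_top.2 hC))
  obtain ⟨n, hn⟩ := h2.exists
  refine absurd (h n) (not_le.2 ?_)
  rw [ENNReal.div_eq_inv_mul, mul_pow, mul_comm, ← ENNReal.inv_pow, ← div_eq_mul_inv,
    ENNReal.lt_div_iff_mul_lt (Or.inl (pow_ne_zero _ hy0)) (Or.inl (ENNReal.pow_ne_top hy))] at hn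
  exact hn

end Eexp

/-! ### Convolution powers and concatenation of independent blocks -/

section Convolution

variable {V : Type*} [NormedAddCommGroup V] [MeasurableSpace V] [BorelSpace V]
  [SecondCountableTopology V]

/-- The `n`-fold convolution power of a measure: the law of the `n`-th step of a random walk. -/
def iterConv (μ : Measure V) : ℕ → Measure V
  | 0 => Measure.dirac 0
  | n + 1 => (iterConv μ n).conv μ

instance (μ : Measure V) [IsProbabilityMeasure μ] (n : ℕ) :
    IsProbabilityMeasure (iterConv μ n) := by
  induction n with
  | zero => unfold iterConv; infer_instance
  | succ n ih => unfold iterConv; infer_instance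

lemma iterConv_add (μ : Measure V) [IsProbabilityMeasure μ] (n m : ℕ) :
    iterConv μ (n + m) = (iterConv μ n).conv (iterConv μ m) := by
  induction m with
  | zero => simp [iterConv]
  | succ m ih => rw [← add_assoc, iterConv, ih, iterConv, Measure.conv_assoc]

lemma iterConv_mul_le (μ : Measure V) [IsProbabilityMeasure μ] (n m : ℕ) {A B C : Set V}
    (h : ∀ a ∈ A, ∀ b ∈ B, a + b ∈ C) :
    iterConv μ n A * iterConv μ m B ≤ iterConv μ (n + m) C := by
  rw [iterConv_add, Measure.conv, ← Measure.prod_prod]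
  refine le_trans (measure_mono ?_) (Measure.le_map_apply (by fun_prop) C)
  rintro ⟨a, b⟩ ⟨ha, hb⟩
  exact h a ha b hb

lemma iterConv_pow_le (μ : Measure V) [IsProbabilityMeasure μ] (n : ℕ) {A : Set V}
    {B : ℕ → Set V} (h0 : (0 : V) ∈ B 0) (h : ∀ k, ∀ a ∈ A, ∀ b ∈ B k, b + a ∈ B (k + 1)) (k : ℕ) :
    iterConv μ n A ^ k ≤ iterConv μ (n * k) (B k) := by
  induction k with
  | zero =>
    simp only [pow_zero, mul_zero, iterConv]
    refine le_trans ?_ (Measure.le_dirac_apply)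
    simp [h0]
  | succ k ih =>
    rw [pow_succ, mul_add, mul_one]
    exact le_trans (by gcongr) (iterConv_mul_le μ (n * k) n fun b hb a ha => h k a ha b hb)

lemma lintegral_eexp_iterConv [NormedSpace ℝ V] (μ : Measure V) [IsProbabilityMeasure μ]
    (g : StrongDual ℝ V) (n : ℕ) :
    ∫⁻ x, eexp (g x) ∂(iterConv μ n) = (∫⁻ x, eexp (g x) ∂μ) ^ n := by
  have hm : Measurable fun x => eexp (g x) := measurable_eexp.comp g.continuous.measurable
  induction n with
  | zero => simp [iterConv, lintegral_dirac' _ hm]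
  | succ n ih =>
    rw [iterConv, Measure.lintegral_conv hm, pow_succ, ← ih, ← lintegral_mul_const _ hm]
    congr with x
    rw [← lintegral_const_mul _ hm]
    simp [eexp_add]

open Pointwise in
-- For convex K, nK + K = (n + 1)K. Steps that all lie in K therefore carry the walk into nK, and
-- the product of the restricted integrals counts only such paths.
lemma setLIntegral_eexp_pow_le [NormedSpace ℝ V] (μ : Measure V) [IsProbabilityMeasure μ]
    (g : StrongDual ℝ V) {K : Set V} (hK : IsCompact K) (hKc : Convex ℝ K)
    (hKn : K.Nonempty) (n : ℕ) :
    (∫⁻ x in K, eexp (g x) ∂μ) ^ n ≤ ∫⁻ x in (n : ℝ) • K, eexp (g x) ∂(iterConv μ n) := by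
  have hm : Measurable fun x => eexp (g x) := measurable_eexp.comp g.continuous.measurable
  classical
  induction n with
  | zero =>
    simp only [pow_zero, iterConv, Nat.cast_zero]
    rw [Set.zero_smul_set hKn, ← Set.singleton_zero,
      setLIntegral_dirac' hm (measurableSet_singleton _)]
    simp
  | succ n ih =>
    have hmeas : ∀ k : ℕ, MeasurableSet ((k : ℝ) • K) := fun k =>
      (hK.smul (k : ℝ)).isClosed.measurableSet
    rw [← lintegral_indicator (hmeas _), iterConv,
      Measure.lintegral_conv (hm.indicator (hmeas _)), pow_succ]
    calc _ ≤ (∫⁻ x in (n : ℝ) • K, eexp (g x) ∂(iterConv μ n)) * ∫⁻ x in K, eexp (g x) ∂μ := by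
          gcongr
      _ = ∫⁻ x in (n : ℝ) • K, (∫⁻ y in K, eexp (g (x + y)) ∂μ) ∂(iterConv μ n) := by
          rw [← lintegral_mul_const _ hm]
          congr with x
          rw [← lintegral_const_mul _ hm]
          simp [eexp_add]
      _ ≤ _ := by
          rw [← lintegral_indicator (hmeas _)]
          refine lintegral_mono fun x => ?_
          by_cases hx : x ∈ (n : ℝ) • K
          · rw [Set.indicator_of_mem hx, ← lintegral_indicator hK.isClosed.measurableSet]
            refine lintegral_mono fun y => ?_
            by_cases hy : y ∈ K
            · rw [Set.indicator_of_mem hy, Set.indicator_of_mem]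
              rw [Nat.cast_succ, hKc.add_smul (Nat.cast_nonneg n) zero_le_one, one_smul]
              exact Set.add_mem_add hx hy
            · simp [hy]
          · simp [hx]

end Convolution

/-! ### Compact convex exhaustion of a measure -/

section Compactness

variable {V : Type*} [NormedAddCommGroup V] [NormedSpace ℝ V] [CompleteSpace V]

lemma isCompact_closure_convexHull {K : Set V} (hK : IsCompact K) :
    IsCompact (closure (convexHull ℝ K)) :=
  isCompact_iff_totallyBounded_isComplete.2
    ⟨(totallyBounded_convexHull.2 hK.totallyBounded).closure, isClosed_closure.isComplete⟩

variable [MeasurableSpace V] [BorelSpace V] [SecondCountableTopology V]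

/-- A finite Borel measure on a separable Banach space is tight. Closed convex hulls of growing
finite unions of compact sets stay compact and carry all the mass, so monotone convergence applies.
-/
lemma lintegral_le_of_forall_compact (μ : Measure V) [IsFiniteMeasure μ] {f : V → ENNReal}
    {C : ENNReal}
    (h : ∀ K : Set V, IsCompact K → Convex ℝ K → K.Nonempty → ∫⁻ x in K, f x ∂μ ≤ C) :
    ∫⁻ x, f x ∂μ ≤ C := by
  have h1 : ∀ n : ℕ, ∃ K : Set V, IsCompact K ∧ μ Kᶜ ≤ (n : ENNReal)⁻¹ := fun n => by
    obtain ⟨K, hK, hK'⟩ := isTightMeasureSet_iff_exists_isCompact_measure_compl_le.1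
      (isTightMeasureSet_singleton (μ := μ)) (n : ENNReal)⁻¹ (by simp)
    exact ⟨K, hK, hK' μ rfl⟩
  choose K hK hKm using h1
  set K' : ℕ → Set V := fun n => closure (convexHull ℝ (⋃ i ∈ Finset.range (n + 1), K i ∪ {0}))
  have hsub : ∀ n, K n ⊆ K' n := fun n x hx =>
    subset_closure (subset_convexHull ℝ _ (Set.mem_biUnion (x := n) (by simp) (Or.inl hx)))
  have hmono : Monotone K' := fun n m hnm => by
    refine closure_mono (convexHull_mono ?_)
    refine Set.biUnion_subset_biUnion_left fun i hi => ?_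
    have : i < n + 1 := Finset.mem_range.1 hi
    exact Finset.mem_coe.2 (Finset.mem_range.2 (by omega))
  have hcomp : ∀ n, IsCompact (K' n) := fun n => isCompact_closure_convexHull
    ((Finset.range (n + 1)).isCompact_biUnion fun i _ => (hK i).union isCompact_singleton)
  have hfull : μ (⋃ n, K' n)ᶜ = 0 := by
    refine le_antisymm (ge_of_tendsto' ENNReal.tendsto_inv_nat_nhds_zero fun n => ?_) bot_le
    exact (measure_mono (Set.compl_subset_compl.2 ((hsub n).trans (Set.subset_iUnion _ n)))).trans
      (hKm n)
  have hae : (⋃ n, K' n) =ᵐ[μ] Set.univ := by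
    rw [ae_eq_univ]; exact hfull
  rw [← setLIntegral_univ, ← setLIntegral_congr hae,
    setLIntegral_iUnion_of_directed _ hmono.directed_le]
  refine iSup_le fun n => h _ (hcomp n) (convex_convexHull ℝ _).closure
    ⟨0, subset_closure (subset_convexHull ℝ _ (Set.mem_biUnion (x := 0) (by simp) (Or.inr rfl)))⟩

end Compactness

/-! ### Hahn–Banach separation from an epigraph-like set -/

section Separation

variable {V : Type*} [NormedAddCommGroup V] [NormedSpace ℝ V]

/-- The open cylinder over the ball below height r' is disjoint from s, so a hyperplane separates
them. The bound 0 ≤ p.2 rescues the case of a vertical hyperplane, which is not the graph of an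
affine function. -/
lemma exists_affine_minorant {s : Set (V × ℝ)} (hs : Convex ℝ s) (h0 : ∀ p ∈ s, 0 ≤ p.2)
    {z : V} {δ r r' : ℝ} (hδ : 0 < δ) (hr : r < r')
    (hd : ∀ p ∈ s, p.1 ∈ Metric.ball z δ → r' ≤ p.2) :
    ∃ (g : StrongDual ℝ V) (c : ℝ), (∀ p ∈ s, g p.1 - c ≤ p.2) ∧ r ≤ g z - c := by
  obtain ⟨f, u, h1, h2⟩ := geometric_hahn_banach_open
    (s := Metric.ball z δ ×ˢ Set.Iio r') (t := s)
    ((convex_ball z δ).prod (convex_Iio r')) (Metric.isOpen_ball.prod isOpen_Iio) hs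
    (by
      rw [Set.disjoint_left]
      rintro p ⟨hp1, hp2⟩ hp
      exact absurd (hd p hp hp1) (not_le.2 hp2))
  set κ : ℝ := f (0, 1)
  set f₁ : StrongDual ℝ V := f.comp (ContinuousLinearMap.inl ℝ V ℝ)
  have hf : ∀ x a, f (x, a) = f₁ x + a * κ := fun x a => by
    have : ((x, a) : V × ℝ) = (x, 0) + a • (0, 1) := by simp
    rw [this, map_add, map_smul]; simp [f₁, κ]
  have hz : z ∈ Metric.ball z δ := Metric.mem_ball_self hδ
  have hz1 : ∀ a < r', f₁ z + a * κ < u := fun a ha => by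
    rw [← hf]; exact h1 _ ⟨hz, ha⟩
  have h2' : ∀ p ∈ s, u ≤ f₁ p.1 + p.2 * κ := fun p hp => by
    rw [← hf]; exact h2 p hp
  have hκ : 0 ≤ κ := by
    by_contra! hneg
    have := hz1 (min (r' - 1) ((u - f₁ z) / κ)) (by simp)
    have h3 : min (r' - 1) ((u - f₁ z) / κ) ≤ (u - f₁ z) / κ := min_le_right _ _
    have h4 := mul_le_mul_of_nonpos_right h3 hneg.le
    rw [div_mul_cancel₀ _ hneg.ne] at h4
    linarith
  rcases hκ.eq_or_lt with hκ | hκ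
  -- Vertical hyperplane: a large multiple of u - f₁ is at least |r| at z and nonpositive on s,
  -- hence below p.2 there.
  · have hz2 : f₁ z < u := by simpa [← hκ] using hz1 (r' - 1) (by simp)
    set M : ℝ := |r| / (u - f₁ z)
    have hM : 0 ≤ M := div_nonneg (abs_nonneg r) (by linarith)
    refine ⟨-(M • f₁), -(M * u), fun p hp => ?_, ?_⟩
    · have := h2' p hp
      rw [← hκ, mul_zero, add_zero] at this
      have := mul_le_mul_of_nonneg_left this hM
      have := h0 p hp
      simp only [neg_apply, smul_apply, smul_eq_mul]
      linarith
    · simp only [neg_apply, smul_apply, smul_eq_mul]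
      have : M * (u - f₁ z) = |r| := div_mul_cancel₀ _ (by linarith)
      linarith [le_abs_self r]
  · refine ⟨-(κ⁻¹ • f₁), -(κ⁻¹ * u), fun p hp => ?_, ?_⟩
    · have := mul_le_mul_of_nonneg_left (h2' p hp) (inv_pos.2 hκ).le
      have h3 : κ⁻¹ * (f₁ p.1 + p.2 * κ) = κ⁻¹ * f₁ p.1 + p.2 := by field_simp
      simp only [neg_apply, smul_apply, smul_eq_mul]
      linarith
    · have := mul_lt_mul_of_pos_left (hz1 r hr) (inv_pos.2 hκ)
      have h3 : κ⁻¹ * (f₁ z + r * κ) = κ⁻¹ * f₁ z + r := by field_simp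
      simp only [neg_apply, smul_apply, smul_eq_mul]
      linarith

end Separation

/-! ### Cramér's theorem from concatenation, tightness and duality -/

section Cramer

variable {V : Type*} [NormedAddCommGroup V] [NormedSpace ℝ V]
  [MeasurableSpace V] [BorelSpace V] [SecondCountableTopology V]

/-- The points `(z, a)` such that the empirical means of a random walk with step law `μ` visit
each neighborhood of `z` with exponential cost at most `a`. This is the epigraph of Cramér's rate
function, see `mem_cramerEpi_iff`. -/
def cramerEpi (μ : Measure V) : Set (V × ℝ) :=
  {p | ∀ ε > 0, ∀ a > p.2, ∃ n : ℕ, 1 ≤ n ∧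
    eexp (-(n * a)) ≤ iterConv μ n (Metric.closedBall ((n : ℝ) • p.1) (n * ε))}

variable {μ : Measure V} [IsProbabilityMeasure μ]

lemma cramerEpi_nonneg {p : V × ℝ} (hp : p ∈ cramerEpi μ) : 0 ≤ p.2 := by
  refine le_of_forall_gt_imp_ge_of_dense fun a ha => ?_
  obtain ⟨n, hn, h⟩ := hp 1 one_pos a ha
  have := eexp_le_one.1 (h.trans prob_le_one)
  have hn' : (0 : ℝ) < n := by exact_mod_cast hn
  nlinarith

omit [BorelSpace V] [SecondCountableTopology V] [IsProbabilityMeasure μ] in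
lemma exists_ball_of_notMem_cramerEpi {p : V × ℝ} (hp : p ∉ cramerEpi μ) :
    ∃ ε > 0, ∃ a > p.2, ∀ n : ℕ, 1 ≤ n →
      iterConv μ n (Metric.closedBall ((n : ℝ) • p.1) (n * ε)) < eexp (-(n * a)) := by
  simp only [cramerEpi, Set.mem_ofPred_eq] at hp
  push Not at hp
  exact hp

omit [NormedSpace ℝ V] [BorelSpace V] [SecondCountableTopology V] in
lemma eventually_half_le_ball (ν : Measure V) [IsProbabilityMeasure ν] :
    ∀ᶠ M : ℕ in atTop, eexp (-1) ≤ ν (Metric.closedBall 0 M) := by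
  have h1 : Monotone fun M : ℕ => Metric.closedBall (0 : V) M := fun a b hab =>
    Metric.closedBall_subset_closedBall (by exact_mod_cast hab)
  have h2 := tendsto_measure_iUnion_atTop (μ := ν) h1
  rw [Metric.iUnion_closedBall_nat, measure_univ] at h2
  have h3 : eexp (-1) < 1 := by rw [← eexp_zero, eexp_lt_eexp]; norm_num
  exact (h2.eventually (lt_mem_nhds h3)).mono fun _ h => h.le

/-- Membership in `cramerEpi` supplies only one good block length n₀. Dividing ⌊γt⌋ by n₀, the good
block is repeated and the fewer than n₀ leftover steps stay in a fixed ball with probability at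
least e⁻¹. The estimate thus holds at every large time. -/
lemma cramer_lower {p : V × ℝ} (hp : p ∈ cramerEpi μ) {γ : ℝ} (hγ : 0 ≤ γ) {ε η : ℝ}
    (hε : 0 < ε) (hη : 0 < η) :
    ∀ᶠ t : ℝ in atTop, eexp (-((γ * p.2 + η) * t)) ≤
      iterConv μ ⌊γ * t⌋₊ (Metric.closedBall ((γ * t) • p.1) (ε * t)) := by
  obtain ⟨z, a⟩ := p
  have ha0 := cramerEpi_nonneg hp
  dsimp only at ha0 ⊢
  have hγ1 : 0 < γ + 1 := by linarith
  set ε' := ε / (2 * (γ + 1))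
  set η' := η / (2 * (γ + 1))
  have hε' : 0 < ε' := by positivity
  have hη' : 0 < η' := by positivity
  have hγε : γ * ε' ≤ ε / 2 := by
    have : (γ + 1) * ε' = ε / 2 := by simp only [ε']; field_simp
    linarith
  have hγη : γ * η' ≤ η / 2 := by
    have : (γ + 1) * η' = η / 2 := by simp only [η']; field_simp
    linarith
  obtain ⟨n₀, hn₀, hcost⟩ := hp ε' hε' (a + η') (by dsimp only; linarith)
  dsimp only at hcost
  obtain ⟨M, hM⟩ := ((Finset.eventually_all (Finset.range n₀)).2 fun r _ =>
    eventually_half_le_ball (iterConv μ r)).exists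
  have e1 : ∀ᶠ t : ℝ in atTop, 1 ≤ η / 2 * t := by
    filter_upwards [eventually_ge_atTop (2 / η)] with t ht
    rw [div_le_iff₀ hη] at ht; linarith
  have e2 : ∀ᶠ t : ℝ in atTop, M + (n₀ + 1) * ‖z‖ ≤ ε / 2 * t := by
    filter_upwards [eventually_ge_atTop (2 * (M + (n₀ + 1) * ‖z‖) / ε)] with t ht
    rw [div_le_iff₀ hε] at ht; linarith
  filter_upwards [e1, e2, eventually_ge_atTop 0] with t ht1 ht2 ht0
  set N := ⌊γ * t⌋₊
  set k := N / n₀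
  set r := N % n₀
  have hN : n₀ * k + r = N := Nat.div_add_mod N n₀
  have hr : r < n₀ := Nat.mod_lt _ hn₀
  have hNle : (N : ℝ) ≤ γ * t := Nat.floor_le (by positivity)
  have hNge : γ * t < N + 1 := Nat.lt_floor_add_one _
  have hN' : (n₀ : ℝ) * k + r = N := by exact_mod_cast hN
  have hr' : (r : ℝ) < n₀ := by exact_mod_cast hr
  have hr0 : (0 : ℝ) ≤ r := Nat.cast_nonneg r
  have hk0 : (n₀ : ℝ) * k ≤ γ * t := by linarith
  have hpow : iterConv μ n₀ (Metric.closedBall ((n₀ : ℝ) • z) (n₀ * ε')) ^ k ≤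
      iterConv μ (n₀ * k) (Metric.closedBall (((n₀ : ℝ) * k) • z) (n₀ * k * ε')) := by
    refine iterConv_pow_le μ n₀
      (B := fun k : ℕ => Metric.closedBall (((n₀ : ℝ) * k) • z) (n₀ * k * ε')) (by simp) ?_ k
    intro k a ha b hb
    rw [mem_closedBall_iff_norm] at ha hb ⊢
    push_cast
    calc ‖b + a - ((n₀ : ℝ) * (k + 1)) • z‖ = ‖(b - ((n₀ : ℝ) * k) • z) + (a - (n₀ : ℝ) • z)‖ := by
          congr 1; module
      _ ≤ n₀ * k * ε' + n₀ * ε' := (norm_add_le _ _).trans (add_le_add hb ha)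
      _ = _ := by ring
  have hmul := iterConv_mul_le μ (n₀ * k) r
    (A := Metric.closedBall (((n₀ : ℝ) * k) • z) (n₀ * k * ε'))
    (B := Metric.closedBall 0 M) (C := Metric.closedBall ((γ * t) • z) (ε * t)) (by
      intro x hx y hy
      rw [mem_closedBall_iff_norm] at hx hy ⊢
      rw [sub_zero] at hy
      calc ‖x + y - (γ * t) • z‖ = ‖(x - ((n₀ : ℝ) * k) • z) + y - (γ * t - n₀ * k) • z‖ := by
            congr 1; module
        _ ≤ n₀ * k * ε' + M + (n₀ + 1) * ‖z‖ := by
            refine (norm_sub_le _ _).trans (add_le_add ((norm_add_le _ _).trans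
              (add_le_add hx hy)) ?_)
            rw [norm_smul, Real.norm_eq_abs, abs_of_nonneg (by linarith)]
            gcongr
            linarith
        _ ≤ ε * t := by
            have : (n₀ : ℝ) * k * ε' ≤ γ * t * ε' := by gcongr
            nlinarith)
  rw [hN] at hmul
  refine le_trans ?_ hmul
  calc eexp (-((γ * a + η) * t)) ≤ eexp (k * (-(n₀ * (a + η'))) + -1) := by
        rw [eexp_le_eexp]
        have h1 : (n₀ : ℝ) * k * (a + η') ≤ γ * t * (a + η') := by gcongr
        nlinarith
    _ = eexp (-(n₀ * (a + η'))) ^ k * eexp (-1) := by rw [eexp_add, eexp_nat_mul]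
    _ ≤ _ := by
        gcongr
        · exact (by gcongr : _ ≤ _).trans hpow
        · exact hM r (Finset.mem_range.2 hr)

/-- The walk spends about θt steps following p and then about θ't steps following q. The two
roundings lose at most two steps, which a large t absorbs. -/
lemma convex_cramerEpi : Convex ℝ (cramerEpi μ) := by
  rintro p hp q hq θ θ' hθ hθ' hsum ε hε a' ha'
  have hp0 := cramerEpi_nonneg hp
  have hq0 := cramerEpi_nonneg hq
  set z := (θ • p + θ' • q).1
  have hz : z = θ • p.1 + θ' • q.1 := rfl
  have ha : (θ • p + θ' • q).2 = θ * p.2 + θ' * q.2 := rfl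
  set a := θ * p.2 + θ' * q.2
  have ha0 : 0 ≤ a := by positivity
  rw [ha] at ha'
  set η := (a' - a) / 4
  have hη : 0 < η := by simp only [η]; linarith
  have e1 : ∀ᶠ t : ℝ in atTop, 3 + 2 * a' / η ≤ t := eventually_ge_atTop _
  have e2 : ∀ᶠ t : ℝ in atTop, 2 + (4 * ε + 4 * ‖z‖) / ε ≤ t := eventually_ge_atTop _
  obtain ⟨t, h1, h2, ht1, ht2⟩ := ((cramer_lower hp hθ (ε := ε / 4) (by positivity) hη).and
    ((cramer_lower hq hθ' (ε := ε / 4) (by positivity) hη).and (e1.and e2))).exists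
  have ht0 : 0 ≤ t := by
    have : 0 ≤ 2 * a' / η := by have : 0 ≤ a' := by linarith
                                positivity
    linarith
  set n₁ := ⌊θ * t⌋₊
  set n₂ := ⌊θ' * t⌋₊
  have l1 : (n₁ : ℝ) ≤ θ * t := Nat.floor_le (by positivity)
  have g1 : θ * t < n₁ + 1 := Nat.lt_floor_add_one _
  have l2 : (n₂ : ℝ) ≤ θ' * t := Nat.floor_le (by positivity)
  have g2 : θ' * t < n₂ + 1 := Nat.lt_floor_add_one _
  have hsumt : θ * t + θ' * t = t := by rw [← add_mul, hsum, one_mul]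
  have ha'0 : 0 ≤ a' := by linarith
  have hdiv : 0 ≤ 2 * a' / η := by positivity
  have hn : (1 : ℝ) ≤ (n₁ + n₂ : ℕ) := by push_cast; linarith
  refine ⟨n₁ + n₂, by exact_mod_cast hn, ?_⟩
  refine le_trans ?_ (iterConv_mul_le μ n₁ n₂ (A := Metric.closedBall ((θ * t) • p.1) (ε / 4 * t))
    (B := Metric.closedBall ((θ' * t) • q.1) (ε / 4 * t)) ?_)
  · refine le_trans ?_ (mul_le_mul' h1 h2)
    rw [← eexp_add, eexp_le_eexp]
    push_cast
    have h5 : 2 * a' ≤ η * t := by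
      have : 2 * a' / η ≤ t := by linarith
      rw [div_le_iff₀ hη] at this; linarith
    have h6 : (t - 2) * a' ≤ (n₁ + n₂) * a' := by gcongr; linarith
    have h7 : a' = a + 4 * η := by simp only [η]; ring
    have h8 : (θ * p.2 + η) * t + (θ' * q.2 + η) * t = (a + 2 * η) * t := by simp only [a]; ring
    nlinarith [mul_nonneg hη.le ht0]
  · intro x hx y hy
    rw [mem_closedBall_iff_norm] at hx hy ⊢
    have h5 : 4 * ‖z‖ + 4 * ε ≤ ε * (t - 2) := by
      have : (4 * ε + 4 * ‖z‖) / ε ≤ t - 2 := by linarith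
      rw [div_le_iff₀ hε] at this; linarith
    calc ‖x + y - ((n₁ + n₂ : ℕ) : ℝ) • z‖
        = ‖(x - (θ * t) • p.1) + (y - (θ' * t) • q.1) + (t - (n₁ + n₂)) • z‖ := by
          congr 1
          rw [hz, ← hsumt]; push_cast
          have : θ' = 1 - θ := by linarith
          subst this
          module
      _ ≤ ε / 4 * t + ε / 4 * t + 2 * ‖z‖ := by
          refine (norm_add_le _ _).trans (add_le_add ((norm_add_le _ _).trans
            (add_le_add hx hy)) ?_)
          rw [norm_smul, Real.norm_eq_abs, abs_of_nonneg (by linarith)]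
          gcongr
          linarith
      _ ≤ (t - 2) * ε := by nlinarith
      _ ≤ ((n₁ + n₂ : ℕ) : ℝ) * ε := by gcongr; push_cast; linarith

open Pointwise in
-- Since (z, g z - c - η) lies outside the epigraph, some ball around z is visited with probability
-- at most e^{-n(g z - c - η)} for every n ≥ 1. On a smaller ball g is at most g z + η. Finitely
-- many such balls cover K, so the n-th power of the integral is at most their number times e^{n(c +
-- 2η)}.
lemma lintegral_eexp_compact_le {g : StrongDual ℝ V} {c : ℝ}
    (hg : ∀ p ∈ cramerEpi μ, g p.1 - c ≤ p.2) {K : Set V} (hK : IsCompact K) (hKc : Convex ℝ K)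
    (hKn : K.Nonempty) : ∫⁻ x in K, eexp (g x) ∂μ ≤ eexp c := by
  refine le_eexp_of_forall_lt fun c' hc' => ?_
  set η := (c' - c) / 2
  have hη : 0 < η := by simp only [η]; linarith
  have hex : ∀ z : V, ∃ ε > 0, (∀ x, ‖x - z‖ ≤ ε → g x ≤ g z + η) ∧ ∀ n : ℕ, 1 ≤ n →
      iterConv μ n (Metric.closedBall ((n : ℝ) • z) (n * ε)) ≤ eexp (-(n * (g z - c - η))) := by
    intro z
    have hz : (z, g z - c - η) ∉ cramerEpi μ := fun h => by
      have := hg _ h; dsimp only at this; linarith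
    obtain ⟨ε, hε, a, ha, h⟩ := exists_ball_of_notMem_cramerEpi hz
    have hcont : ∀ᶠ x in 𝓝 z, g x < g z + η :=
      g.continuous.continuousAt.eventually (gt_mem_nhds (by linarith))
    obtain ⟨ε', hε', h'⟩ := Metric.eventually_nhds_iff.1 hcont
    refine ⟨min ε (ε' / 2), by positivity, fun x hx => (h' ?_).le, fun n hn => ?_⟩
    · rw [dist_eq_norm]
      have := min_le_right ε (ε' / 2)
      linarith
    · refine ((measure_mono (Metric.closedBall_subset_closedBall ?_)).trans (h n hn).le).trans ?_
      · gcongr; exact min_le_left _ _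
      · rw [eexp_le_eexp]; dsimp only at ha; gcongr
  choose ε hε hgε hcost using hex
  obtain ⟨s, hs, hcov⟩ := hK.elim_nhds_subcover (fun z => Metric.closedBall z (ε z))
    fun z _ => Metric.closedBall_mem_nhds z (hε z)
  refine le_of_forall_pow_le (C := (s.card + 1 : ℕ)) (ENNReal.natCast_ne_top _) (eexp_ne_zero _)
    (eexp_ne_top _) fun n => ?_
  rcases Nat.eq_zero_or_pos n with rfl | hn
  · simp
  have hn0 : (0 : ℝ) < n := by exact_mod_cast hn
  refine (setLIntegral_eexp_pow_le μ g hK hKc hKn n).trans ?_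
  have hball : ∀ z x : V, x ∈ Metric.closedBall ((n : ℝ) • z) (n * ε z) →
      g x ≤ n * (g z + η) := by
    intro z x hx
    have h1 : ‖(n : ℝ)⁻¹ • x - z‖ ≤ ε z := by
      rw [mem_closedBall_iff_norm] at hx
      have : (n : ℝ)⁻¹ • x - z = (n : ℝ)⁻¹ • (x - (n : ℝ) • z) := by
        rw [smul_sub, inv_smul_smul₀ hn0.ne']
      rw [this, norm_smul, norm_inv, Real.norm_eq_abs, abs_of_pos hn0, inv_mul_le_iff₀ hn0]
      exact hx
    have h2 := hgε z _ h1
    rw [map_smul, smul_eq_mul, inv_mul_le_iff₀ hn0] at h2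
    exact h2
  calc ∫⁻ x in (n : ℝ) • K, eexp (g x) ∂(iterConv μ n)
      ≤ ∫⁻ x in ⋃ z ∈ s, Metric.closedBall ((n : ℝ) • z) (n * ε z), eexp (g x)
          ∂(iterConv μ n) := by
        refine lintegral_mono_set ?_
        rintro _ ⟨x, hx, rfl⟩
        obtain ⟨z, hz, hxz⟩ := Set.mem_iUnion₂.1 (hcov hx)
        refine Set.mem_iUnion₂.2 ⟨z, hz, ?_⟩
        rw [mem_closedBall_iff_norm] at hxz ⊢
        simp only
        rw [← smul_sub, norm_smul, Real.norm_eq_abs, abs_of_pos hn0]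
        gcongr
    _ ≤ ∑ z ∈ s, ∫⁻ x in Metric.closedBall ((n : ℝ) • z) (n * ε z), eexp (g x)
          ∂(iterConv μ n) := by
        have hU : ⋃ z ∈ s, Metric.closedBall ((n : ℝ) • z) (n * ε z) =
            ⋃ z : s, Metric.closedBall ((n : ℝ) • (z : V)) (n * ε z) := by ext; simp
        rw [← Finset.sum_coe_sort s fun z => ∫⁻ x in Metric.closedBall ((n : ℝ) • z) (n * ε z),
          eexp (g x) ∂(iterConv μ n), hU, ← tsum_fintype (L := .unconditional _)]
        exact lintegral_iUnion_le _ _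
    _ ≤ ∑ z ∈ s, eexp c' ^ n := by
        refine Finset.sum_le_sum fun z _ => ?_
        calc _ ≤ ∫⁻ x in Metric.closedBall ((n : ℝ) • z) (n * ε z), eexp (n * (g z + η))
                ∂(iterConv μ n) :=
              setLIntegral_mono measurable_const fun x hx => eexp_le_eexp.2 (hball z x hx)
          _ ≤ eexp (n * (g z + η)) * eexp (-(n * (g z - c - η))) := by
              rw [setLIntegral_const]; gcongr; exact hcost z n hn
          _ = eexp c' ^ n := by
              rw [← eexp_add, ← eexp_nat_mul]; congr 1; simp only [η]; ring
    _ ≤ (s.card + 1 : ℕ) * eexp c' ^ n := by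
        rw [Finset.sum_const, nsmul_eq_mul]; gcongr; simp

lemma lintegral_eexp_le [CompleteSpace V] {g : StrongDual ℝ V} {c : ℝ}
    (hg : ∀ p ∈ cramerEpi μ, g p.1 - c ≤ p.2) : ∫⁻ x, eexp (g x) ∂μ ≤ eexp c :=
  lintegral_le_of_forall_compact μ fun _ hK hKc hKn => lintegral_eexp_compact_le hg hK hKc hKn

/-- On an empty epigraph the affine function with g = 0, c = -1 would be a minorant, giving 1 ≤ e⁻¹.
-/
lemma cramerEpi_nonempty [CompleteSpace V] : (cramerEpi μ).Nonempty := by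
  by_contra! h
  have := lintegral_eexp_le (μ := μ) (g := 0) (c := -1) (by simp [h])
  simp only [zero_apply, eexp_zero, lintegral_const, measure_univ,
    mul_one] at this
  exact absurd this (not_le.2 (by rw [← eexp_zero, eexp_lt_eexp]; norm_num))

lemma iterConv_le_chernoff (g : StrongDual ℝ V) {c : ℝ} (n : ℕ) {A : Set V}
    (hA : ∀ x ∈ A, c ≤ g x) :
    iterConv μ n A ≤ eexp (-c) * (∫⁻ x, eexp (g x) ∂μ) ^ n := by
  have hm : Measurable fun x => eexp (g x) := measurable_eexp.comp g.continuous.measurable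
  have h1 : eexp c * iterConv μ n A ≤ (∫⁻ x, eexp (g x) ∂μ) ^ n := by
    rw [← lintegral_eexp_iterConv]
    refine le_trans ?_ (mul_meas_ge_le_lintegral hm (eexp c))
    gcongr
    intro x hx
    exact eexp_le_eexp.2 (hA x hx)
  calc iterConv μ n A = eexp (-c) * (eexp c * iterConv μ n A) := by
        rw [← mul_assoc, eexp_neg_mul_self, one_mul]
    _ ≤ _ := by gcongr

/-- **Cramér's theorem** for separable Banach spaces: the exponential cost of visiting
neighborhoods of a point is the convex conjugate of the cumulant generating function. -/
lemma mem_cramerEpi_iff [CompleteSpace V] {z : V} {a : ℝ} :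
    (z, a) ∈ cramerEpi μ ↔ ∀ g : StrongDual ℝ V, eexp (g z - a) ≤ ∫⁻ x, eexp (g x) ∂μ := by
  constructor
  · intro h g
    refine eexp_le_of_forall_lt fun y hy => ?_
    by_contra! hlt
    set η := (g z - a - y) / 2
    have hη : 0 < η := by simp only [η]; linarith
    have hcont : ∀ᶠ x in 𝓝 z, g z - η < g x :=
      g.continuous.continuousAt.eventually (lt_mem_nhds (by linarith))
    obtain ⟨ε, hε, h'⟩ := Metric.eventually_nhds_iff.1 hcont
    obtain ⟨n, hn, hc⟩ := h (ε / 2) (by positivity) (a + η) (by dsimp only; linarith)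
    have hn0 : (0 : ℝ) < n := by exact_mod_cast hn
    have h2 := hc.trans (iterConv_le_chernoff g (c := n * (g z - η)) n fun x hx => by
      have h1 : dist ((n : ℝ)⁻¹ • x) z < ε := by
        dsimp only at hx
        rw [mem_closedBall_iff_norm] at hx
        have : (n : ℝ)⁻¹ • x - z = (n : ℝ)⁻¹ • (x - (n : ℝ) • z) := by
          rw [smul_sub, inv_smul_smul₀ hn0.ne']
        rw [dist_eq_norm, this, norm_smul, norm_inv, Real.norm_eq_abs, abs_of_pos hn0,
          inv_mul_lt_iff₀ hn0]
        nlinarith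
      have h2 := (h' h1).le
      rw [map_smul, smul_eq_mul, ← div_eq_inv_mul, le_div_iff₀ hn0] at h2
      linarith)
    have h3 : eexp (-(n * (g z - η))) * (∫⁻ x, eexp (g x) ∂μ) ^ n <
        eexp (-(n * (g z - η))) * eexp y ^ n := by
      rw [ENNReal.mul_lt_mul_iff_right (eexp_ne_zero _) (eexp_ne_top _)]
      exact ENNReal.pow_lt_pow_left (by omega) hlt
    rw [← eexp_nat_mul, ← eexp_add] at h3
    have h4 := eexp_lt_eexp.1 (h2.trans_lt h3)
    have : a + η = g z - y - η := by simp only [η]; ring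
    rw [this] at h4
    linarith
  · intro h
    by_contra hn
    obtain ⟨ε, hε, a', ha', hc⟩ := exists_ball_of_notMem_cramerEpi hn
    dsimp only at hc ha'
    -- A point of the epigraph near z with height below a' would make the ball around z too likely.
    -- Hence a separating affine minorant exceeds a at z, while `lintegral_eexp_le` bounds its Λ by
    -- c, which contradicts the assumption on z.
    obtain ⟨g, c, hg, hgz⟩ := exists_affine_minorant (convex_cramerEpi (μ := μ))
      (fun p hp => cramerEpi_nonneg hp) (z := z) (δ := ε / 2) (r := (a + a') / 2) (r' := a')
      (by positivity) (by linarith) (by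
        intro p hp hpz
        by_contra! hlt
        obtain ⟨n, hn, hcn⟩ := hp (ε / 2) (by positivity) a' hlt
        refine absurd (hcn.trans (measure_mono ?_)) (not_le.2 (hc n hn))
        refine Metric.closedBall_subset_closedBall' ?_
        rw [dist_eq_norm, ← smul_sub, norm_smul, Real.norm_natCast]
        rw [mem_ball_iff_norm] at hpz
        have : (n : ℝ) * ‖p.1 - z‖ ≤ n * (ε / 2) := by gcongr
        linarith)
    have h1 := (h g).trans (lintegral_eexp_le hg)
    rw [eexp_le_eexp] at h1
    linarith

end Cramer

/-! ### The support function of {Λ ≤ 0} and the cone over the epigraph -/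

section DualRate

variable {V : Type*} [NormedAddCommGroup V] [NormedSpace ℝ V] [MeasurableSpace V]

/-- The support function of the sublevel set `{Λ ≤ 0}` of the cumulant generating function. -/
def dualRate (μ : Measure V) (z : V) : EReal :=
  ⨆ (g : StrongDual ℝ V) (_ : ∫⁻ x, eexp (g x) ∂μ ≤ 1), ((g z : ℝ) : EReal)

variable {μ : Measure V}

lemma le_dualRate {g : StrongDual ℝ V} (hg : ∫⁻ x, eexp (g x) ∂μ ≤ 1) (z : V) :
    ((g z : ℝ) : EReal) ≤ dualRate μ z :=
  le_iSup₂_of_le g hg le_rfl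

lemma dualRate_le_iff {z : V} {y : EReal} : dualRate μ z ≤ y ↔
    ∀ g : StrongDual ℝ V, ∫⁻ x, eexp (g x) ∂μ ≤ 1 → ((g z : ℝ) : EReal) ≤ y :=
  iSup₂_le_iff

lemma lt_dualRate_iff {z : V} {y : EReal} : y < dualRate μ z ↔
    ∃ g : StrongDual ℝ V, ∫⁻ x, eexp (g x) ∂μ ≤ 1 ∧ y < ((g z : ℝ) : EReal) := by
  simp [dualRate, lt_iSup_iff]

lemma dualRate_nonneg [IsProbabilityMeasure μ] (z : V) : 0 ≤ dualRate μ z := by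
  simpa using le_dualRate (μ := μ) (g := 0) (by simp) z

lemma dualRate_combo_le {z₁ z₂ : V} {a b x₁ x₂ : ℝ} (ha : 0 ≤ a) (hb : 0 ≤ b)
    (h₁ : dualRate μ z₁ ≤ x₁) (h₂ : dualRate μ z₂ ≤ x₂) :
    dualRate μ (a • z₁ + b • z₂) ≤ ((a * x₁ + b * x₂ : ℝ) : EReal) := by
  refine dualRate_le_iff.2 fun g hg => ?_
  have e₁ := EReal.coe_le_coe_iff.1 ((le_dualRate hg z₁).trans h₁)
  have e₂ := EReal.coe_le_coe_iff.1 ((le_dualRate hg z₂).trans h₂)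
  rw [EReal.coe_le_coe_iff, map_add, map_smul, map_smul, smul_eq_mul, smul_eq_mul]
  gcongr

lemma lowerSemicontinuous_dualRate : LowerSemicontinuous (dualRate μ) := by
  refine lowerSemicontinuous_iSup fun g => lowerSemicontinuous_iSup fun _ => ?_
  exact (continuous_coe_real_ereal.comp g.continuous).lowerSemicontinuous

/-- The cone generated by the epigraph of Cramér's rate function. -/
def cramerCone (μ : Measure V) : Set (V × ℝ) :=
  {p | ∃ γ : ℝ, 0 < γ ∧ γ⁻¹ • p ∈ cramerEpi μ}

variable [BorelSpace V] [SecondCountableTopology V] [IsProbabilityMeasure μ]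

/-- Scales add: the combination has scale aγ₁ + bγ₂, and normalizing by it gives a convex
combination in the epigraph. -/
lemma convex_cramerCone : Convex ℝ (cramerCone μ) := by
  rintro p ⟨γ₁, h₁, hp⟩ q ⟨γ₂, h₂, hq⟩ a b ha hb hab
  have hpos : 0 < a * γ₁ + b * γ₂ := by
    rcases ha.eq_or_lt with rfl | ha
    · have : b = 1 := by linarith
      subst this; simpa using h₂
    · positivity
  refine ⟨a * γ₁ + b * γ₂, hpos, ?_⟩
  have := convex_cramerEpi (μ := μ) hp hq (a := a * γ₁ / (a * γ₁ + b * γ₂))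
    (b := b * γ₂ / (a * γ₁ + b * γ₂)) (by positivity) (by positivity) (by field_simp)
  convert this using 1
  rw [smul_add, smul_smul, smul_smul, smul_smul, smul_smul]
  congr 2 <;> field_simp

lemma cramerCone_nonneg {p : V × ℝ} (hp : p ∈ cramerCone μ) : 0 ≤ p.2 := by
  obtain ⟨γ, hγ, h⟩ := hp
  have := cramerEpi_nonneg h
  rw [Prod.smul_snd, smul_eq_mul] at this
  exact (mul_nonneg_iff_of_pos_left (inv_pos.2 hγ)).1 this

lemma smul_mem_cramerCone {p : V × ℝ} (hp : p ∈ cramerCone μ) {c : ℝ} (hc : 0 < c) :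
    c • p ∈ cramerCone μ := by
  obtain ⟨γ, hγ, h⟩ := hp
  refine ⟨c * γ, by positivity, ?_⟩
  convert h using 1
  rw [smul_smul]; congr 1; field_simp

variable [CompleteSpace V]

lemma dualRate_le_of_mem_cramerCone {z : V} {a : ℝ} (h : (z, a) ∈ cramerCone μ) :
    dualRate μ z ≤ a := by
  obtain ⟨γ, hγ, h⟩ := h
  refine dualRate_le_iff.2 fun g hg => ?_
  have h1 := eexp_le_one.1 ((mem_cramerEpi_iff.1 (by exact h) g).trans hg)
  rw [map_smul, smul_eq_mul, smul_eq_mul, ← mul_sub] at h1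
  have := (mul_nonpos_iff_pos_imp_nonpos.1 h1).1 (inv_pos.2 hγ)
  exact EReal.coe_le_coe_iff.2 (by linarith)

/-- An affine minorant of a cone has a linear minorant above it: scaling by large factors gives g z
≤ a on the cone, and scaling by small factors gives c ≥ 0. The linear minorant then satisfies Λ(g) ≤
0, and g z ≥ g z - c ≥ r. -/
lemma le_dualRate_of_forall_cramerCone {z : V} {δ r r' : ℝ} (hδ : 0 < δ) (hr : r < r')
    (h : ∀ p ∈ cramerCone μ, p.1 ∈ Metric.ball z δ → r' ≤ p.2) : (r : EReal) ≤ dualRate μ z := by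
  obtain ⟨g, c, hg, hgz⟩ := exists_affine_minorant convex_cramerCone
    (fun p hp => cramerCone_nonneg hp) hδ hr h
  have hscale : ∀ p ∈ cramerCone μ, ∀ t : ℝ, 0 < t → t * g p.1 - c ≤ t * p.2 := fun p hp t ht => by
    simpa using hg _ (smul_mem_cramerCone hp ht)
  have hle : ∀ p ∈ cramerCone μ, g p.1 ≤ p.2 := fun p hp => by
    by_contra! hlt
    have := hscale p hp ((|c| + 1) / (g p.1 - p.2)) (div_pos (by positivity) (by linarith))
    have h2 : (|c| + 1) / (g p.1 - p.2) * (g p.1 - p.2) = |c| + 1 :=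
      div_mul_cancel₀ _ (by linarith)
    linarith [le_abs_self c]
  have hsub : ∀ p ∈ cramerEpi μ, p ∈ cramerCone μ := fun p hp => ⟨1, one_pos, by simpa⟩
  have hc : 0 ≤ c := by
    obtain ⟨p, hp⟩ := cramerEpi_nonempty (μ := μ)
    by_contra! hneg
    have h1 := hle p (hsub p hp)
    have := hscale p (hsub p hp) (-c / (2 * (p.2 - g p.1 + 1)))
      (div_pos (by linarith) (by linarith))
    have h2 : -c / (2 * (p.2 - g p.1 + 1)) * (p.2 - g p.1 + 1) = -c / 2 := by
      field_simp [show p.2 - g p.1 + 1 ≠ 0 by linarith]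
    have h3 : 0 < -c / (2 * (p.2 - g p.1 + 1)) := div_pos (by linarith) (by linarith)
    linarith
  have hint : ∫⁻ x, eexp (g x) ∂μ ≤ 1 := by
    rw [← eexp_zero]
    exact lintegral_eexp_le fun p hp => by simpa using hle p (hsub p hp)
  exact le_trans (EReal.coe_le_coe_iff.2 (by linarith)) (le_dualRate hint z)

end DualRate

/-! ### Identification of Υ with the support function -/

section Upsilon

lemma coe_sub_log_le_iff {x a : ℝ} {m : ENNReal} :
    (x : EReal) - ENNReal.log m ≤ a ↔ eexp (x - a) ≤ m := by
  rcases eq_or_ne m ⊤ with rfl | ht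
  · simp
  rcases eq_or_ne m 0 with rfl | h0
  · simp [eexp_ne_zero]
  obtain ⟨y, rfl⟩ := exists_eexp_eq h0 ht
  rw [log_eexp, eexp_le_eexp, ← EReal.coe_sub, EReal.coe_le_coe_iff]
  constructor <;> intro h <;> linarith

variable {Ω E : Type*} [MeasurableSpace Ω] [NormedAddCommGroup E] [NormedSpace ℝ E]
  [MeasurableSpace E] [BorelSpace E] [SecondCountableTopology E]

/-- The joint law of a waiting time and a reward. -/
def stepLaw (P : Measure Ω) (s : Ω → ℝ) (x : Ω → E) : Measure (ℝ × E) :=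
  P.map fun ω => (s ω, x ω)

variable {P : Measure Ω} {s : Ω → ℝ} {x : Ω → E}

/-- A functional on ℝ × E is the same as a pair (ζ, φ), and in this form no extended subtraction
remains. -/
lemma cramerRate_le_iff (hs : Measurable s) (hx : Measurable x) {b a : ℝ} {w : E} :
    cramerRate P s x b w ≤ a ↔ ∀ g : StrongDual ℝ (ℝ × E),
      eexp (g (b, w) - a) ≤ ∫⁻ z, eexp (g z) ∂(stepLaw P s x) := by
  have key : ∀ g : StrongDual ℝ (ℝ × E), ∫⁻ z, eexp (g z) ∂(stepLaw P s x) =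
      ∫⁻ ω, eexp (g (s ω, x ω)) ∂P := fun g => by
    exact lintegral_map (f := fun z => eexp (g z))
      (measurable_eexp.comp g.continuous.measurable) (hs.prodMk hx)
  simp only [cramerRate, iSup_le_iff, coe_sub_log_le_iff, key]
  constructor
  · intro h g
    have hg : ∀ c v, g (c, v) = g (1, 0) * c + g.comp (ContinuousLinearMap.inr ℝ ℝ E) v := by
      intro c v
      have : ((c, v) : ℝ × E) = c • (1, 0) + (0, v) := by simp
      rw [this, map_add, map_smul]
      simp [mul_comm]
    have := h (g (1, 0)) (g.comp (ContinuousLinearMap.inr ℝ ℝ E))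
    simp only [jointMgf] at this
    rw [hg b w, mul_comm]
    refine this.trans (le_of_eq (lintegral_congr fun ω => ?_))
    rw [hg (s ω) (x ω)]; rfl
  · intro h ζ φ
    have := h (ζ • ContinuousLinearMap.fst ℝ ℝ E + φ.comp (ContinuousLinearMap.snd ℝ ℝ E))
    simp only [jointMgf]
    simpa [mul_comm b ζ, eexp] using this

variable [IsProbabilityMeasure P] [CompleteSpace E]

lemma isProbabilityMeasure_stepLaw (hs : Measurable s) (hx : Measurable x) :
    IsProbabilityMeasure (stepLaw P s x) :=
  Measure.isProbabilityMeasure_map (hs.prodMk hx).aemeasurable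

omit [MeasurableSpace E] [BorelSpace E] [SecondCountableTopology E] [CompleteSpace E] in
lemma cramerRate_nonneg (b : ℝ) (w : E) : 0 ≤ cramerRate P s x b w := by
  refine le_iSup₂_of_le 0 0 ?_
  simp [jointMgf]

lemma mem_cramerEpi_stepLaw_iff (hs : Measurable s) (hx : Measurable x) {b a : ℝ} {w : E} :
    ((b, w), a) ∈ cramerEpi (stepLaw P s x) ↔ cramerRate P s x b w ≤ a := by
  have := isProbabilityMeasure_stepLaw (P := P) hs hx
  rw [mem_cramerEpi_iff, cramerRate_le_iff hs hx]

lemma infPerspective_le_of_mem (hs : Measurable s) (hx : Measurable x) {z : ℝ × E} {a : ℝ}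
    (h : (z, a) ∈ cramerCone (stepLaw P s x)) : infPerspective P s x z.1 z.2 ≤ a := by
  obtain ⟨γ, hγ, h⟩ := h
  refine iInf₂_le_of_le γ hγ ?_
  have h1 : cramerRate P s x (z.1 / γ) (γ⁻¹ • z.2) ≤ ((γ⁻¹ * a : ℝ) : EReal) := by
    rw [← mem_cramerEpi_stepLaw_iff hs hx, div_eq_inv_mul]
    exact h
  refine (mul_le_mul_of_nonneg_left h1 (EReal.coe_nonneg.2 hγ.le)).trans ?_
  rw [← EReal.coe_mul, mul_inv_cancel_left₀ hγ.ne']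

lemma exists_mem_cramerCone_of_lt (hs : Measurable s) (hx : Measurable x) {z : ℝ × E} {r : ℝ}
    (h : infPerspective P s x z.1 z.2 < r) :
    ∃ a < r, (z, a) ∈ cramerCone (stepLaw P s x) := by
  obtain ⟨γ, h⟩ := iInf_lt_iff.1 h
  obtain ⟨hγ, h⟩ := iInf_lt_iff.1 h
  have h0 := cramerRate_nonneg (P := P) (s := s) (x := x) (z.1 / γ) (γ⁻¹ • z.2)
  rcases eq_or_ne (cramerRate P s x (z.1 / γ) (γ⁻¹ • z.2)) ⊤ with ht | ht
  · rw [ht, EReal.coe_mul_top_of_pos hγ] at h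
    exact absurd h not_top_lt
  · have hb : cramerRate P s x (z.1 / γ) (γ⁻¹ • z.2) ≠ ⊥ := (lt_of_lt_of_le (by decide) h0).ne'
    obtain ⟨c, hc⟩ : ∃ c : ℝ, (c : EReal) = cramerRate P s x (z.1 / γ) (γ⁻¹ • z.2) :=
      ⟨_, EReal.coe_toReal ht hb⟩
    have hc' := hc.symm
    rw [hc', ← EReal.coe_mul, EReal.coe_lt_coe_iff] at h
    refine ⟨γ * c, h, γ, hγ, ?_⟩
    have : γ⁻¹ • (z, γ * c) = ((z.1 / γ, γ⁻¹ • z.2), c) := by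
      ext <;> simp [div_eq_inv_mul, hγ.ne']
    rw [this, mem_cramerEpi_stepLaw_iff hs hx, hc']

lemma dualRate_le_infPerspective (hs : Measurable s) (hx : Measurable x) (z : ℝ × E) :
    dualRate (stepLaw P s x) z ≤ infPerspective P s x z.1 z.2 := by
  have := isProbabilityMeasure_stepLaw (P := P) hs hx
  by_contra! hlt
  obtain ⟨r, h1, h2⟩ := EReal.lt_iff_exists_real_btwn.1 hlt
  obtain ⟨a, ha, h⟩ := exists_mem_cramerCone_of_lt hs hx h1
  exact absurd ((dualRate_le_of_mem_cramerCone h).trans_lt (EReal.coe_lt_coe_iff.2 ha)) h2.not_gt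

lemma mem_ball_prod_iff {z z' : ℝ × E} {δ : ℝ} : z' ∈ Metric.ball z δ ↔
    z'.1 ∈ Set.Ioo (z.1 - δ) (z.1 + δ) ∧ z'.2 ∈ Metric.ball z.2 δ := by
  rw [← Real.ball_eq_Ioo, Metric.mem_ball, Prod.dist_eq, max_lt_iff]; rfl

/-- The regularization `Υ` is the support function of the set `{Λ ≤ 0}`. -/
lemma upsilon_eq_dualRate (hs : Measurable s) (hx : Measurable x) (β : ℝ) (w : E) :
    upsilon P s x β w = dualRate (stepLaw P s x) (β, w) := by
  have := isProbabilityMeasure_stepLaw (P := P) hs hx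
  apply le_antisymm
  · by_contra! hlt
    obtain ⟨r', h1, h2⟩ := EReal.lt_iff_exists_real_btwn.1 hlt
    obtain ⟨r, h0, h1⟩ := EReal.lt_iff_exists_real_btwn.1 h1
    obtain ⟨δ, h2⟩ := lt_iSup_iff.1 h2
    obtain ⟨hδ, h2⟩ := lt_iSup_iff.1 h2
    refine absurd (le_dualRate_of_forall_cramerCone hδ (EReal.coe_lt_coe_iff.1 h1) ?_)
      (not_le.2 h0)
    intro p hp hpb
    obtain ⟨hb, hv⟩ := mem_ball_prod_iff.1 hpb
    have h3 := h2.le.trans ((iInf₂_le p.1.1 hb).trans (iInf₂_le p.1.2 hv))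
    exact EReal.coe_le_coe_iff.1 (h3.trans (infPerspective_le_of_mem hs hx hp))
  · by_contra! hlt
    obtain ⟨r, h1, h2⟩ := EReal.lt_iff_exists_real_btwn.1 hlt
    obtain ⟨δ, hδ, h3⟩ := Metric.eventually_nhds_iff_ball.1
      (lowerSemicontinuous_dualRate (β, w) _ h2)
    refine absurd h1 (not_lt.2 (le_iSup₂_of_le δ hδ ?_))
    refine le_iInf₂ fun b hb => le_iInf₂ fun v hv => ?_
    exact (h3 (b, v) (mem_ball_prod_iff.2 ⟨hb, hv⟩)).le.trans (dualRate_le_infPerspective hs hx _)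

/-- The entry point of the lower bounds: Υ is a regularization, so only points near (β, w) are known
to be reachable at a cost below a. -/
lemma exists_cramerCone_of_upsilon_lt (hs : Measurable s) (hx : Measurable x) {β a δ : ℝ} {w : E}
    (h : upsilon P s x β w < a) (hδ : 0 < δ) :
    ∃ z ∈ Metric.ball (β, w) δ, ∃ a' < a, (z, a') ∈ cramerCone (stepLaw P s x) := by
  have h1 := (le_iSup₂ (f := fun δ (_ : (0 : ℝ) < δ) => ⨅ b ∈ Set.Ioo (β - δ) (β + δ),
    ⨅ v ∈ Metric.ball w δ, infPerspective P s x b v) δ hδ).trans_lt h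
  simp only [iInf_lt_iff] at h1
  obtain ⟨b, hb, v, hv, h1⟩ := h1
  exact ⟨(b, v), mem_ball_prod_iff.2 ⟨hb, hv⟩, exists_mem_cramerCone_of_lt hs hx h1⟩

end Upsilon

/-! ### Nonnegativity, convexity and lower semicontinuity of the rate functions -/

section RateFunction

lemma ereal_convex_of_forall_real {E : Type*} [NormedAddCommGroup E] [NormedSpace ℝ E]
    {I : E → EReal} (h0 : ∀ w, 0 ≤ I w)
    (h : ∀ w₁ w₂ : E, ∀ a b : ℝ, 0 < a → 0 < b → a + b = 1 → ∀ x₁ x₂ : ℝ, I w₁ < x₁ → I w₂ < x₂ →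
      I (a • w₁ + b • w₂) ≤ ((a * x₁ + b * x₂ : ℝ) : EReal)) : ERealConvex I := by
  intro w₁ w₂ a b ha hb hab
  rcases ha.eq_or_lt with rfl | ha
  · obtain rfl : b = 1 := by linarith
    simp
  rcases hb.eq_or_lt with rfl | hb
  · obtain rfl : a = 1 := by linarith
    simp
  have hnn : ∀ (c : ℝ) (w : E), 0 < c → 0 ≤ (c : EReal) * I w := fun c w hc =>
    mul_nonneg (EReal.coe_nonneg.2 hc.le) (h0 w)
  have hbot : ∀ (c : ℝ) (w : E), 0 < c → (c : EReal) * I w ≠ ⊥ := fun c w hc =>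
    (lt_of_lt_of_le (by decide) (hnn c w hc)).ne'
  rcases eq_or_ne (I w₁) ⊤ with ht | ht₁
  · rw [ht, EReal.coe_mul_top_of_pos ha, EReal.top_add_of_ne_bot (hbot b w₂ hb)]; exact le_top
  rcases eq_or_ne (I w₂) ⊤ with ht | ht₂
  · rw [ht, EReal.coe_mul_top_of_pos hb, EReal.add_top_of_ne_bot (hbot a w₁ ha)]; exact le_top
  have hb₁ : I w₁ ≠ ⊥ := (lt_of_lt_of_le (by decide) (h0 w₁)).ne'
  have hb₂ : I w₂ ≠ ⊥ := (lt_of_lt_of_le (by decide) (h0 w₂)).ne'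
  lift I w₁ to ℝ using ⟨ht₁, hb₁⟩ with y₁ hy₁
  lift I w₂ to ℝ using ⟨ht₂, hb₂⟩ with y₂ hy₂
  rw [← EReal.coe_mul, ← EReal.coe_mul, ← EReal.coe_add]
  by_contra! hlt
  obtain ⟨r, h1, h2⟩ := EReal.lt_iff_exists_real_btwn.1 hlt
  rw [EReal.coe_lt_coe_iff] at h1
  set η := r - (a * y₁ + b * y₂)
  have hη : 0 < η := by simp only [η]; linarith
  have := h w₁ w₂ a b ha hb hab (y₁ + η) (y₂ + η)
    (by rw [← hy₁, EReal.coe_lt_coe_iff]; linarith)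
    (by rw [← hy₂, EReal.coe_lt_coe_iff]; linarith)
  have h3 : a * (y₁ + η) + b * (y₂ + η) = r := by
    have : a * (y₁ + η) + b * (y₂ + η) = a * y₁ + b * y₂ + (a + b) * η := by ring
    rw [this, hab]; simp only [η]; ring
  rw [h3] at this
  exact absurd h2 (not_lt.2 this)

variable {Ω E : Type*} [MeasurableSpace Ω] [NormedAddCommGroup E] [NormedSpace ℝ E]
  [MeasurableSpace E] [BorelSpace E] [SecondCountableTopology E] [CompleteSpace E]
  {P : Measure Ω} [IsProbabilityMeasure P] {s : Ω → ℝ} {x : Ω → E}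

lemma rateOf_top (hs : Measurable s) (hx : Measurable x) (w : E) :
    rateOf P s x ⊤ w = dualRate (stepLaw P s x) (1, w) := by
  simp [rateOf, upsilon_eq_dualRate hs hx]

lemma rateOf_coe (hs : Measurable s) (hx : Measurable x) (L : ℝ) (w : E) :
    rateOf P s x L w = ⨅ β ∈ Set.Icc (0 : ℝ) 1,
      dualRate (stepLaw P s x) (β, w) + (((1 - β) * L : ℝ) : EReal) := by
  simp [rateOf, upsilon_eq_dualRate hs hx]

lemma add_coe_lt_coe_iff {y : EReal} {a b : ℝ} :
    y + (a : EReal) < b ↔ y < ((b - a : ℝ) : EReal) := by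
  induction y with
  | bot => simp [EReal.bot_lt_coe, -EReal.coe_sub]
  | top => simp [-EReal.coe_sub]
  | coe y => rw [← EReal.coe_add, EReal.coe_lt_coe_iff, EReal.coe_lt_coe_iff, lt_sub_iff_add_lt]

lemma add_coe_le_coe_iff {y : EReal} {a b : ℝ} :
    y + (a : EReal) ≤ b ↔ y ≤ ((b - a : ℝ) : EReal) := by
  induction y with
  | bot => simp
  | top => simp [-EReal.coe_sub]
  | coe y => rw [← EReal.coe_add, EReal.coe_le_coe_iff, EReal.coe_le_coe_iff, le_sub_iff_add_le]

lemma rateOf_coe_lt_iff (hs : Measurable s) (hx : Measurable x) {L r : ℝ} {w : E} :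
    rateOf P s x L w < r ↔ ∃ β ∈ Set.Icc (0 : ℝ) 1,
      dualRate (stepLaw P s x) (β, w) < ((r - (1 - β) * L : ℝ) : EReal) := by
  simp only [rateOf_coe hs hx, iInf_lt_iff, add_coe_lt_coe_iff, exists_prop]

lemma rateOf_coe_le (hs : Measurable s) (hx : Measurable x) {L r β : ℝ} {w : E}
    (hβ : β ∈ Set.Icc (0 : ℝ) 1)
    (h : dualRate (stepLaw P s x) (β, w) ≤ ((r - (1 - β) * L : ℝ) : EReal)) :
    rateOf P s x L w ≤ r := by
  rw [rateOf_coe hs hx]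
  exact iInf₂_le_of_le β hβ (add_coe_le_coe_iff.2 h)

/-- An extended real decay rate that is nonnegative is either `⊤` or a nonnegative real. -/
lemma ereal_nonneg_cases {ℓ : EReal} (h : 0 ≤ ℓ) : ℓ = ⊤ ∨ ∃ L : ℝ, 0 ≤ L ∧ ℓ = L := by
  induction ℓ with
  | bot => exact absurd h (by decide)
  | top => exact Or.inl rfl
  | coe y => exact Or.inr ⟨y, EReal.coe_nonneg.1 h, rfl⟩

lemma rateOf_nonneg (hs : Measurable s) (hx : Measurable x) {ℓ : EReal} (hℓ : 0 ≤ ℓ) (w : E) :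
    0 ≤ rateOf P s x ℓ w := by
  have := isProbabilityMeasure_stepLaw (P := P) hs hx
  rcases ereal_nonneg_cases hℓ with rfl | ⟨L, hL, rfl⟩
  · rw [rateOf_top hs hx]; exact dualRate_nonneg _
  · rw [rateOf_coe hs hx]
    refine le_iInf₂ fun β hβ => add_nonneg (dualRate_nonneg _) (EReal.coe_nonneg.2 ?_)
    exact mul_nonneg (by linarith [hβ.2]) hL

lemma rateOf_convex (hs : Measurable s) (hx : Measurable x) {ℓ : EReal} (hℓ : 0 ≤ ℓ) :
    ERealConvex (rateOf P s x ℓ) := by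
  refine ereal_convex_of_forall_real (rateOf_nonneg hs hx hℓ) ?_
  intro w₁ w₂ a b ha hb hab x₁ x₂ h₁ h₂
  rcases ereal_nonneg_cases hℓ with rfl | ⟨L, hL, rfl⟩
  · rw [rateOf_top hs hx] at h₁ h₂ ⊢
    have := dualRate_combo_le ha.le hb.le h₁.le h₂.le
    simpa [hab] using this
  · obtain ⟨β₁, hβ₁, h₁⟩ := (rateOf_coe_lt_iff hs hx).1 h₁
    obtain ⟨β₂, hβ₂, h₂⟩ := (rateOf_coe_lt_iff hs hx).1 h₂
    refine rateOf_coe_le hs hx (β := a * β₁ + b * β₂)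
      (convex_Icc (0 : ℝ) 1 hβ₁ hβ₂ ha.le hb.le hab) ?_
    have h3 := dualRate_combo_le ha.le hb.le h₁.le h₂.le
    have h4 : a * x₁ + b * x₂ - (1 - (a * β₁ + b * β₂)) * L =
        a * (x₁ - (1 - β₁) * L) + b * (x₂ - (1 - β₂) * L) := by
      linear_combination L * hab
    rw [h4]
    exact h3

/-- For finite ℓ this is an infimum over the compact interval [0, 1] of a jointly lower
semicontinuous function, so a strict lower bound at w persists near w uniformly in β. -/
lemma rateOf_lowerSemicontinuous (hs : Measurable s) (hx : Measurable x) {ℓ : EReal}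
    (hℓ : 0 ≤ ℓ) : LowerSemicontinuous (rateOf P s x ℓ) := by
  rcases ereal_nonneg_cases hℓ with rfl | ⟨L, hL, rfl⟩
  · have : rateOf P s x ⊤ = fun w => dualRate (stepLaw P s x) (1, w) :=
      funext fun w => rateOf_top hs hx w
    rw [this]
    exact lowerSemicontinuous_dualRate.comp (by fun_prop)
  · intro w y hy
    obtain ⟨r, h1, h2⟩ := EReal.lt_iff_exists_real_btwn.1 hy
    have key : ∀ᶠ w' in 𝓝 w, ∀ β ∈ Set.Icc (0 : ℝ) 1,
        ((r - (1 - β) * L : ℝ) : EReal) < dualRate (stepLaw P s x) (β, w') := by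
      refine isCompact_Icc.eventually_forall_of_forall_eventually fun β hβ => ?_
      have h3 : ((r - (1 - β) * L : ℝ) : EReal) < dualRate (stepLaw P s x) (β, w) := by
        by_contra! hle
        exact absurd h2 (not_lt.2 (rateOf_coe_le hs hx hβ hle))
      obtain ⟨g, hg, h4⟩ := lt_dualRate_iff.1 h3
      rw [EReal.coe_lt_coe_iff] at h4
      have hc : Continuous fun p : E × ℝ => g (p.2, p.1) - (r - (1 - p.2) * L) := by fun_prop
      filter_upwards [hc.continuousAt.eventually (lt_mem_nhds (sub_pos.2 h4))] with p hp
      exact lt_of_lt_of_le (EReal.coe_lt_coe_iff.2 (sub_pos.1 hp)) (le_dualRate hg _)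
    filter_upwards [key] with w' hw'
    refine h1.trans_le ?_
    by_contra! hlt
    obtain ⟨β, hβ, h5⟩ := (rateOf_coe_lt_iff hs hx).1 hlt
    exact absurd h5 (hw' β hβ).not_gt

end RateFunction

/-! ### Expected numbers of visits -/

section Visits

variable {V : Type*} [NormedAddCommGroup V] [NormedSpace ℝ V] [MeasurableSpace V]

/-- The expected number of visits of a random walk to the dilation of a set. -/
def visits (μ : Measure V) (A : Set V) (t : ℝ) : ENNReal :=
  ∑' n, iterConv μ n {z | t⁻¹ • z ∈ A}

variable {μ : Measure V}

lemma visits_mono {A B : Set V} (h : A ⊆ B) (t : ℝ) : visits μ A t ≤ visits μ B t :=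
  ENNReal.tsum_le_tsum fun _ => measure_mono fun _ hz => h hz

lemma visits_union_le (A B : Set V) (t : ℝ) :
    visits μ (A ∪ B) t ≤ visits μ A t + visits μ B t := by
  rw [visits, visits, visits, ← ENNReal.tsum_add]
  exact ENNReal.tsum_le_tsum fun n => measure_union_le {z | t⁻¹ • z ∈ A} {z | t⁻¹ • z ∈ B}

lemma iterConv_le_visits (A : Set V) (n : ℕ) (t : ℝ) :
    iterConv μ n {z | t⁻¹ • z ∈ A} ≤ visits μ A t :=
  ENNReal.le_tsum n

/-- The upper large deviation bound for the expected number of visits to a set. -/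
def HasVisitBound (μ : Measure V) (A : Set V) : Prop :=
  ∀ r r' : ℝ, r' < r → (∀ z ∈ A, (r : EReal) ≤ dualRate μ z) →
    ∀ᶠ t : ℝ in atTop, visits μ A t ≤ eexp (-r' * t)

end Visits

/-! ### Visit bounds for compact sets and for convex sets -/

section VisitBounds

variable {E : Type*} [NormedAddCommGroup E] [NormedSpace ℝ E]
  [MeasurableSpace E] [BorelSpace E] [SecondCountableTopology E]
  {μ : Measure (ℝ × E)} [IsProbabilityMeasure μ]

/-- Positivity of the waiting times turns Λ ≤ 0 into Λ < 0, which is what makes the sum over all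
step numbers a convergent geometric series. -/
lemma lintegral_eexp_sub_fst_lt (hμ : ∀ᵐ z ∂μ, 0 < z.1) {g : StrongDual ℝ (ℝ × E)}
    (hg : ∫⁻ z, eexp (g z) ∂μ ≤ 1) {θ : ℝ} (hθ : 0 < θ) :
    ∫⁻ z, eexp ((g - θ • ContinuousLinearMap.fst ℝ ℝ E) z) ∂μ < 1 := by
  have hle : ∀ᵐ z ∂μ, eexp ((g - θ • ContinuousLinearMap.fst ℝ ℝ E) z) < eexp (g z) := by
    filter_upwards [hμ] with z hz
    rw [eexp_lt_eexp]
    simpa using mul_pos hθ hz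
  refine lt_of_lt_of_le (lintegral_strict_mono (IsProbabilityMeasure.ne_zero μ)
    (measurable_eexp.comp g.continuous.measurable).aemeasurable ?_ hle) hg
  exact ne_top_of_le_ne_top ENNReal.one_ne_top
    ((lintegral_mono_ae (hle.mono fun z hz => hz.le)).trans hg)

lemma exists_nhds_visits_le (hμ : ∀ᵐ z ∂μ, 0 < z.1) {z : ℝ × E} {r : ℝ}
    (hr : (r : EReal) < dualRate μ z) :
    ∃ U ∈ 𝓝 z, ∃ C : ENNReal, C ≠ ⊤ ∧ ∀ t : ℝ, 0 < t → visits μ U t ≤ C * eexp (-r * t) := by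
  obtain ⟨g, hg, hgz⟩ := lt_dualRate_iff.1 hr
  rw [EReal.coe_lt_coe_iff] at hgz
  -- The tilt costs θ z.1, kept below half of the gap g z - r.
  obtain ⟨θ, hθ, hθz⟩ : ∃ θ : ℝ, 0 < θ ∧ r < g z - θ * z.1 := by
    refine ⟨(g z - r) / (2 * (|z.1| + 1)), div_pos (by linarith) (by positivity), ?_⟩
    have h1 : (g z - r) / (2 * (|z.1| + 1)) * z.1 ≤
        (g z - r) / (2 * (|z.1| + 1)) * (|z.1| + 1) := by
      have : 0 ≤ (g z - r) / (2 * (|z.1| + 1)) := div_nonneg (by linarith) (by positivity)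
      gcongr
      linarith [le_abs_self z.1]
    have h2 : (g z - r) / (2 * (|z.1| + 1)) * (|z.1| + 1) = (g z - r) / 2 := by field_simp
    linarith
  set g' := g - θ • ContinuousLinearMap.fst ℝ ℝ E
  have hg'z : r < g' z := by simpa [g'] using hθz
  have hρ := lintegral_eexp_sub_fst_lt hμ hg hθ
  set ρ := ∫⁻ z, eexp (g' z) ∂μ
  refine ⟨{z | r < g' z}, g'.continuous.continuousAt.eventually (lt_mem_nhds hg'z), (1 - ρ)⁻¹,
    ENNReal.inv_ne_top.2 (tsub_pos_of_lt hρ).ne', fun t ht => ?_⟩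
  rw [← ENNReal.tsum_geometric, mul_comm, ← ENNReal.tsum_mul_left]
  refine ENNReal.tsum_le_tsum fun n => ?_
  rw [neg_mul]
  refine iterConv_le_chernoff g' n fun x hx => ?_
  have h1 : r < g' (t⁻¹ • x) := hx
  rw [map_smul, smul_eq_mul, ← div_eq_inv_mul, lt_div_iff₀ ht] at h1
  exact h1.le

lemma exists_visits_compact_le (hμ : ∀ᵐ z ∂μ, 0 < z.1) {K : Set (ℝ × E)} (hK : IsCompact K)
    {r : ℝ} (hr : ∀ z ∈ K, (r : EReal) < dualRate μ z) :
    ∃ C : ENNReal, C ≠ ⊤ ∧ ∀ t : ℝ, 0 < t → visits μ K t ≤ C * eexp (-r * t) := by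
  refine hK.induction_on
    (p := fun A => ∃ C : ENNReal, C ≠ ⊤ ∧ ∀ t : ℝ, 0 < t → visits μ A t ≤ C * eexp (-r * t))
    ⟨0, by simp, fun t _ => by simp [visits]⟩ ?_ ?_ ?_
  · rintro A B hAB ⟨C, hC, h⟩
    exact ⟨C, hC, fun t ht => (visits_mono hAB t).trans (h t ht)⟩
  · rintro A B ⟨C, hC, h⟩ ⟨C', hC', h'⟩
    refine ⟨C + C', ENNReal.add_ne_top.2 ⟨hC, hC'⟩, fun t ht => ?_⟩
    rw [add_mul]
    exact (visits_union_le A B t).trans (add_le_add (h t ht) (h' t ht))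
  · intro z hz
    obtain ⟨U, hU, h⟩ := exists_nhds_visits_le hμ (hr z hz)
    exact ⟨U, mem_nhdsWithin_of_mem_nhds hU, h⟩

lemma hasVisitBound_of_isCompact (hμ : ∀ᵐ z ∂μ, 0 < z.1) {K : Set (ℝ × E)} (hK : IsCompact K) :
    HasVisitBound μ K := by
  intro r r' hr h
  obtain ⟨C, hC, hv⟩ := exists_visits_compact_le hμ hK (r := (r + r') / 2) fun z hz =>
    lt_of_lt_of_le (EReal.coe_lt_coe_iff.2 (by linarith)) (h z hz)
  filter_upwards [eventually_const_mul_eexp_le hC (a := -((r + r') / 2)) (b := -r')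
    (by linarith), eventually_gt_atTop 0] with t ht ht0
  exact (hv t ht0).trans ht

/-- A set is compactly convexly exhausted if each compact subset lies in a compact convex one. -/
def ConvexlyExhausted {V : Type*} [NormedAddCommGroup V] [NormedSpace ℝ V] (A : Set V) : Prop :=
  ∀ K ⊆ A, IsCompact K → ∃ K' ⊆ A, IsCompact K' ∧ Convex ℝ K' ∧ K ⊆ K'

open Pointwise in
-- A bound with no prefactor, even though A need not be compact: if the probability exceeded e^y
-- with y > -rt, inner regularity would put more than e^y on tK with K ⊆ A compact convex. Repeating
-- the block k times lands in ktK by convexity, where the compact bound allows at most C e^{ky}. The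
-- k-th root gives a contradiction.
lemma iterConv_le_of_convexlyExhausted [CompleteSpace E] (hμ : ∀ᵐ z ∂μ, 0 < z.1)
    {A : Set (ℝ × E)} (hA : MeasurableSet A) (hex : ConvexlyExhausted A) {r : ℝ}
    (hr : ∀ z ∈ A, (r : EReal) ≤ dualRate μ z) (n : ℕ) {t : ℝ} (ht : 0 < t) :
    iterConv μ n {z | t⁻¹ • z ∈ A} ≤ eexp (-r * t) := by
  refine le_eexp_of_forall_lt fun y hy => ?_
  by_contra! hlt
  have hmeas : MeasurableSet {z : ℝ × E | t⁻¹ • z ∈ A} := hA.preimage (measurable_const_smul _)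
  obtain ⟨K₀, hK₀, hK₀c, hlt⟩ := hmeas.exists_lt_isCompact hlt
  obtain ⟨K, hKA, hK, hKc, hKK⟩ := hex (t⁻¹ • K₀)
    (by rintro _ ⟨z, hz, rfl⟩; exact hK₀ hz) (hK₀c.smul t⁻¹)
  have hlt : eexp y < iterConv μ n (t • K) := by
    refine hlt.trans_le (measure_mono fun z hz => ?_)
    exact ⟨t⁻¹ • z, hKK ⟨z, hz, rfl⟩, smul_inv_smul₀ ht.ne' z⟩
  have hKn : K.Nonempty := by
    by_contra! h
    simp [h] at hlt
  obtain ⟨C, hC, hv⟩ := exists_visits_compact_le hμ hK (r := -y / t) fun z hz =>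
    lt_of_lt_of_le (EReal.coe_lt_coe_iff.2 (by rw [div_lt_iff₀ ht]; linarith)) (hr z (hKA hz))
  refine absurd (le_of_forall_pow_le (C := C + 1) (by simp [hC]) (eexp_ne_zero y)
    (eexp_ne_top y) fun k => ?_) hlt.not_ge
  rcases Nat.eq_zero_or_pos k with rfl | hk
  · simp
  have hk0 : (0 : ℝ) < k := by exact_mod_cast hk
  refine (iterConv_pow_le μ n (B := fun k : ℕ => ((k : ℝ) * t) • K) ?_ ?_ k).trans ?_
  · simp only [Nat.cast_zero, zero_mul, Set.zero_smul_set hKn]; exact Set.mem_zero.2 rfl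
  · intro k a ha b hb
    have : ((k + 1 : ℕ) : ℝ) * t = k * t + t := by push_cast; ring
    simp only [this]
    rw [hKc.add_smul (by positivity) ht.le]
    exact Set.add_mem_add hb ha
  · have h1 : iterConv μ (n * k) (((k : ℝ) * t) • K) ≤ visits μ K (k * t) := by
      refine le_trans (measure_mono ?_) (iterConv_le_visits K (n * k) (k * t))
      rintro _ ⟨x, hx, rfl⟩
      change ((k : ℝ) * t)⁻¹ • ((k : ℝ) * t) • x ∈ K
      rwa [inv_smul_smul₀ (by positivity)]
    refine (h1.trans (hv _ (by positivity))).trans ?_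
    rw [← eexp_nat_mul]
    gcongr
    · exact le_self_add
    · rw [eexp_le_eexp]; field_simp; rfl

/-- Chernoff's bound with the functional -z.1, whose exponential moment is below 1: completing n
renewals by a fixed time is exponentially unlikely in n. -/
lemma exists_iterConv_fst_le (hμ : ∀ᵐ z ∂μ, 0 < z.1) :
    ∃ κ > 0, ∀ (b : ℝ) (n : ℕ),
      iterConv μ n {z | z.1 ≤ b} ≤ eexp (b - κ * n) := by
  have h := lintegral_eexp_sub_fst_lt hμ (g := 0) (by simp) one_pos
  obtain ⟨c, hc, hc1⟩ := exists_between h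
  obtain ⟨y, rfl⟩ := exists_eexp_eq (bot_lt_iff_ne_bot.1 (lt_of_le_of_lt bot_le hc))
    (ne_top_of_lt hc1)
  rw [← eexp_zero, eexp_lt_eexp] at hc1
  refine ⟨-y, by linarith, fun b n => ?_⟩
  have := iterConv_le_chernoff (μ := μ) (0 - (1 : ℝ) • ContinuousLinearMap.fst ℝ ℝ E) (c := -b) n
    (A := {z | z.1 ≤ b}) (fun z hz => by
      simp only [Set.mem_ofPred_eq] at hz
      simpa using hz)
  refine this.trans ?_
  rw [show b - -y * n = -(-b) + n * y by ring, eexp_add, eexp_nat_mul]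
  gcongr

lemma tsum_iterConv_tail_le {κ b r M t : ℝ} (hκ : 0 < κ)
    (hκn : ∀ (b : ℝ) (n : ℕ), iterConv μ n {z | z.1 ≤ b} ≤ eexp (b - κ * n))
    (hM : b + r ≤ κ * M) (ht : 0 < t) {N : ℕ} (hN : M * t ≤ N) {A : Set (ℝ × E)}
    (hb : ∀ z ∈ A, z.1 ≤ b) :
    ∑' n, iterConv μ (n + N) {z | t⁻¹ • z ∈ A} ≤ (∑' n : ℕ, eexp (-κ) ^ n) * eexp (-r * t) := by
  rw [mul_comm, ← ENNReal.tsum_mul_left]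
  refine ENNReal.tsum_le_tsum fun n => ?_
  refine (measure_mono (fun z hz => ?_)).trans ((hκn (b * t) (n + N)).trans ?_)
  · have := hb _ hz
    rw [Prod.smul_fst, smul_eq_mul, ← div_eq_inv_mul, div_le_iff₀ ht] at this
    exact this
  · rw [← eexp_nat_mul, ← eexp_add, eexp_le_eexp]
    push_cast
    have h4 : (b + r) * t ≤ κ * M * t := by gcongr
    have h5 : κ * (M * t) ≤ κ * N := by gcongr
    linarith

/-- The first N ≈ Mt steps contribute N times the uniform bound. With κM ≥ b + r, the later steps
form a geometric tail of order e^{-rt}. -/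
lemma exists_visits_le_linear (hμ : ∀ᵐ z ∂μ, 0 < z.1) (b r : ℝ) : ∃ M D : ℝ,
    ∀ (t : ℝ) (A : Set (ℝ × E)), 0 < t → (∀ z ∈ A, z.1 ≤ b) →
      (∀ n, iterConv μ n {z | t⁻¹ • z ∈ A} ≤ eexp (-r * t)) →
      visits μ A t ≤ ENNReal.ofReal (M * t + D) * eexp (-r * t) := by
  obtain ⟨κ, hκ, hκn⟩ := exists_iterConv_fst_le hμ
  obtain ⟨M, hM0, hM⟩ : ∃ M : ℝ, 0 ≤ M ∧ b + r ≤ κ * M := by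
    refine ⟨max 0 ((b + r) / κ), le_max_left _ _, ?_⟩
    have : (b + r) / κ ≤ max 0 ((b + r) / κ) := le_max_right _ _
    rwa [div_le_iff₀ hκ, mul_comm] at this
  obtain ⟨C, hC⟩ : ∃ C : NNReal, ∑' n : ℕ, eexp (-κ) ^ n = C := by
    refine ⟨_, (ENNReal.coe_toNNReal ?_).symm⟩
    rw [ENNReal.tsum_geometric]
    refine ENNReal.inv_ne_top.2 (tsub_pos_of_lt ?_).ne'
    rw [← eexp_zero, eexp_lt_eexp]; linarith
  refine ⟨M, 1 + C, fun t A ht hb h => ?_⟩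
  obtain ⟨N, hN, hN'⟩ : ∃ N : ℕ, M * t ≤ N ∧ (N : ℝ) ≤ M * t + 1 :=
    ⟨⌈M * t⌉₊, Nat.le_ceil _, (Nat.ceil_lt_add_one (by positivity)).le⟩
  have h2 := tsum_iterConv_tail_le hκ hκn hM ht hN hb
  rw [hC] at h2
  have h1 : ∑ n ∈ Finset.range N, iterConv μ n {z | t⁻¹ • z ∈ A} ≤ N * eexp (-r * t) := by
    refine (Finset.sum_le_card_nsmul _ _ _ fun n _ => h n).trans ?_
    simp
  have h3 : (N : ENNReal) + C ≤ ENNReal.ofReal (M * t + (1 + C)) := by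
    rw [← ENNReal.ofReal_coe_nnreal, ← ENNReal.ofReal_natCast,
      ← ENNReal.ofReal_add (Nat.cast_nonneg N) NNReal.zero_le_coe]
    exact ENNReal.ofReal_le_ofReal (by linarith)
  calc visits μ A t = ∑ n ∈ Finset.range N, iterConv μ n {z | t⁻¹ • z ∈ A} +
        ∑' n, iterConv μ (n + N) {z | t⁻¹ • z ∈ A} :=
      (Summable.sum_add_tsum_nat_add' (f := fun n => iterConv μ n {z | t⁻¹ • z ∈ A})
        ENNReal.summable).symm
    _ ≤ N * eexp (-r * t) + C * eexp (-r * t) := add_le_add h1 h2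
    _ = (N + C) * eexp (-r * t) := (add_mul _ _ _).symm
    _ ≤ _ := mul_le_mul_left h3 _

lemma hasVisitBound_of_convexlyExhausted [CompleteSpace E] (hμ : ∀ᵐ z ∂μ, 0 < z.1)
    {A : Set (ℝ × E)} (hA : MeasurableSet A) (hex : ConvexlyExhausted A) {b : ℝ}
    (hb : ∀ z ∈ A, z.1 ≤ b) : HasVisitBound μ A := by
  intro r r' hr h
  obtain ⟨M, D, hMD⟩ := exists_visits_le_linear hμ b r
  filter_upwards [eventually_linear_mul_eexp_le M D (a := -r) (b := -r')
    (by linarith), eventually_gt_atTop 0] with t ht ht0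
  exact (hMD t A ht0 hb fun n => iterConv_le_of_convexlyExhausted hμ hA hex h n ht0).trans ht

end VisitBounds

/-! ### Random walks with independent identically distributed steps -/

section IID

variable {Ω V : Type*} [MeasurableSpace Ω] [NormedAddCommGroup V] [MeasurableSpace V]
  [BorelSpace V] [SecondCountableTopology V] {P : Measure Ω} [IsProbabilityMeasure P]
  {ξ : ℕ → Ω → V}

lemma map_eq_of_identDistrib (hident : ∀ i, IdentDistrib (ξ i) (ξ 0) P P) (i : ℕ) :
    P.map (ξ i) = P.map (ξ 0) := (hident i).map_eq

lemma measurable_walk (hξ : ∀ i, Measurable (ξ i)) (n : ℕ) :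
    Measurable fun ω => ∑ i ∈ Finset.range n, ξ i ω :=
  Finset.measurable_fun_sum _ fun i _ => hξ i

lemma map_walk_eq_iterConv (hξ : ∀ i, Measurable (ξ i)) (hindep : iIndepFun ξ P)
    (hident : ∀ i, IdentDistrib (ξ i) (ξ 0) P P) (n : ℕ) :
    P.map (fun ω => ∑ i ∈ Finset.range n, ξ i ω) = iterConv (P.map (ξ 0)) n := by
  induction n with
  | zero => simp [iterConv, Measure.map_const]
  | succ n ih =>
    have h := hindep.indepFun_sum_range_succ hξ n
    have h2 := h.map_add_eq_map_conv_map
      (by convert measurable_walk hξ n using 1; ext ω; simp) (hξ n)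
    rw [iterConv, ← ih, ← map_eq_of_identDistrib hident n]
    convert h2 using 2
    · ext ω; simp [Finset.sum_range_succ]
    · congr 1; ext ω; simp

lemma measure_walk_mem (hξ : ∀ i, Measurable (ξ i)) (hindep : iIndepFun ξ P)
    (hident : ∀ i, IdentDistrib (ξ i) (ξ 0) P P) (n : ℕ) {A : Set V} (hA : MeasurableSet A) :
    P {ω | ∑ i ∈ Finset.range n, ξ i ω ∈ A} = iterConv (P.map (ξ 0)) n A := by
  rw [← map_walk_eq_iterConv hξ hindep hident n, Measure.map_apply (measurable_walk hξ n) hA]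
  rfl

/-- Used with m = 1 for the waiting time that straddles t, and with larger m for the filler steps of
the lower bound. -/
lemma measure_walk_mem_inter (hξ : ∀ i, Measurable (ξ i)) (hindep : iIndepFun ξ P)
    (hident : ∀ i, IdentDistrib (ξ i) (ξ 0) P P) (n m : ℕ) {A Q : Set V} (hA : MeasurableSet A)
    (hQ : MeasurableSet Q) :
    P {ω | ∑ i ∈ Finset.range n, ξ i ω ∈ A ∧ ∀ i ∈ Finset.Ico n (n + m), ξ i ω ∈ Q} =
      iterConv (P.map (ξ 0)) n A * P.map (ξ 0) Q ^ m := by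
  have hdisj : Disjoint (Finset.range n) (Finset.Ico n (n + m)) := by
    rw [Finset.range_eq_Ico]; exact Finset.Ico_disjoint_Ico_consecutive 0 n (n + m)
  have hI := hindep.indepFun_finset _ _ hdisj hξ
  have hmeas₁ : MeasurableSet {v : (Finset.range n) → V | ∑ i, v i ∈ A} :=
    hA.preimage (Finset.measurable_fun_sum _ fun i _ => measurable_pi_apply i)
  have hmeas₂ : MeasurableSet {v : (Finset.Ico n (n + m)) → V | ∀ i, v i ∈ Q} := by
    have : {v : (Finset.Ico n (n + m)) → V | ∀ i, v i ∈ Q} =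
        ⋂ i, (fun v => v i) ⁻¹' Q := by ext; simp
    rw [this]
    exact MeasurableSet.iInter fun i => hQ.preimage (measurable_pi_apply i)
  have h1 := hI.measure_inter_preimage_eq_mul _ _ hmeas₁ hmeas₂
  have h2 := hindep.measure_inter_preimage_eq_mul (Finset.Ico n (n + m)) (sets := fun _ => Q)
    fun _ _ => hQ
  have h3 : ∀ i, P (ξ i ⁻¹' Q) = P.map (ξ 0) Q := fun i => by
    rw [← map_eq_of_identDistrib hident i, Measure.map_apply (hξ i) hQ]
  simp only [h3, Finset.prod_const, Nat.card_Ico, Nat.add_sub_cancel_left] at h2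
  rw [← h2, ← measure_walk_mem hξ hindep hident n hA]
  convert h1 using 2
  · ext ω
    simp only [Set.mem_ofPred_eq, Set.mem_inter_iff, Set.mem_preimage, Subtype.forall]
    rw [Finset.sum_coe_sort (Finset.range n) fun i => ξ i ω]
  · congr 1
    ext ω
    simp only [Set.mem_ofPred_eq, Set.mem_preimage]
    rw [Finset.sum_coe_sort (Finset.range n) fun i => ξ i ω]
  · congr 1
    ext ω
    simp

lemma lintegral_prod_walk (hξ : ∀ i, Measurable (ξ i)) (hindep : iIndepFun ξ P)
    (hident : ∀ i, IdentDistrib (ξ i) (ξ 0) P P) {f : V → ENNReal} (hf : Measurable f) (n : ℕ) :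
    ∫⁻ ω, ∏ i ∈ Finset.range n, f (ξ i ω) ∂P = (∫⁻ ω, f (ξ 0 ω) ∂P) ^ n := by
  have := lintegral_prod_eq_prod_lintegral_of_indepFun (Finset.range n) (fun i ω => f (ξ i ω))
    (hindep.comp (fun _ => f) fun _ => hf) fun i => hf.comp (hξ i)
  rw [this]
  have h : ∀ i, ∫⁻ ω, f (ξ i ω) ∂P = ∫⁻ ω, f (ξ 0 ω) ∂P := fun i => by
    rw [← lintegral_map hf (hξ i), ← lintegral_map hf (hξ 0), map_eq_of_identDistrib hident i]
  simp [h]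

end IID

/-! ### Translation between logarithmic rates and exponential inequalities -/

section Conversion

lemma inv_mul_log_le_iff {t a : ℝ} (ht : 0 < t) {p : ENNReal} :
    ((t⁻¹ : ℝ) : EReal) * ENNReal.log p ≤ a ↔ p ≤ eexp (a * t) := by
  have ht' : 0 < t⁻¹ := inv_pos.2 ht
  rcases eq_or_ne p ⊤ with rfl | hp
  · rw [ENNReal.log_top, EReal.coe_mul_top_of_pos ht']
    simp [eexp_ne_top]
  rcases eq_or_ne p 0 with rfl | hp0
  · rw [ENNReal.log_zero, EReal.coe_mul_bot_of_pos ht']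
    simp
  obtain ⟨y, rfl⟩ := exists_eexp_eq hp0 hp
  rw [log_eexp, eexp_le_eexp, ← EReal.coe_mul, EReal.coe_le_coe_iff, inv_mul_le_iff₀ ht, mul_comm]

lemma le_inv_mul_log_iff {t a : ℝ} (ht : 0 < t) {p : ENNReal} :
    (a : EReal) ≤ ((t⁻¹ : ℝ) : EReal) * ENNReal.log p ↔ eexp (a * t) ≤ p := by
  have ht' : 0 < t⁻¹ := inv_pos.2 ht
  rcases eq_or_ne p ⊤ with rfl | hp
  · rw [ENNReal.log_top, EReal.coe_mul_top_of_pos ht']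
    simp
  rcases eq_or_ne p 0 with rfl | hp0
  · rw [ENNReal.log_zero, EReal.coe_mul_bot_of_pos ht']
    simp [eexp_ne_zero]
  obtain ⟨y, rfl⟩ := exists_eexp_eq hp0 hp
  rw [log_eexp, eexp_le_eexp, ← EReal.coe_mul, EReal.coe_le_coe_iff, ← div_eq_inv_mul,
    le_div_iff₀ ht]

variable {Ω E : Type*} [MeasurableSpace Ω] [NormedAddCommGroup E] [NormedSpace ℝ E]
  {P : Measure Ω} {S : ℕ → Ω → ℝ} {X : ℕ → Ω → E} {I : E → EReal}

lemma limsup_logProb_le {A : Set E} {a : ℝ}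
    (h : ∀ᶠ t : ℝ in atTop, P {ω | t⁻¹ • cumulativeReward S X t ω ∈ A} ≤ eexp (a * t)) :
    limsup (logProb P S X A) atTop ≤ a := by
  refine limsup_le_of_le (h := ?_)
  filter_upwards [h, eventually_gt_atTop 0] with t ht ht0
  exact (inv_mul_log_le_iff ht0).2 ht

lemma le_liminf_logProb {A : Set E} {a : ℝ}
    (h : ∀ᶠ t : ℝ in atTop, eexp (a * t) ≤ P {ω | t⁻¹ • cumulativeReward S X t ω ∈ A}) :
    a ≤ liminf (logProb P S X A) atTop := by
  refine le_liminf_of_le (h := ?_)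
  filter_upwards [h, eventually_gt_atTop 0] with t ht ht0
  exact (le_inv_mul_log_iff ht0).2 ht

lemma eventually_le_of_limsup_logProb_lt {A : Set E} {a : ℝ}
    (h : limsup (logProb P S X A) atTop < a) :
    ∀ᶠ t : ℝ in atTop, P {ω | t⁻¹ • cumulativeReward S X t ω ∈ A} ≤ eexp (a * t) := by
  filter_upwards [eventually_lt_of_limsup_lt h, eventually_gt_atTop 0] with t ht ht0
  exact (inv_mul_log_le_iff ht0).1 ht.le

lemma upperBound_of_forall_real {F : Set E}
    (h : ∀ x : ℝ, (x : EReal) < ⨅ w ∈ F, I w →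
      ∀ᶠ t : ℝ in atTop, P {ω | t⁻¹ • cumulativeReward S X t ω ∈ F} ≤ eexp (-x * t)) :
    UpperBound P S X I F := by
  unfold UpperBound
  by_contra! hlt
  obtain ⟨c, h1, h2⟩ := EReal.lt_iff_exists_real_btwn.1 hlt
  have h3 : ((-c : ℝ) : EReal) < ⨅ w ∈ F, I w := by
    rw [EReal.coe_neg]; exact EReal.neg_lt_comm.1 h1
  have := limsup_logProb_le (h (-c) h3)
  rw [neg_neg] at this
  exact absurd h2 this.not_gt

lemma lowerBound_of_forall_real {G : Set E}
    (h : ∀ w ∈ G, ∀ a : ℝ, I w < a →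
      ∀ᶠ t : ℝ in atTop, eexp (-a * t) ≤ P {ω | t⁻¹ • cumulativeReward S X t ω ∈ G}) :
    LowerBound P S X I G := by
  unfold LowerBound
  by_contra! hlt
  obtain ⟨c, h1, h2⟩ := EReal.lt_iff_exists_real_btwn.1 hlt
  have h3 : ⨅ w ∈ G, I w < ((-c : ℝ) : EReal) := by
    rw [EReal.coe_neg]; exact EReal.lt_neg_comm.1 h2
  simp only [iInf_lt_iff] at h3
  obtain ⟨w, hw, h3⟩ := h3
  have := le_liminf_logProb (h w hw (-c) h3)
  rw [neg_neg] at this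
  exact absurd h1 this.not_gt

variable [IsProbabilityMeasure P] {s : Ω → ℝ}

lemma eventually_inv_mul_log_le_zero :
    ∀ᶠ r : ℝ in atTop, ((r⁻¹ : ℝ) : EReal) * ENNReal.log (P {ω | r < s ω}) ≤ 0 := by
  filter_upwards [eventually_gt_atTop 0] with r hr
  rw [← EReal.coe_zero, inv_mul_log_le_iff hr, zero_mul, eexp_zero]
  exact prob_le_one

lemma ellSup_nonneg : 0 ≤ ellSup P s := by
  rw [ellSup, EReal.neg_nonneg]
  exact limsup_le_of_le (h := eventually_inv_mul_log_le_zero)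

lemma ellSup_le_ellInf : ellSup P s ≤ ellInf P s := by
  rw [ellSup, ellInf, EReal.neg_le_neg_iff]
  exact liminf_le_limsup

lemma ellInf_nonneg : 0 ≤ ellInf P s := ellSup_nonneg.trans ellSup_le_ellInf

lemma eventually_tail_le {c : ℝ} (h : (c : EReal) < ellSup P s) :
    ∀ᶠ r : ℝ in atTop, P {ω | r < s ω} ≤ eexp (-c * r) := by
  have h1 := EReal.lt_neg_comm.1 h
  rw [← EReal.coe_neg] at h1
  filter_upwards [eventually_lt_of_limsup_lt h1, eventually_gt_atTop 0] with r hr hr0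
  exact (inv_mul_log_le_iff hr0).1 hr.le

lemma eventually_le_tail {c : ℝ} (h : ellInf P s < (c : EReal)) :
    ∀ᶠ r : ℝ in atTop, eexp (-c * r) ≤ P {ω | r < s ω} := by
  have h1 := EReal.neg_lt_comm.1 h
  rw [← EReal.coe_neg] at h1
  filter_upwards [eventually_lt_of_lt_liminf h1, eventually_gt_atTop 0] with r hr hr0
  exact (le_inv_mul_log_iff hr0).1 hr.le

lemma eventually_scaled_tail_le {c u : ℝ} (hu : 0 ≤ u) (h : (c : EReal) < ellSup P s) :
    ∀ᶠ t : ℝ in atTop, P {ω | t * u < s ω} ≤ eexp (-(c * u) * t) := by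
  rcases hu.eq_or_lt with rfl | hu
  · refine Eventually.of_forall fun t => ?_
    simpa using prob_le_one
  · filter_upwards [(tendsto_id.atTop_mul_const hu).eventually (eventually_tail_le h)] with t ht
    refine ht.trans (le_of_eq ?_)
    congr 1; simp only [id]; ring

end Conversion

/-! ### Pathwise description of the reward through the walk -/

section Path

variable {Ω E : Type*} [MeasurableSpace Ω] [NormedAddCommGroup E] [NormedSpace ℝ E]
  {S : ℕ → Ω → ℝ} {X : ℕ → Ω → E}

/-- The random walk of renewal times and accumulated rewards. -/
def walk (S : ℕ → Ω → ℝ) (X : ℕ → Ω → E) (n : ℕ) (ω : Ω) : ℝ × E :=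
  ∑ i ∈ Finset.range n, (S i ω, X i ω)

lemma walk_succ (n : ℕ) (ω : Ω) : walk S X (n + 1) ω = walk S X n ω + (S n ω, X n ω) :=
  Finset.sum_range_succ _ _

lemma walk_fst (n : ℕ) (ω : Ω) : (walk S X n ω).1 = ∑ i ∈ Finset.range n, S i ω :=
  Prod.fst_sum

lemma walk_snd (n : ℕ) (ω : Ω) : (walk S X n ω).2 = ∑ i ∈ Finset.range n, X i ω :=
  Prod.snd_sum

lemma walk_fst_strictMono (hpos : ∀ i ω, 0 < S i ω) (ω : Ω) :
    StrictMono fun n => (walk S X n ω).1 :=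
  strictMono_nat_of_lt_succ fun n => by
    rw [walk_succ]; simpa using hpos n ω

lemma walk_fst_nonneg (hpos : ∀ i ω, 0 < S i ω) (n : ℕ) (ω : Ω) : 0 ≤ (walk S X n ω).1 := by
  rw [walk_fst]; exact Finset.sum_nonneg fun i _ => (hpos i ω).le

lemma cumulativeReward_eq_walk (hpos : ∀ i ω, 0 < S i ω) {n : ℕ} {t : ℝ} {ω : Ω}
    (h1 : (walk S X n ω).1 ≤ t) (h2 : t < (walk S X (n + 1) ω).1) :
    cumulativeReward S X t ω = (walk S X n ω).2 := by
  have hmono := walk_fst_strictMono (X := X) hpos ω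
  have hren : ∀ i, renewalTime S i ω = (walk S X (i + 1) ω).1 := fun i => (walk_fst _ _).symm
  rw [cumulativeReward, walk_snd, tsum_eq_sum (s := Finset.range n)]
  · refine Finset.sum_congr rfl fun i hi => Set.indicator_of_mem ?_ _
    change renewalTime S i ω ≤ t
    rw [hren]
    exact (hmono.monotone (Nat.succ_le_of_lt (Finset.mem_range.1 hi))).trans h1
  · intro i hi
    refine Set.indicator_of_notMem ?_ _
    change ¬ renewalTime S i ω ≤ t
    rw [hren, not_le]
    refine h2.trans_le (hmono.monotone ?_)
    have := Finset.mem_range.not.1 hi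
    omega

lemma exists_renewal_index {t : ℝ} (ht : 0 ≤ t) {ω : Ω} {m : ℕ}
    (hm : t < (walk S X m ω).1) :
    ∃ n < m, (walk S X n ω).1 ≤ t ∧ t < (walk S X (n + 1) ω).1 := by
  classical
  have hex : ∃ m, t < (walk S X m ω).1 := ⟨m, hm⟩
  have hne : Nat.find hex ≠ 0 := fun h0 => by
    have := Nat.find_spec hex
    rw [h0] at this
    simp only [walk, Finset.range_zero, Finset.sum_empty, Prod.fst_zero] at this
    linarith
  obtain ⟨n, hn⟩ := Nat.exists_eq_succ_of_ne_zero hne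
  refine ⟨n, ?_, ?_, ?_⟩
  · have := Nat.find_min' hex hm; omega
  · exact not_lt.1 (Nat.find_min hex (m := n) (by omega))
  · have := Nat.find_spec hex
    rwa [hn] at this

end Path

/-! ### The upper bound reduced to visit bounds on strips -/

section UpperBound

variable {Ω E : Type*} [MeasurableSpace Ω] {P : Measure Ω} [IsProbabilityMeasure P]
  [NormedAddCommGroup E] [NormedSpace ℝ E] [CompleteSpace E]
  [SecondCountableTopology E] [MeasurableSpace E] [BorelSpace E]
  {S : ℕ → Ω → ℝ} {X : ℕ → Ω → E}

/-- The assumptions on the sequence of waiting times and rewards. -/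
structure IsRenewalReward (P : Measure Ω) (S : ℕ → Ω → ℝ) (X : ℕ → Ω → E) : Prop where
  measurable_time : ∀ i, Measurable (S i)
  measurable_reward : ∀ i, Measurable (X i)
  pos : ∀ i ω, 0 < S i ω
  indep : iIndepFun (fun i ω => (S i ω, X i ω)) P
  ident : ∀ i, IdentDistrib (fun ω => (S i ω, X i ω)) (fun ω => (S 0 ω, X 0 ω)) P P

namespace IsRenewalReward

variable (h : IsRenewalReward P S X)
include h

lemma measurable_step (i : ℕ) : Measurable fun ω => (S i ω, X i ω) :=
  (h.measurable_time i).prodMk (h.measurable_reward i)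

lemma isProbabilityMeasure : IsProbabilityMeasure (stepLaw P (S 0) (X 0)) :=
  isProbabilityMeasure_stepLaw (h.measurable_time 0) (h.measurable_reward 0)

lemma ae_pos : ∀ᵐ z ∂(stepLaw P (S 0) (X 0)), 0 < z.1 := by
  rw [stepLaw, ae_map_iff (h.measurable_step 0).aemeasurable
    (measurableSet_lt measurable_const measurable_fst)]
  exact Eventually.of_forall fun ω => h.pos 0 ω

lemma measure_walk (n : ℕ) {A : Set (ℝ × E)} (hA : MeasurableSet A) :
    P {ω | walk S X n ω ∈ A} = iterConv (stepLaw P (S 0) (X 0)) n A :=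
  measure_walk_mem h.measurable_step h.indep h.ident n hA

lemma measure_walk_inter (n m : ℕ) {A Q : Set (ℝ × E)} (hA : MeasurableSet A)
    (hQ : MeasurableSet Q) :
    P {ω | walk S X n ω ∈ A ∧ ∀ i ∈ Finset.Ico n (n + m), (S i ω, X i ω) ∈ Q} =
      iterConv (stepLaw P (S 0) (X 0)) n A * P {ω | (S 0 ω, X 0 ω) ∈ Q} ^ m := by
  have := measure_walk_mem_inter h.measurable_step h.indep h.ident n m hA hQ
  rw [Measure.map_apply (h.measurable_step 0) hQ] at this
  exact this

/-- Discards the paths on which no renewal index exists at time t; there the series defining W_t has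
no useful value. -/
lemma measure_walk_fst_le_eq_zero (t : ℝ) : P {ω | ∀ n, (walk S X n ω).1 ≤ t} = 0 := by
  have := h.isProbabilityMeasure
  obtain ⟨κ, hκ, hκn⟩ := exists_iterConv_fst_le h.ae_pos
  have h1 : Tendsto (fun n : ℕ => eexp (t - κ * n)) atTop (𝓝 0) := by
    refine tendsto_eexp_atBot.comp ?_
    have := (tendsto_natCast_atTop_atTop (R := ℝ)).const_mul_atTop hκ
    simpa [sub_eq_add_neg] using
      tendsto_atBot_add_const_left atTop t (tendsto_neg_atTop_atBot.comp this)
  refine le_antisymm (ge_of_tendsto' h1 fun n => ?_) bot_le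
  refine le_trans ?_ (hκn t n)
  rw [← h.measure_walk n (measurableSet_le measurable_fst measurable_const)]
  exact measure_mono fun ω hω => hω n

/-- Decomposition over the last renewal n before t and the strip of width 1/N containing T_n/t. On
strip k the next waiting time exceeds t(1 - (k + 1)/N), and it is independent of the walk at step n.
-/
lemma measure_cumulativeReward_le {F : Set E} (hF : MeasurableSet F) {N : ℕ} (hN : 0 < N) {t : ℝ}
    (ht : 0 < t) :
    P {ω | t⁻¹ • cumulativeReward S X t ω ∈ F} ≤
      ∑ k ∈ Finset.range N, visits (stepLaw P (S 0) (X 0))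
        (Set.Icc ((k : ℝ) / N) ((k + 1) / N) ×ˢ F) t *
        P {ω | t * (1 - (k + 1) / N) < S 0 ω} := by
  have hN0 : (0 : ℝ) < N := by exact_mod_cast hN
  set A : ℕ → Set (ℝ × E) := fun k => Set.Icc ((k : ℝ) / N) ((k + 1) / N) ×ˢ F
  set Q : ℕ → Set (ℝ × E) := fun k => {z | t * (1 - (k + 1) / N) < z.1}
  have hA : ∀ k, MeasurableSet {z : ℝ × E | t⁻¹ • z ∈ A k} := fun k =>
    (measurableSet_Icc.prod hF).preimage (measurable_const_smul _)
  have hQ : ∀ k, MeasurableSet (Q k) := fun k => measurableSet_lt measurable_const measurable_fst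
  have hsub : {ω | t⁻¹ • cumulativeReward S X t ω ∈ F} ⊆ {ω | ∀ n, (walk S X n ω).1 ≤ t} ∪
      ⋃ k ∈ Finset.range N, ⋃ n, {ω | walk S X n ω ∈ {z : ℝ × E | t⁻¹ • z ∈ A k} ∧
        ∀ i ∈ Finset.Ico n (n + 1), (S i ω, X i ω) ∈ Q k} := by
    intro ω hω
    by_cases hall : ∀ n, (walk S X n ω).1 ≤ t
    · exact Or.inl hall
    right
    push Not at hall
    obtain ⟨m, hm⟩ := hall
    obtain ⟨n, -, h1, h2⟩ := exists_renewal_index ht.le hm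
    rw [Set.mem_ofPred_eq, cumulativeReward_eq_walk h.pos h1 h2] at hω
    have h0 := walk_fst_nonneg (X := X) h.pos n ω
    set b := t⁻¹ * (walk S X n ω).1
    have hb0 : 0 ≤ b := by positivity
    have hb1 : b ≤ 1 := by
      rw [inv_mul_le_iff₀ ht, mul_one]; exact h1
    have htb : t * b = (walk S X n ω).1 := mul_inv_cancel_left₀ ht.ne' _
    obtain ⟨k, hk, hk1, hk2⟩ : ∃ k < N, (k : ℝ) / N ≤ b ∧ b ≤ (k + 1) / N := by
      -- For b = 1 the floor of bN would be N, one past the last strip.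
      rcases hb1.eq_or_lt with hb | hb
      · refine ⟨N - 1, by omega, ?_, ?_⟩
        · rw [hb, div_le_one hN0]; exact_mod_cast Nat.sub_le N 1
        · rw [hb, Nat.cast_sub hN, Nat.cast_one, sub_add_cancel, div_self hN0.ne']
      · refine ⟨⌊b * N⌋₊, ?_, ?_, ?_⟩
        · rw [Nat.floor_lt (by positivity)]; nlinarith
        · rw [div_le_iff₀ hN0]; exact Nat.floor_le (by positivity)
        · rw [le_div_iff₀ hN0]; exact (Nat.lt_floor_add_one _).le
    refine Set.mem_biUnion (x := k) (by simpa using hk) (Set.mem_iUnion.2 ⟨n, ?_, ?_⟩)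
    · exact ⟨⟨hk1, hk2⟩, hω⟩
    · intro i hi
      obtain rfl : i = n := by
        have := Finset.mem_Ico.1 hi; omega
      rw [walk_succ] at h2
      simp only [Prod.fst_add] at h2
      change t * (1 - (k + 1) / N) < S i ω
      have : t * b ≤ t * ((k + 1) / N) := by gcongr
      rw [mul_sub, mul_one]
      linarith
  refine (measure_mono hsub).trans ((measure_union_le _ _).trans ?_)
  rw [h.measure_walk_fst_le_eq_zero, zero_add]
  refine (measure_biUnion_finset_le _ _).trans (Finset.sum_le_sum fun k _ => ?_)
  refine (measure_iUnion_le _).trans ?_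
  rw [visits, ← ENNReal.tsum_mul_right]
  refine ENNReal.tsum_le_tsum fun n => ?_
  rw [h.measure_walk_inter n 1 (hA k) (hQ k), pow_one]
  exact le_rfl

lemma eventually_visits_mul_tail_le {A : Set (ℝ × E)}
    (hA : HasVisitBound (stepLaw P (S 0) (X 0)) A) {r c u x : ℝ} (hu : 0 ≤ u)
    (hr : ∀ z ∈ A, (r : EReal) ≤ dualRate (stepLaw P (S 0) (X 0)) z)
    (hc : (c : EReal) < ellSup P (S 0)) (hx : x < r + c * u) :
    ∀ᶠ t : ℝ in atTop, visits (stepLaw P (S 0) (X 0)) A t * P {ω | t * u < S 0 ω} ≤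
      eexp (-x * t) := by
  filter_upwards [hA r (x - c * u) (by linarith) hr, eventually_scaled_tail_le hu hc] with t h1 h2
  refine (mul_le_mul' h1 h2).trans ?_
  rw [← eexp_add, eexp_le_eexp]
  linarith

lemma eventually_le_of_pieces {F : Set E} (hF : MeasurableSet F) {N : ℕ} (hN : 0 < N) {x x' : ℝ}
    (hx : x < x')
    (hk : ∀ k < N, ∀ᶠ t : ℝ in atTop, visits (stepLaw P (S 0) (X 0))
        (Set.Icc ((k : ℝ) / N) ((k + 1) / N) ×ˢ F) t *
        P {ω | t * (1 - (k + 1) / N) < S 0 ω} ≤ eexp (-x' * t)) :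
    ∀ᶠ t : ℝ in atTop, P {ω | t⁻¹ • cumulativeReward S X t ω ∈ F} ≤ eexp (-x * t) := by
  have hall := (Finset.eventually_all (Finset.range N)).2 fun k hk' =>
    hk k (Finset.mem_range.1 hk')
  filter_upwards [hall, eventually_gt_atTop 0, eventually_const_mul_eexp_le
    (C := N) (ENNReal.natCast_ne_top _) (a := -x') (b := -x) (by linarith)] with t h1 h2 h3
  refine (h.measure_cumulativeReward_le hF hN h2).trans (le_trans ?_ h3)
  refine (Finset.sum_le_card_nsmul _ _ _ h1).trans ?_
  simp

/-- The upper bound follows from bounds on the expected number of visits to strips. If the waiting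
times have superexponential tails, only visits at times close to `1` matter. -/
lemma upperBound_of_hasVisitBound {F : Set E} (hF : MeasurableSet F)
    (hV : ∀ a b : ℝ, b ≤ 1 → HasVisitBound (stepLaw P (S 0) (X 0)) (Set.Icc a b ×ˢ F))
    (hlim : ellSup P (S 0) = ⊤ → ∀ r r' : ℝ, r' < r →
      (∀ w ∈ F, (r : EReal) ≤ dualRate (stepLaw P (S 0) (X 0)) (1, w)) →
      ∃ a < 1, ∀ β ∈ Set.Icc a 1, ∀ w ∈ F,
        (r' : EReal) ≤ dualRate (stepLaw P (S 0) (X 0)) (β, w)) :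
    UpperBound P S X (rateSup P (S 0) (X 0)) F := by
  have := h.isProbabilityMeasure
  refine upperBound_of_forall_real fun x hx => ?_
  obtain ⟨y, hxy, hy⟩ := EReal.lt_iff_exists_real_btwn.1 hx
  rw [EReal.coe_lt_coe_iff] at hxy
  have hy' : ∀ w ∈ F, (y : EReal) ≤ rateSup P (S 0) (X 0) w := fun w hw =>
    hy.le.trans (iInf₂_le w hw)
  rcases ereal_nonneg_cases (ellSup_nonneg (P := P) (s := S 0)) with hℓ | ⟨L, hL, hℓ⟩
  · simp only [rateSup, hℓ, rateOf_top (h.measurable_time 0) (h.measurable_reward 0)] at hy'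
    obtain ⟨x', hx', hx''⟩ := exists_between hxy
    obtain ⟨r, hr, hr'⟩ := exists_between hx''
    obtain ⟨a, ha, hD⟩ := hlim hℓ y r hr' hy'
    obtain ⟨N, hN0, hNa⟩ : ∃ N : ℕ, 0 < N ∧ 1 / (N : ℝ) ≤ 1 - a := by
      obtain ⟨n, hn⟩ := exists_nat_one_div_lt (sub_pos.2 ha)
      exact ⟨n + 1, by omega, by exact_mod_cast hn.le⟩
    have hN : (0 : ℝ) < N := by exact_mod_cast hN0
    refine h.eventually_le_of_pieces hF hN0 hx' fun k hk => ?_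
    have hkN : ((k : ℝ) + 1) / N ≤ 1 := by
      rw [div_le_one hN]; exact_mod_cast hk
    rcases hkN.eq_or_lt with hk1 | hk1
    -- In the last strip the tail factor is bounded by 1 and the visits give the whole rate.
    · refine h.eventually_visits_mul_tail_le (hV _ _ hkN) (r := r) (c := 0) (by linarith) ?_
        (by rw [hℓ]; exact EReal.coe_lt_top 0) (by linarith)
      rintro ⟨β, w⟩ ⟨hβ, hw⟩
      refine hD β ⟨?_, hβ.2.trans hkN⟩ w hw
      have h1 := hβ.1
      have : (k : ℝ) / N = (k + 1) / N - 1 / N := by ring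
      dsimp only at h1
      linarith
    -- In the other strips the required waiting time is a positive fraction of t, so its
    -- superexponential tail alone suffices; c is chosen to give the exponent x' + 1.
    · refine h.eventually_visits_mul_tail_le (hV _ _ hkN) (r := 0)
        (c := (x' + 1) / (1 - (k + 1) / N)) (by linarith) (fun z _ => dualRate_nonneg z)
        (by rw [hℓ]; exact EReal.coe_lt_top _) ?_
      rw [div_mul_cancel₀ _ (by linarith)]
      linarith
  -- Finite ℓ: the strip width costs L/N ≤ η and replacing L by L - η costs at most η more, which
  -- leaves at least x + 2η.
  · set η := (y - x) / 4
    have hη : 0 < η := by simp only [η]; linarith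
    obtain ⟨N, hN0, hNL⟩ : ∃ N : ℕ, 0 < N ∧ L / (N : ℝ) ≤ η := by
      obtain ⟨n, hn⟩ := exists_nat_gt (L / η)
      refine ⟨n + 1, by omega, ?_⟩
      push_cast
      rw [div_lt_iff₀ hη] at hn
      rw [div_le_iff₀ (by positivity)]
      nlinarith
    have hN : (0 : ℝ) < N := by exact_mod_cast hN0
    refine h.eventually_le_of_pieces hF hN0 (x' := x + η) (by linarith) fun k hk => ?_
    have hkN : ((k : ℝ) + 1) / N ≤ 1 := by
      rw [div_le_one hN]; exact_mod_cast hk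
    have hk0 : (0 : ℝ) ≤ k / N := by positivity
    have hk0' : (0 : ℝ) ≤ (k + 1) / N := by positivity
    refine h.eventually_visits_mul_tail_le (hV _ _ hkN) (r := y - (1 - k / N) * L) (c := L - η)
      (by linarith) ?_ (by rw [hℓ]; exact EReal.coe_lt_coe_iff.2 (by linarith)) ?_
    · rintro ⟨β, w⟩ ⟨hβ, hw⟩
      have hβ1 := hβ.1
      have hβ2 := hβ.2
      dsimp only at hβ1 hβ2
      have h1 := hy' w hw
      simp only [rateSup, hℓ] at h1
      have h2 : ((y - (1 - β) * L : ℝ) : EReal) ≤ dualRate (stepLaw P (S 0) (X 0)) (β, w) := by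
        by_contra! hlt
        exact absurd ((rateOf_coe_lt_iff (h.measurable_time 0) (h.measurable_reward 0)).2
          ⟨β, ⟨by linarith, by linarith⟩, hlt⟩) (not_lt.2 h1)
      refine le_trans (EReal.coe_le_coe_iff.2 ?_) h2
      have : (1 - β) * L ≤ (1 - k / N) * L := by gcongr
      linarith
    · have e1 : ((k : ℝ) + 1) / N = k / N + 1 / N := by ring
      have e2 : L / N = L * (1 / N) := by ring
      have e3 : η * (1 - (k + 1) / N) ≤ η * 1 := by gcongr; linarith
      have e4 : y = x + 4 * η := by simp only [η]; ring
      have e5 : y - (1 - k / N) * L + (L - η) * (1 - (k + 1) / N) =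
          y - L * (1 / N) - η * (1 - (k + 1) / N) := by rw [e1]; ring
      rw [e5]
      linarith

end IsRenewalReward
end UpperBound

/-! ### Sets exhausted by compact convex subsets -/

section ConvexHull

variable {E : Type*} [NormedAddCommGroup E] [NormedSpace ℝ E]

lemma isCompact_convexJoin {s t : Set E} (hs : IsCompact s) (ht : IsCompact t) :
    IsCompact (convexJoin ℝ s t) := by
  have h : convexJoin ℝ s t =
      (fun p : ℝ × E × E => (1 - p.1) • p.2.1 + p.1 • p.2.2) '' (Set.Icc (0 : ℝ) 1 ×ˢ s ×ˢ t) := by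
    ext z
    simp only [mem_convexJoin, segment_eq_image, Set.mem_image, Prod.exists, Set.mem_prod]
    constructor
    · rintro ⟨x, hx, y, hy, θ, hθ, rfl⟩
      exact ⟨θ, x, y, ⟨hθ, hx, hy⟩, rfl⟩
    · rintro ⟨θ, x, y, ⟨hθ, hx, hy⟩, rfl⟩
      exact ⟨x, hx, y, hy, θ, hθ, rfl⟩
  rw [h]
  exact (isCompact_Icc.prod (hs.prod ht)).image (by fun_prop)

/-- In finite dimension, the convex hull of a compact set is compact. -/
lemma isCompact_convexHull_of_finiteDimensional [FiniteDimensional ℝ E] {K : Set E}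
    (hK : IsCompact K) : IsCompact (convexHull ℝ K) := by
  classical
  rcases K.eq_empty_or_nonempty with rfl | ⟨x₀, hx₀⟩
  · simp
  set J : ℕ → Set E := fun n => (convexJoin ℝ K)^[n] K
  have hsucc : ∀ n, J (n + 1) = convexJoin ℝ K (J n) := fun n =>
    Function.iterate_succ_apply' _ _ _
  have hmono : Monotone J := monotone_nat_of_le_succ fun n y hy => by
    rw [hsucc]
    exact mem_convexJoin.2 ⟨x₀, hx₀, y, hy, right_mem_segment ℝ x₀ y⟩
  have hcomp : ∀ n, IsCompact (J n) := fun n => by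
    induction n with
    | zero => exact hK
    | succ n ih => rw [hsucc]; exact isCompact_convexJoin hK ih
  have hle : ∀ n, J n ⊆ convexHull ℝ K := fun n => by
    induction n with
    | zero => exact subset_convexHull ℝ K
    | succ n ih =>
      rw [hsucc]
      intro z hz
      obtain ⟨x, hx, y, hy, hz⟩ := mem_convexJoin.1 hz
      exact (convex_convexHull ℝ K).segment_subset (subset_convexHull ℝ K hx) (ih hy) hz
  have hfin : ∀ (n : ℕ) (t : Finset E), (t : Set E) ⊆ K → t.card = n + 1 →
      convexHull ℝ (t : Set E) ⊆ J n := by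
    intro n
    induction n with
    | zero =>
      intro t ht hc
      obtain ⟨x, rfl⟩ := Finset.card_eq_one.1 hc
      rw [Finset.coe_singleton, convexHull_singleton, ← Finset.coe_singleton]
      exact ht
    | succ n ih =>
      intro t ht hc
      obtain ⟨x, t', -, rfl, hc'⟩ := Finset.card_eq_succ.1 hc
      rw [Finset.coe_insert, Set.insert_subset_iff] at ht
      rw [Finset.coe_insert, convexHull_insert (by
        rw [Finset.coe_nonempty, ← Finset.card_pos]; omega), hsucc]
      exact convexJoin_mono (Set.singleton_subset_iff.2 ht.1) (ih t' ht.2 hc')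
  -- Carathéodory: affinely independent finite sets have at most dim E + 1 points, so dim E iterated
  -- joins reach the whole hull.
  have heq : convexHull ℝ K = J (Module.finrank ℝ E) := by
    refine Set.Subset.antisymm ?_ (hle _)
    rw [convexHull_eq_union]
    refine Set.iUnion_subset fun t => Set.iUnion_subset fun ht => Set.iUnion_subset fun hind => ?_
    rcases Nat.eq_zero_or_pos t.card with h0 | hpos
    · rw [Finset.card_eq_zero.1 h0]; simp
    obtain ⟨n, hn⟩ := Nat.exists_eq_succ_of_ne_zero hpos.ne'
    refine (hfin n t ht hn).trans (hmono ?_)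
    have h1 := hind.card_le_finrank_succ
    rw [Fintype.card_coe] at h1
    have h2 := Submodule.finrank_le (vectorSpan ℝ (Set.range ((↑) : t → E)))
    omega
  rw [heq]
  exact hcomp _

variable [CompleteSpace E]

lemma convexlyExhausted_of_isClosed {F : Set E} (hF : IsClosed F) (hc : Convex ℝ F) :
    ConvexlyExhausted F := fun K hKF hK =>
  ⟨closure (convexHull ℝ K), closure_minimal (convexHull_min hKF hc) hF,
    isCompact_closure_convexHull hK, (convex_convexHull ℝ K).closure,
    (subset_convexHull ℝ K).trans subset_closure⟩

lemma convexlyExhausted_of_finiteDimensional [FiniteDimensional ℝ E] {F : Set E}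
    (hc : Convex ℝ F) : ConvexlyExhausted F := fun K hKF hK =>
  ⟨convexHull ℝ K, convexHull_min hKF hc, isCompact_convexHull_of_finiteDimensional hK,
    convex_convexHull ℝ K, subset_convexHull ℝ K⟩

open Pointwise in
-- The closed hull must be kept inside the open set. With s a finite δ-net of K, the set conv(s)
-- plus a closed δ-ball is closed, convex, contains K and lies in F.
lemma convexlyExhausted_of_isOpen {F : Set E} (hF : IsOpen F) (hc : Convex ℝ F) :
    ConvexlyExhausted F := by
  intro K hKF hK
  refine ⟨closure (convexHull ℝ K), ?_, isCompact_closure_convexHull hK,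
    (convex_convexHull ℝ K).closure, (subset_convexHull ℝ K).trans subset_closure⟩
  obtain ⟨δ, hδ, hsub⟩ := hK.exists_cthickening_subset_open hF hKF
  obtain ⟨s, hs, hcov⟩ := hK.elim_nhds_subcover (fun x => Metric.closedBall x δ)
    fun x _ => Metric.closedBall_mem_nhds x hδ
  have h1 : K ⊆ (s : Set E) + Metric.closedBall 0 δ := by
    intro x hx
    obtain ⟨y, hy, hxy⟩ := Set.mem_iUnion₂.1 (hcov hx)
    refine ⟨y, hy, x - y, ?_, by simp⟩
    rw [mem_closedBall_zero_iff, ← dist_eq_norm]; exact hxy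
  have h2 : (s : Set E) + Metric.closedBall 0 δ ⊆ F := by
    rintro _ ⟨y, hy, v, hv, rfl⟩
    refine hsub (Metric.mem_cthickening_of_dist_le _ y δ K (hs y hy) ?_)
    rw [mem_closedBall_zero_iff] at hv
    simpa [dist_eq_norm] using hv
  have h3 : convexHull ℝ (s : Set E) + Metric.closedBall 0 δ ⊆ F := by
    have := convexHull_min h2 hc
    rwa [convexHull_add, (convex_closedBall (0 : E) δ).convexHull_eq] at this
  refine Set.Subset.trans (closure_minimal (convexHull_min ?_ ?_) ?_) h3
  · exact h1.trans (Set.add_subset_add_right (subset_convexHull ℝ _))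
  · exact (convex_convexHull ℝ _).add (convex_closedBall 0 δ)
  · exact Metric.isClosed_closedBall.add_left_of_isCompact (s.finite_toSet.isCompact_convexHull ℝ)

lemma ConvexlyExhausted.prod_Icc {F : Set E} (hF : ConvexlyExhausted F) (a b : ℝ) :
    ConvexlyExhausted (Set.Icc a b ×ˢ F) := by
  intro K hKF hK
  obtain ⟨K', hK'F, hK', hc, hsub⟩ := hF (Prod.snd '' K)
    (by rintro _ ⟨z, hz, rfl⟩; exact (hKF hz).2) (hK.image continuous_snd)
  exact ⟨Set.Icc a b ×ˢ K', Set.prod_mono le_rfl hK'F, isCompact_Icc.prod hK',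
    (convex_Icc a b).prod hc, fun z hz => ⟨(hKF hz).1, hsub ⟨z, hz, rfl⟩⟩⟩

end ConvexHull

/-! ### Upper bounds for compact, convex and closed sets -/

section UpperBounds

variable {Ω E : Type*} [MeasurableSpace Ω] {P : Measure Ω} [IsProbabilityMeasure P]
  [NormedAddCommGroup E] [NormedSpace ℝ E] [CompleteSpace E]
  [SecondCountableTopology E] [MeasurableSpace E] [BorelSpace E]
  {S : ℕ → Ω → ℝ} {X : ℕ → Ω → E}

namespace IsRenewalReward

variable (h : IsRenewalReward P S X)
include h

lemma upperBound_of_isCompact {F : Set E} (hF : IsCompact F) :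
    UpperBound P S X (rateSup P (S 0) (X 0)) F := by
  have := h.isProbabilityMeasure
  refine h.upperBound_of_hasVisitBound hF.isClosed.measurableSet
    (fun a b _ => hasVisitBound_of_isCompact h.ae_pos (isCompact_Icc.prod hF)) ?_
  intro _ r r' hr hD
  have key : ∀ᶠ β in 𝓝 (1 : ℝ), ∀ w ∈ F, (r' : EReal) < dualRate (stepLaw P (S 0) (X 0)) (β, w) :=
    hF.eventually_forall_of_forall_eventually fun w hw =>
      lowerSemicontinuous_dualRate (1, w) _
        (lt_of_lt_of_le (EReal.coe_lt_coe_iff.2 hr) (hD w hw))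
  obtain ⟨ε, hε, hball⟩ := Metric.eventually_nhds_iff.1 key
  refine ⟨1 - ε / 2, by linarith, fun β hβ w hw => (hball ?_ w hw).le⟩
  rw [Real.dist_eq, abs_sub_lt_iff]
  constructor <;> linarith [hβ.1, hβ.2]

/-- If ℓ_s = +∞, F need not be compact, so passing from β near 1 to β = 1 needs uniformity in w.
Sublinearity provides it: the support function at (1, w) is at most its value at (β, w) plus (1 - β)
times its value at (1, 0), which is where finiteness of the rate at 0 enters. -/
lemma upperBound_of_convexlyExhausted {F : Set E} (hF : MeasurableSet F)
    (hex : ConvexlyExhausted F)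
    (hfin : ellSup P (S 0) < ⊤ ∨ rateSup P (S 0) (X 0) 0 < ⊤) :
    UpperBound P S X (rateSup P (S 0) (X 0)) F := by
  have := h.isProbabilityMeasure
  refine h.upperBound_of_hasVisitBound hF
    (fun a b _ => hasVisitBound_of_convexlyExhausted h.ae_pos (measurableSet_Icc.prod hF)
      (hex.prod_Icc a b) (b := b) fun z hz => hz.1.2) ?_
  intro hℓ r r' hr hD
  have h0 : dualRate (stepLaw P (S 0) (X 0)) (1, 0) < ⊤ := by
    rcases hfin with hfin | hfin
    · exact absurd hℓ hfin.ne
    · rwa [rateSup, hℓ, rateOf_top (h.measurable_time 0) (h.measurable_reward 0)] at hfin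
  obtain ⟨d, hd, -⟩ := EReal.lt_iff_exists_real_btwn.1 h0
  have hd0 : 0 < d := EReal.coe_pos.1 ((dualRate_nonneg _).trans_lt hd)
  refine ⟨1 - (r - r') / (2 * d), ?_, fun β hβ w hw => ?_⟩
  · have : 0 < (r - r') / (2 * d) := div_pos (by linarith) (by linarith)
    linarith
  · by_contra! hlt
    have h1 := dualRate_combo_le zero_le_one (sub_nonneg.2 hβ.2) hlt.le hd.le
    have h2 : (1 : ℝ) • (β, w) + (1 - β) • ((1, 0) : ℝ × E) = (1, w) := by
      ext <;> simp
    rw [h2] at h1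
    have h3 := EReal.coe_le_coe_iff.1 ((hD w hw).trans h1)
    have h4 : (1 - β) * d ≤ (r - r') / (2 * d) * d := by
      gcongr; linarith [hβ.1]
    have h5 : (r - r') / (2 * d) * d = (r - r') / 2 := by field_simp
    linarith

lemma upperBound_of_isClosed_of_expTight (ht : ExpTight P S X) {F : Set E} (hF : IsClosed F) :
    UpperBound P S X (rateSup P (S 0) (X 0)) F := by
  refine upperBound_of_forall_real fun x hx => ?_
  obtain ⟨K, hK, hKt⟩ := ht (|x| + 2) (by positivity)
  obtain ⟨y, hxy, hy⟩ := EReal.lt_iff_exists_real_btwn.1 hx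
  rw [EReal.coe_lt_coe_iff] at hxy
  have h1 : limsup (logProb P S X (F ∩ K)) atTop < ((-((x + y) / 2) : ℝ) : EReal) := by
    refine (h.upperBound_of_isCompact (hK.inter_left hF)).trans_lt ?_
    rw [EReal.coe_neg, EReal.neg_lt_neg_iff]
    refine lt_of_lt_of_le ?_ (hy.le.trans (biInf_mono Set.inter_subset_left))
    rw [EReal.coe_lt_coe_iff]; linarith
  have h2 : limsup (logProb P S X Kᶜ) atTop < ((-(|x| + 1) : ℝ) : EReal) :=
    hKt.trans_lt (EReal.coe_lt_coe_iff.2 (by linarith))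
  filter_upwards [eventually_le_of_limsup_logProb_lt h1, eventually_le_of_limsup_logProb_lt h2,
    eventually_const_mul_eexp_le (C := 2) (by simp) (a := -(min ((x + y) / 2) (|x| + 1)))
      (b := -x) (by
        rw [neg_lt_neg_iff, lt_min_iff]
        exact ⟨by linarith, by linarith [le_abs_self x]⟩),
    eventually_ge_atTop 0] with t e1 e2 e3 ht0
  calc P {ω | t⁻¹ • cumulativeReward S X t ω ∈ F}
      ≤ P ({ω | t⁻¹ • cumulativeReward S X t ω ∈ F ∩ K} ∪
          {ω | t⁻¹ • cumulativeReward S X t ω ∈ Kᶜ}) := by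
        refine measure_mono fun ω hω => ?_
        by_cases hk : t⁻¹ • cumulativeReward S X t ω ∈ K
        · exact Or.inl ⟨hω, hk⟩
        · exact Or.inr hk
    _ ≤ eexp (-((x + y) / 2) * t) + eexp (-(|x| + 1) * t) :=
        (measure_union_le _ _).trans (add_le_add e1 e2)
    _ ≤ 2 * eexp (-(min ((x + y) / 2) (|x| + 1)) * t) := by
        rw [two_mul]
        refine add_le_add ?_ ?_ <;> rw [eexp_le_eexp] <;> gcongr
        · exact min_le_left _ _
        · exact min_le_right _ _
    _ ≤ eexp (-x * t) := e3

end IsRenewalReward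
end UpperBounds

/-! ### The lower bound: one long wait, or filler steps -/

section LowerBound

lemma cramerCone_lower {V : Type*} [NormedAddCommGroup V] [NormedSpace ℝ V]
    [MeasurableSpace V] [BorelSpace V] [SecondCountableTopology V] {μ : Measure V}
    [IsProbabilityMeasure μ] {z : V} {a b ε : ℝ} (h : (z, a) ∈ cramerCone μ) (hab : a < b)
    (hε : 0 < ε) :
    ∀ᶠ t : ℝ in atTop, ∃ n, eexp (-b * t) ≤ iterConv μ n (Metric.closedBall (t • z) (ε * t)) := by
  obtain ⟨γ, hγ, h⟩ := h
  filter_upwards [cramer_lower h hγ.le hε (sub_pos.2 hab)] with t ht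
  refine ⟨⌊γ * t⌋₊, ?_⟩
  have h1 : (γ * t) • (γ⁻¹ • (z, a)).1 = t • z := by
    rw [Prod.smul_fst, smul_smul]; congr 1; field_simp
  have h2 : -((γ * (γ⁻¹ • (z, a)).2 + (b - a)) * t) = -b * t := by
    rw [Prod.smul_snd, smul_eq_mul, mul_inv_cancel_left₀ hγ.ne']; ring
  rwa [h1, h2] at ht

variable {Ω E : Type*} [MeasurableSpace Ω] {P : Measure Ω} [IsProbabilityMeasure P]
  [NormedAddCommGroup E] [NormedSpace ℝ E] [CompleteSpace E]
  [SecondCountableTopology E] [MeasurableSpace E] [BorelSpace E]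
  {S : ℕ → Ω → ℝ} {X : ℕ → Ω → E}

namespace IsRenewalReward

variable (h : IsRenewalReward P S X)
include h

/-- The walk first visits a ball around t(β, w), then one waiting time jumps over t. The jump is
taken longer than t(1 - β + 2δ) because the walk may arrive early, by up to 2δt: δt from the visited
ball and δt from its center. -/
lemma eventually_le_of_upsilon_lt_of_tail {G : Set E} (hG : IsOpen G) {w : E} (hw : w ∈ G)
    {β a₁ a₂ a : ℝ} (hβ : β < 1) (h₁ : upsilon P (S 0) (X 0) β w < a₁)
    (h₂ : ellInf P (S 0) < a₂) (ha : a₁ + (1 - β) * a₂ < a) :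
    ∀ᶠ t : ℝ in atTop, eexp (-a * t) ≤ P {ω | t⁻¹ • cumulativeReward S X t ω ∈ G} := by
  have := h.isProbabilityMeasure
  have ha₂ : 0 < a₂ := EReal.coe_pos.1 (ellInf_nonneg.trans_lt h₂)
  obtain ⟨ρ, hρ, hball⟩ := Metric.isOpen_iff.1 hG w hw
  obtain ⟨δ, hδ, hδ1, hδ2, hδ3⟩ : ∃ δ > 0, 2 * δ ≤ ρ ∧ 2 * δ ≤ 1 - β ∧
      a₁ + (1 - β + 2 * δ) * a₂ ≤ a := by
    have e : 0 < (a - (a₁ + (1 - β) * a₂)) / (2 * a₂) := div_pos (by linarith) (by linarith)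
    set m := min ((1 - β) / 2) ((a - (a₁ + (1 - β) * a₂)) / (2 * a₂))
    refine ⟨min (ρ / 2) m, lt_min (by linarith) (lt_min (by linarith) e), ?_, ?_, ?_⟩
    · linarith [min_le_left (ρ / 2) m]
    · linarith [(min_le_right (ρ / 2) m).trans (min_le_left _ _)]
    · have := (min_le_right (ρ / 2) m).trans (min_le_right _ _)
      rw [le_div_iff₀ (by linarith)] at this
      linarith
  obtain ⟨z, hz, a', ha', hcone⟩ := exists_cramerCone_of_upsilon_lt (h.measurable_time 0)
    (h.measurable_reward 0) h₁ hδ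
  obtain ⟨⟨hb1, hb2⟩, hv⟩ := mem_ball_prod_iff.1 hz
  dsimp only at hb1 hb2 hv
  have hu : 0 < 1 - β + 2 * δ := by linarith
  filter_upwards [cramerCone_lower hcone ha' hδ, (tendsto_id.atTop_mul_const hu).eventually
    (eventually_le_tail h₂), eventually_gt_atTop 0] with t ht1 ht2 ht0
  obtain ⟨n, hn⟩ := ht1
  set Q : Set (ℝ × E) := {y | t * (1 - β + 2 * δ) < y.1}
  have hQ : MeasurableSet Q := measurableSet_lt measurable_const measurable_fst
  calc eexp (-a * t) ≤ eexp (-a₁ * t) * eexp (-a₂ * (t * (1 - β + 2 * δ))) := by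
        rw [← eexp_add, eexp_le_eexp]
        have : (a₁ + (1 - β + 2 * δ) * a₂) * t ≤ a * t := by gcongr
        linarith
    _ ≤ iterConv (stepLaw P (S 0) (X 0)) n (Metric.closedBall (t • z) (δ * t)) *
          P {ω | (S 0 ω, X 0 ω) ∈ Q} ^ 1 := by
        rw [pow_one]; exact mul_le_mul' hn ht2
    _ = _ := (h.measure_walk_inter n 1 Metric.isClosed_closedBall.measurableSet hQ).symm
    _ ≤ _ := by
        refine measure_mono ?_
        rintro ω ⟨hω1, hω2⟩
        have hω2 := hω2 n (by simp)
        change t * (1 - β + 2 * δ) < S n ω at hω2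
        rw [Metric.mem_closedBall, Prod.dist_eq, max_le_iff] at hω1
        obtain ⟨hω1, hω3⟩ := hω1
        rw [Real.dist_eq, abs_le, Prod.smul_fst, smul_eq_mul] at hω1
        have e1 : t * z.1 ≤ t * (β + δ) := by gcongr
        have e2 : t * (β - δ) ≤ t * z.1 := by gcongr
        have e3 : t * (2 * δ) ≤ t * (1 - β) := by gcongr
        have hW := cumulativeReward_eq_walk (X := X) h.pos (n := n) (t := t) (ω := ω)
          (by nlinarith) (by rw [walk_succ, Prod.fst_add]; dsimp only; nlinarith)
        refine hball ?_
        rw [hW, Metric.mem_ball]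
        have e4 : dist (t⁻¹ • (walk S X n ω).2) z.2 ≤ δ := by
          have : t⁻¹ • (walk S X n ω).2 - z.2 = t⁻¹ • ((walk S X n ω).2 - t • z.2) := by
            rw [smul_sub, inv_smul_smul₀ ht0.ne']
          rw [dist_eq_norm, this, norm_smul, norm_inv, Real.norm_eq_abs, abs_of_pos ht0,
            inv_mul_le_iff₀ ht0, ← dist_eq_norm, mul_comm]
          exact hω3
        have e5 := dist_triangle (t⁻¹ • (walk S X n ω).2) z.2 w
        rw [Metric.mem_ball] at hv
        linarith

lemma exists_filler : ∃ s₀ M q : ℝ, 0 < s₀ ∧ 0 ≤ M ∧ 0 ≤ q ∧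
    eexp (-q) ≤ P {ω | (S 0 ω, X 0 ω) ∈ {z : ℝ × E | s₀ < z.1 ∧ ‖z.2‖ ≤ M}} := by
  obtain ⟨k, hk⟩ : ∃ k : ℕ, P {ω | 1 / ((k : ℝ) + 1) < S 0 ω ∧ ‖X 0 ω‖ ≤ k} ≠ 0 := by
    by_contra! hzero
    have h1 : P (⋃ k : ℕ, {ω | 1 / ((k : ℝ) + 1) < S 0 ω ∧ ‖X 0 ω‖ ≤ k}) = 0 :=
      measure_iUnion_null hzero
    have h2 : ⋃ k : ℕ, {ω | 1 / ((k : ℝ) + 1) < S 0 ω ∧ ‖X 0 ω‖ ≤ k} = Set.univ := by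
      refine Set.eq_univ_of_forall fun ω => ?_
      obtain ⟨n₁, hn₁⟩ := exists_nat_one_div_lt (h.pos 0 ω)
      obtain ⟨n₂, hn₂⟩ := exists_nat_ge ‖X 0 ω‖
      refine Set.mem_iUnion.2 ⟨max n₁ n₂, lt_of_le_of_lt ?_ hn₁, hn₂.trans ?_⟩
      · have : (n₁ : ℝ) ≤ (max n₁ n₂ : ℕ) := by exact_mod_cast le_max_left _ _
        gcongr
      · exact_mod_cast le_max_right _ _
    rw [h2, measure_univ] at h1
    exact one_ne_zero h1
  obtain ⟨y, hy⟩ := exists_eexp_eq hk (measure_ne_top P _)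
  refine ⟨1 / (k + 1), k, -y, by positivity, by positivity, ?_, ?_⟩
  · have : eexp y ≤ 1 := hy ▸ prob_le_one
    linarith [eexp_le_one.1 this]
  · rw [neg_neg, ← hy]; exact le_rfl

/-- The m filler steps together carry the walk past t, so the renewal index at time t lies among
them and at most m rewards of norm M are added. -/
lemma dist_walk_le {n m : ℕ} {s₀ M t : ℝ} (hM : 0 ≤ M) (ht : 0 ≤ t) {ω : Ω}
    (h1 : (walk S X n ω).1 ≤ t) (h2 : t < (walk S X n ω).1 + m * s₀)
    (hm : ∀ i ∈ Finset.Ico n (n + m), (S i ω, X i ω) ∈ {z : ℝ × E | s₀ < z.1 ∧ ‖z.2‖ ≤ M}) :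
    ‖cumulativeReward S X t ω - (walk S X n ω).2‖ ≤ m * M := by
  have h3 : t < (walk S X (n + m) ω).1 := by
    rw [walk_fst] at h2 ⊢
    rw [← Finset.sum_range_add_sum_Ico _ (Nat.le_add_right n m)]
    refine h2.trans_le ?_
    gcongr
    have := Finset.card_nsmul_le_sum (Finset.Ico n (n + m)) (fun i => S i ω) s₀
      fun i hi => (hm i hi).1.le
    simpa using this
  obtain ⟨n', hn', h4, h5⟩ := exists_renewal_index ht h3
  have hnn : n ≤ n' := by
    have := (walk_fst_strictMono (X := X) h.pos ω).lt_iff_lt.1 (h1.trans_lt h5)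
    omega
  rw [cumulativeReward_eq_walk h.pos h4 h5, walk_snd, walk_snd, ← Finset.sum_Ico_eq_sub _ hnn]
  refine (norm_sum_le_of_le (f := fun i => X i ω) _ (n := fun _ => M) fun i hi => ?_).trans ?_
  · have := Finset.mem_Ico.1 hi
    exact (hm i (Finset.mem_Ico.2 ⟨this.1, by omega⟩)).2
  · rw [Finset.sum_const, nsmul_eq_mul, Nat.card_Ico]
    gcongr
    omega

/-- A long waiting time cannot be used here, since ℓ_i may be infinite. The walk is aimed short of t
and the remaining gap, at most 4δt, is bridged by typical bounded steps whose total cost is O(δt).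
-/
lemma eventually_le_of_upsilon_one_lt {G : Set E} (hG : IsOpen G) {w : E} (hw : w ∈ G)
    {a₁ a : ℝ} (h₁ : upsilon P (S 0) (X 0) 1 w < a₁) (ha : a₁ < a) :
    ∀ᶠ t : ℝ in atTop, eexp (-a * t) ≤ P {ω | t⁻¹ • cumulativeReward S X t ω ∈ G} := by
  have := h.isProbabilityMeasure
  obtain ⟨ρ, hρ, hball⟩ := Metric.isOpen_iff.1 hG w hw
  obtain ⟨s₀, M, q, hs₀, hM, hq, hpq⟩ := h.exists_filler
  set B := 5 + 2 * ‖w‖ + 4 * (M / s₀)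
  have hB : 0 < B := by positivity
  obtain ⟨δ, hδ, hδ1, hδ2, hδ3⟩ : ∃ δ > 0, 4 * δ ≤ 1 ∧ δ * B ≤ ρ ∧
      4 * δ / s₀ * q ≤ (a - a₁) / 2 := by
    have e : 0 < (a - a₁) * s₀ / (8 * (q + 1)) :=
      div_pos (mul_pos (by linarith) hs₀) (by linarith)
    set m₂ := min (ρ / B) ((a - a₁) * s₀ / (8 * (q + 1)))
    refine ⟨min (1 / 4) m₂, ?_, ?_, ?_, ?_⟩
    · exact lt_min (by norm_num) (lt_min (div_pos hρ hB) e)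
    · linarith [min_le_left (1 / 4) m₂]
    · have := (min_le_right (1 / 4) m₂).trans (min_le_left _ _)
      rwa [le_div_iff₀ hB] at this
    · have := (min_le_right (1 / 4) m₂).trans (min_le_right _ _)
      have hpos : 0 < min (1 / 4) m₂ := lt_min (by norm_num) (lt_min (div_pos hρ hB) e)
      rw [le_div_iff₀ (by linarith)] at this
      rw [div_mul_eq_mul_div, div_le_iff₀ hs₀]
      linarith
  have hw0 := norm_nonneg w
  obtain ⟨z, hz, a', ha', hcone⟩ := exists_cramerCone_of_upsilon_lt (h.measurable_time 0)
    (h.measurable_reward 0) h₁ hδ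
  obtain ⟨⟨hb1, hb2⟩, hv⟩ := mem_ball_prod_iff.1 hz
  dsimp only at hb1 hb2 hv
  have hl : 0 < 1 - 2 * δ := by linarith
  -- Shrinking by 1 - 2δ puts the arrival time between (1 - 4δ)t and t, despite the error δ in z.1
  -- and the error δt of the walk.
  have hcone' := smul_mem_cramerCone hcone hl
  have ha'0 : 0 ≤ a' := cramerCone_nonneg hcone
  have hla : (1 - 2 * δ) * a' < a₁ := by nlinarith
  have e1 : ∀ᶠ t : ℝ in atTop, q ≤ (a - a₁) / 2 * t := by
    filter_upwards [eventually_ge_atTop (2 * q / (a - a₁))] with t ht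
    rw [div_le_iff₀ (by linarith)] at ht; linarith
  filter_upwards [cramerCone_lower hcone' hla hδ, e1, eventually_gt_atTop 0,
    eventually_ge_atTop (M / δ)] with t ht1 ht2 ht0 ht3
  rw [div_le_iff₀ hδ] at ht3
  obtain ⟨n, hn⟩ := ht1
  obtain ⟨m, hm1, hm2⟩ : ∃ m : ℕ, 4 * δ * t / s₀ < m ∧ (m : ℝ) ≤ 4 * δ * t / s₀ + 1 :=
    ⟨⌊4 * δ * t / s₀⌋₊ + 1, by exact_mod_cast Nat.lt_floor_add_one _, by
      push_cast; gcongr; exact Nat.floor_le (by positivity)⟩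
  set Q : Set (ℝ × E) := {z : ℝ × E | s₀ < z.1 ∧ ‖z.2‖ ≤ M}
  have hQ : MeasurableSet Q := (measurableSet_lt measurable_const measurable_fst).inter
    (measurableSet_le measurable_snd.norm measurable_const)
  calc eexp (-a * t) ≤ eexp (-a₁ * t) * eexp (-q) ^ m := by
        rw [← eexp_nat_mul, ← eexp_add, eexp_le_eexp]
        have f1 : m * q ≤ (4 * δ * t / s₀ + 1) * q := by gcongr
        have f2 : 4 * δ / s₀ * q * t ≤ (a - a₁) / 2 * t := by gcongr
        have f3 : 4 * δ * t / s₀ * q = 4 * δ / s₀ * q * t := by ring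
        linarith
    _ ≤ iterConv (stepLaw P (S 0) (X 0)) n
          (Metric.closedBall (t • (1 - 2 * δ) • z) (δ * t)) *
          P {ω | (S 0 ω, X 0 ω) ∈ Q} ^ m := by
        exact mul_le_mul' hn (pow_le_pow_left' hpq m)
    _ = _ := (h.measure_walk_inter n m Metric.isClosed_closedBall.measurableSet hQ).symm
    _ ≤ _ := by
        refine measure_mono ?_
        rintro ω ⟨hω1, hω2⟩
        rw [Metric.mem_closedBall, Prod.dist_eq, max_le_iff] at hω1
        obtain ⟨hω1, hω3⟩ := hω1
        rw [Real.dist_eq, abs_le, Prod.smul_fst, Prod.smul_fst, smul_eq_mul, smul_eq_mul] at hω1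
        have f1 : (1 - 2 * δ) * z.1 + δ ≤ 1 := by nlinarith
        have f2 : 1 - 4 * δ ≤ (1 - 2 * δ) * z.1 - δ := by nlinarith
        have f3 : t * ((1 - 2 * δ) * z.1 + δ) ≤ t * 1 := by gcongr
        have f4 : t * (1 - 4 * δ) ≤ t * ((1 - 2 * δ) * z.1 - δ) := by gcongr
        rw [div_lt_iff₀ hs₀] at hm1
        have hdist := h.dist_walk_le hM ht0.le (n := n) (m := m) (ω := ω) (t := t) (by linarith)
          (by linarith) hω2
        rw [dist_eq_norm] at hω3
        have hz2 : ‖z.2‖ ≤ ‖w‖ + δ := by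
          rw [mem_ball_iff_norm] at hv
          have := norm_le_norm_add_norm_sub' z.2 w
          linarith
        refine hball ?_
        rw [mem_ball_iff_norm] at hv ⊢
        have key : t⁻¹ • cumulativeReward S X t ω - w =
            t⁻¹ • (cumulativeReward S X t ω - (walk S X n ω).2) +
            t⁻¹ • ((walk S X n ω).2 - t • (1 - 2 * δ) • z.2) + (-(2 * δ)) • z.2 + (z.2 - w) := by
          rw [smul_sub t⁻¹ _ (t • (1 - 2 * δ) • z.2), inv_smul_smul₀ ht0.ne']
          module
        have g1 : ‖t⁻¹ • (cumulativeReward S X t ω - (walk S X n ω).2)‖ ≤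
            4 * δ * (M / s₀) + δ := by
          rw [norm_smul, norm_inv, Real.norm_eq_abs, abs_of_pos ht0, inv_mul_le_iff₀ ht0]
          refine hdist.trans ?_
          calc m * M ≤ (4 * δ * t / s₀ + 1) * M := by gcongr
            _ = t * (4 * δ * (M / s₀)) + M := by ring
            _ ≤ _ := by linarith
        have g2 : ‖t⁻¹ • ((walk S X n ω).2 - t • (1 - 2 * δ) • z.2)‖ ≤ δ := by
          rw [norm_smul, norm_inv, Real.norm_eq_abs, abs_of_pos ht0, inv_mul_le_iff₀ ht0]
          exact hω3.trans_eq (mul_comm _ _)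
        have g3 : ‖(-(2 * δ)) • z.2‖ ≤ 2 * δ * (‖w‖ + δ) := by
          rw [norm_smul, norm_neg, Real.norm_eq_abs, abs_of_pos (by linarith)]
          gcongr
        calc _ ≤ 4 * δ * (M / s₀) + δ + δ + 2 * δ * (‖w‖ + δ) + ‖z.2 - w‖ := by
              rw [key]
              exact (norm_add_le _ _).trans (add_le_add_left ((norm_add_le _ _).trans
                (add_le_add ((norm_add_le _ _).trans (add_le_add g1 g2)) g3)) _)
          _ < 4 * δ * (M / s₀) + δ + δ + 2 * δ * (‖w‖ + δ) + δ := by gcongr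
          _ ≤ δ * B := by simp only [B]; nlinarith
          _ ≤ ρ := hδ2

lemma lowerBound_of_isOpen {G : Set E} (hG : IsOpen G) :
    LowerBound P S X (rateInf P (S 0) (X 0)) G := by
  refine lowerBound_of_forall_real fun w hw a ha => ?_
  have hone : upsilon P (S 0) (X 0) 1 w < a →
      ∀ᶠ t : ℝ in atTop, eexp (-a * t) ≤ P {ω | t⁻¹ • cumulativeReward S X t ω ∈ G} := by
    intro ha
    obtain ⟨a₁, h1, h2⟩ := EReal.lt_iff_exists_real_btwn.1 ha
    exact h.eventually_le_of_upsilon_one_lt hG hw h1 (EReal.coe_lt_coe_iff.1 h2)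
  have hs := h.measurable_time 0
  have hx := h.measurable_reward 0
  rcases ereal_nonneg_cases (ellInf_nonneg (P := P) (s := S 0)) with hℓ | ⟨L, hL, hℓ⟩
  · rw [rateInf, hℓ, rateOf_top hs hx, ← upsilon_eq_dualRate hs hx] at ha
    exact hone ha
  · rw [rateInf, hℓ, rateOf_coe_lt_iff hs hx] at ha
    obtain ⟨β, hβ, hD⟩ := ha
    rw [← upsilon_eq_dualRate hs hx] at hD
    rcases hβ.2.eq_or_lt with rfl | hβ1
    · exact hone (by simpa using hD)
    obtain ⟨a₁, h1, h2⟩ := EReal.lt_iff_exists_real_btwn.1 hD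
    rw [EReal.coe_lt_coe_iff] at h2
    obtain ⟨a₂, h3, h4⟩ := exists_between (show L < (a - a₁) / (1 - β) by
      rw [lt_div_iff₀ (by linarith)]; linarith)
    rw [lt_div_iff₀ (by linarith)] at h4
    exact h.eventually_le_of_upsilon_lt_of_tail hG hw hβ1 h1
      (by rw [hℓ]; exact EReal.coe_lt_coe_iff.2 h3) (by linarith)

end IsRenewalReward
end LowerBound

/-! ### Exponential tightness and goodness in finite dimension -/

section ExponentialTightness

variable {Ω E : Type*} [MeasurableSpace Ω] {P : Measure Ω} [IsProbabilityMeasure P]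
  [NormedAddCommGroup E] [NormedSpace ℝ E] [CompleteSpace E]
  [SecondCountableTopology E] [MeasurableSpace E] [BorelSpace E]
  {S : ℕ → Ω → ℝ} {X : ℕ → Ω → E}

namespace IsRenewalReward

variable (h : IsRenewalReward P S X)
include h

lemma lintegral_prod_step {f : ℝ × E → ENNReal} (hf : Measurable f) (n : ℕ) :
    ∫⁻ ω, ∏ i ∈ Finset.range n, f (S i ω, X i ω) ∂P = (∫⁻ ω, f (S 0 ω, X 0 ω) ∂P) ^ n :=
  lintegral_prod_walk h.measurable_step h.indep h.ident hf n

/-- Chernoff's bound for sums of functions of the steps. -/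
lemma measure_le_sum_step {f : ℝ × E → ℝ} (hf : Measurable f) (n : ℕ) (c : ℝ) :
    P {ω | c ≤ ∑ i ∈ Finset.range n, f (S i ω, X i ω)} ≤
      eexp (-c) * (∫⁻ ω, eexp (f (S 0 ω, X 0 ω)) ∂P) ^ n := by
  have hfe : Measurable fun z => eexp (f z) := measurable_eexp.comp hf
  have hprod : ∀ ω, ∏ i ∈ Finset.range n, eexp (f (S i ω, X i ω)) =
      eexp (∑ i ∈ Finset.range n, f (S i ω, X i ω)) := fun ω => by
    induction n with
    | zero => simp
    | succ n ih => rw [Finset.prod_range_succ, Finset.sum_range_succ, eexp_add, ih]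
  have hm : Measurable fun ω => eexp (∑ i ∈ Finset.range n, f (S i ω, X i ω)) :=
    measurable_eexp.comp (Finset.measurable_fun_sum _ fun i _ => hf.comp (h.measurable_step i))
  rw [← h.lintegral_prod_step hfe]
  simp only [hprod]
  have h1 := mul_meas_ge_le_lintegral hm (eexp c) (μ := P)
  simp only [eexp_le_eexp] at h1
  calc _ = eexp (-c) * (eexp c * P {ω | c ≤ ∑ i ∈ Finset.range n, f (S i ω, X i ω)}) := by
        rw [← mul_assoc, eexp_neg_mul_self, one_mul]
    _ ≤ _ := by gcongr

/-- As ζ decreases to -∞ the integrand tends to 0 because the waiting times are positive, and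
dominated convergence applies. -/
lemma exists_lintegral_eexp_lt_one {ζ σ : ℝ}
    (hfin : ∫⁻ ω, eexp (ζ * S 0 ω + σ * ‖X 0 ω‖) ∂P < ⊤) :
    ∃ ζ' ≤ 0, ∫⁻ ω, eexp (ζ' * S 0 ω + σ * ‖X 0 ω‖) ∂P < 1 := by
  have hm : ∀ ζ : ℝ, Measurable fun ω => eexp (ζ * S 0 ω + σ * ‖X 0 ω‖) := fun ζ =>
    measurable_eexp.comp (((h.measurable_time 0).const_mul ζ).add
      ((h.measurable_reward 0).norm.const_mul σ))
  have hlim : Tendsto (fun k : ℕ => ∫⁻ ω, eexp ((ζ - k) * S 0 ω + σ * ‖X 0 ω‖) ∂P) atTop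
      (𝓝 (∫⁻ _, 0 ∂P)) := by
    refine tendsto_lintegral_of_dominated_convergence _ (fun k => hm (ζ - k)) (fun k => ?_)
      hfin.ne ?_
    · refine Eventually.of_forall fun ω => ?_
      simp only [eexp_le_eexp]
      have : (0 : ℝ) ≤ k * S 0 ω := mul_nonneg (Nat.cast_nonneg k) (h.pos 0 ω).le
      linarith
    · refine Eventually.of_forall fun ω => tendsto_eexp_atBot.comp ?_
      have h1 := (tendsto_natCast_atTop_atTop (R := ℝ)).atTop_mul_const (h.pos 0 ω)
      have h2 := tendsto_atBot_add_const_left atTop (ζ * S 0 ω + σ * ‖X 0 ω‖)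
        (tendsto_neg_atTop_atBot.comp h1)
      refine h2.congr fun k => ?_
      simp only [Function.comp]; ring
  rw [lintegral_zero] at hlim
  obtain ⟨k, hk, hk1⟩ := ((hlim.eventually (gt_mem_nhds one_pos)).and
    (eventually_ge_atTop ⌈ζ⌉₊)).exists
  refine ⟨ζ - k, ?_, hk⟩
  have : ζ ≤ k := (Nat.le_ceil ζ).trans (by exact_mod_cast hk1)
  linarith

lemma expTight_of_finiteDimensional [FiniteDimensional ℝ E] {ζ σ : ℝ} (hζ : ζ ≤ 0) (hσ : 0 < σ)
    (hρ : ∫⁻ ω, eexp (ζ * S 0 ω + σ * ‖X 0 ω‖) ∂P < 1) : ExpTight P S X := by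
  intro a ha
  have : ProperSpace E := FiniteDimensional.proper_real E
  -- Before time t the sum of the ζS_i is at least ζt. Thus norms adding to more than Rt force the
  -- exponent ζS + σ‖X‖ to sum to at least (a + 1)t.
  set R := (a + 1 - ζ) / σ
  have hR : σ * R = a + 1 - ζ := mul_div_cancel₀ _ hσ.ne'
  refine ⟨Metric.closedBall 0 R, isCompact_closedBall 0 R, ?_⟩
  set ρ := ∫⁻ ω, eexp (ζ * S 0 ω + σ * ‖X 0 ω‖) ∂P
  have hC : (1 - ρ)⁻¹ ≠ ⊤ := ENNReal.inv_ne_top.2 (tsub_pos_of_lt hρ).ne'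
  have hf : Measurable fun z : ℝ × E => ζ * z.1 + σ * ‖z.2‖ := by fun_prop
  apply limsup_logProb_le
  filter_upwards [eventually_const_mul_eexp_le hC (a := -(a + 1)) (b := -a) (by linarith),
    eventually_gt_atTop 0] with t ht ht0
  refine le_trans ?_ ht
  have hsub : {ω | t⁻¹ • cumulativeReward S X t ω ∈ (Metric.closedBall (0 : E) R)ᶜ} ⊆
      {ω | ∀ n, (walk S X n ω).1 ≤ t} ∪ ⋃ n, {ω | (a + 1) * t ≤
        ∑ i ∈ Finset.range n, (ζ * S i ω + σ * ‖X i ω‖)} := by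
    intro ω hω
    by_cases hall : ∀ n, (walk S X n ω).1 ≤ t
    · exact Or.inl hall
    right
    push Not at hall
    obtain ⟨m, hm⟩ := hall
    obtain ⟨n, -, h1, h2⟩ := exists_renewal_index ht0.le hm
    refine Set.mem_iUnion.2 ⟨n, ?_⟩
    simp only [Set.mem_ofPred_eq, Set.mem_compl_iff, mem_closedBall_zero_iff, not_le,
      cumulativeReward_eq_walk h.pos h1 h2] at hω ⊢
    rw [norm_smul, norm_inv, Real.norm_eq_abs, abs_of_pos ht0, ← div_eq_inv_mul,
      lt_div_iff₀ ht0, walk_snd] at hω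
    rw [Finset.sum_add_distrib, ← Finset.mul_sum, ← Finset.mul_sum, ← walk_fst (X := X)]
    have h3 : ζ * t ≤ ζ * (walk S X n ω).1 := mul_le_mul_of_nonpos_left h1 hζ
    have h4 : σ * (R * t) ≤ σ * ∑ i ∈ Finset.range n, ‖X i ω‖ := by
      gcongr
      exact hω.le.trans (norm_sum_le _ _)
    have h5 : σ * (R * t) = (a + 1 - ζ) * t := by rw [← hR]; ring
    linarith
  refine (measure_mono hsub).trans ((measure_union_le _ _).trans ?_)
  rw [h.measure_walk_fst_le_eq_zero, zero_add]
  refine (measure_iUnion_le _).trans ?_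
  rw [← ENNReal.tsum_geometric, ← ENNReal.tsum_mul_right]
  refine ENNReal.tsum_le_tsum fun n => ?_
  rw [neg_mul]
  exact (h.measure_le_sum_step hf n ((a + 1) * t)).trans_eq (mul_comm _ _)

/-- For a norming functional φ of w, the pair (ζ, σφ) is admissible in the dual formula since φ(X) ≤
‖X‖. -/
lemma le_dualRate_of_lintegral_lt_one {ζ σ : ℝ} (hσ : 0 < σ)
    (hρ : ∫⁻ ω, eexp (ζ * S 0 ω + σ * ‖X 0 ω‖) ∂P ≤ 1) (β : ℝ) (w : E) :
    ((ζ * β + σ * ‖w‖ : ℝ) : EReal) ≤ dualRate (stepLaw P (S 0) (X 0)) (β, w) := by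
  obtain ⟨φ, hφ, hφw⟩ := exists_dual_vector'' ℝ w
  have hg := le_dualRate (μ := stepLaw P (S 0) (X 0))
    (g := ζ • ContinuousLinearMap.fst ℝ ℝ E + (σ • φ).comp (ContinuousLinearMap.snd ℝ ℝ E)) ?_
    (β, w)
  · refine le_trans (EReal.coe_le_coe_iff.2 ?_) hg
    have : φ w = ‖w‖ := by simpa using hφw
    simp [this]
  · rw [stepLaw, lintegral_map (f := fun z => eexp ((ζ • ContinuousLinearMap.fst ℝ ℝ E +
      (σ • φ).comp (ContinuousLinearMap.snd ℝ ℝ E)) z)) (measurable_eexp.comp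
      (ContinuousLinearMap.continuous _).measurable) (h.measurable_step 0)]
    refine (lintegral_mono fun ω => ?_).trans hρ
    simp only [eexp_le_eexp]
    have h1 : φ (X 0 ω) ≤ ‖X 0 ω‖ := by
      refine (le_abs_self _).trans ((φ.le_opNorm _).trans ?_)
      exact mul_le_of_le_one_left (norm_nonneg _) hφ
    simpa using mul_le_mul_of_nonneg_left h1 hσ.le

lemma le_rateOf_of_lintegral_lt_one {ζ σ : ℝ} (hζ : ζ ≤ 0) (hσ : 0 < σ)
    (hρ : ∫⁻ ω, eexp (ζ * S 0 ω + σ * ‖X 0 ω‖) ∂P ≤ 1) {ℓ : EReal} (hℓ : 0 ≤ ℓ) (w : E) :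
    ((ζ + σ * ‖w‖ : ℝ) : EReal) ≤ rateOf P (S 0) (X 0) ℓ w := by
  have hs := h.measurable_time 0
  have hx := h.measurable_reward 0
  rcases ereal_nonneg_cases hℓ with rfl | ⟨L, hL, rfl⟩
  · rw [rateOf_top hs hx]
    simpa using h.le_dualRate_of_lintegral_lt_one hσ hρ 1 w
  · by_contra! hlt
    obtain ⟨β, hβ, hD⟩ := (rateOf_coe_lt_iff hs hx).1 hlt
    have h1 := EReal.coe_lt_coe_iff.1
      ((h.le_dualRate_of_lintegral_lt_one hσ hρ β w).trans_lt hD)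
    have h2 : 0 ≤ (1 - β) * L := mul_nonneg (by linarith [hβ.2]) hL
    have h3 : ζ * 1 ≤ ζ * β := mul_le_mul_of_nonpos_left hβ.2 hζ
    linarith

lemma compactLevelSets_rateOf [FiniteDimensional ℝ E] {ζ σ : ℝ} (hζ : ζ ≤ 0) (hσ : 0 < σ)
    (hρ : ∫⁻ ω, eexp (ζ * S 0 ω + σ * ‖X 0 ω‖) ∂P ≤ 1) {ℓ : EReal} (hℓ : 0 ≤ ℓ) :
    CompactLevelSets (rateOf P (S 0) (X 0) ℓ) := by
  intro a
  have : ProperSpace E := FiniteDimensional.proper_real E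
  refine (isCompact_closedBall (0 : E) ((a - ζ) / σ)).of_isClosed_subset
    ((rateOf_lowerSemicontinuous (h.measurable_time 0) (h.measurable_reward 0)
      hℓ).isClosed_preimage _) fun w hw => ?_
  have h1 := EReal.coe_le_coe_iff.1 ((h.le_rateOf_of_lintegral_lt_one hζ hσ hρ hℓ w).trans hw)
  rw [mem_closedBall_zero_iff, le_div_iff₀ hσ]
  linarith

end IsRenewalReward
end ExponentialTightness

/-! ### Exponential tightness under all exponential moments -/

section InfiniteDimension

/-- At every scale the intersection is covered by balls around a finite net of some K k, so it is
totally bounded. -/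
lemma isCompact_iInter_cthickening {E : Type*} [NormedAddCommGroup E] [CompleteSpace E]
    {K : ℕ → Set E} (hK : ∀ k, IsCompact (K k)) :
    IsCompact (⋂ k : ℕ, Metric.cthickening (1 / ((k : ℝ) + 1)) (K k)) := by
  refine isCompact_iff_totallyBounded_isComplete.2
    ⟨?_, (isClosed_iInter fun k => Metric.isClosed_cthickening).isComplete⟩
  refine Metric.totallyBounded_iff.2 fun ε hε => ?_
  obtain ⟨k, hk⟩ := exists_nat_one_div_lt (half_pos hε)
  obtain ⟨t, ht, hcov⟩ := Metric.totallyBounded_iff.1 (hK k).totallyBounded (ε / 2) (half_pos hε)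
  refine ⟨t, ht, fun x hx => ?_⟩
  have hx' := Set.mem_iInter.1 hx k
  rw [(hK k).cthickening_eq_biUnion_closedBall (by positivity)] at hx'
  obtain ⟨y, hy, hxy⟩ := Set.mem_iUnion₂.1 hx'
  obtain ⟨z, hz, hyz⟩ := Set.mem_iUnion₂.1 (hcov hy)
  refine Set.mem_iUnion₂.2 ⟨z, hz, ?_⟩
  rw [Metric.mem_closedBall] at hxy
  rw [Metric.mem_ball] at hyz ⊢
  linarith [dist_triangle x y z]

open Pointwise in
lemma sum_mem_smul_of_convex {E : Type*} [NormedAddCommGroup E] [NormedSpace ℝ E] {H : Set E}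
    (hH : Convex ℝ H) (h0 : (0 : E) ∈ H) (n : ℕ) {y : ℕ → E} (hy : ∀ i < n, y i ∈ H) {r : ℝ}
    (hr : n ≤ r) : ∑ i ∈ Finset.range n, y i ∈ r • H := by
  have h1 : ∑ i ∈ Finset.range n, y i ∈ (n : ℝ) • H := by
    induction n with
    | zero => simpa using ⟨0, h0, by simp⟩
    | succ n ih =>
      rw [Finset.sum_range_succ, Nat.cast_succ, hH.add_smul (Nat.cast_nonneg n) zero_le_one,
        one_smul]
      refine Set.add_mem_add (ih (fun i hi => hy i (by omega)) ?_) (hy n (by omega))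
      push_cast at hr; linarith
  rcases Nat.eq_zero_or_pos n with rfl | hn
  · simpa using ⟨0, h0, by simp⟩
  obtain ⟨x, hx, hxe⟩ := h1
  have hn0 : (0 : ℝ) < n := by exact_mod_cast hn
  have hr0 : 0 < r := hn0.trans_le hr
  refine ⟨((n : ℝ) / r) • x, hH.smul_mem_of_zero_mem h0 hx
    ⟨by positivity, (div_le_one hr0).2 hr⟩, ?_⟩
  simp only at hxe ⊢
  rw [← hxe, smul_smul, mul_div_cancel₀ _ hr0.ne']

variable {Ω E : Type*} [MeasurableSpace Ω] {P : Measure Ω} [IsProbabilityMeasure P]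
  [NormedAddCommGroup E] [NormedSpace ℝ E] [CompleteSpace E]
  [SecondCountableTopology E] [MeasurableSpace E] [BorelSpace E]
  {S : ℕ → Ω → ℝ} {X : ℕ → Ω → E}

open Classical in
-- The finite measure with density e^{σ‖v‖} is tight, so C can carry all but mass 1 of it. The
-- integral is then at most 1 + 1 ≤ e, a bound independent of σ.
lemma exists_compact_lintegral_eexp_le {x : Ω → E} (hx : Measurable x) {σ : ℝ}
    (hσ : ∫⁻ ω, eexp (σ * ‖x ω‖) ∂P < ⊤) :
    ∃ C : Set E, IsCompact C ∧
      ∫⁻ ω, eexp (if x ω ∈ C then 0 else σ * ‖x ω‖) ∂P ≤ eexp 1 := by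
  have hm : Measurable fun v : E => eexp (σ * ‖v‖) :=
    measurable_eexp.comp (measurable_norm.const_mul σ)
  have hfin : ∫⁻ v, eexp (σ * ‖v‖) ∂(P.map x) ≠ ⊤ := by
    rw [lintegral_map hm hx]; exact hσ.ne
  have : IsFiniteMeasure ((P.map x).withDensity fun v => eexp (σ * ‖v‖)) :=
    isFiniteMeasure_withDensity hfin
  obtain ⟨C, hC, hC'⟩ := isTightMeasureSet_iff_exists_isCompact_measure_compl_le.1
    (isTightMeasureSet_singleton (μ := (P.map x).withDensity fun v => eexp (σ * ‖v‖))) 1 one_pos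
  have h1 := hC' _ rfl
  rw [withDensity_apply _ hC.isClosed.measurableSet.compl,
    ← lintegral_indicator hC.isClosed.measurableSet.compl,
    lintegral_map (hm.indicator hC.isClosed.measurableSet.compl) hx] at h1
  refine ⟨C, hC, ?_⟩
  calc _ ≤ ∫⁻ ω, (1 + Cᶜ.indicator (fun v => eexp (σ * ‖v‖)) (x ω)) ∂P := by
        refine lintegral_mono fun ω => ?_
        by_cases hω : x ω ∈ C
        · simp [hω]
        · simp [hω]
    _ ≤ 1 + 1 := by
        rw [lintegral_add_left measurable_const]
        simpa using h1
    _ ≤ eexp 1 := by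
        rw [eexp, one_add_one_eq_two, ← ENNReal.ofReal_ofNat]
        exact ENNReal.ofReal_le_ofReal (by linarith [Real.add_one_le_exp 1])

namespace IsRenewalReward

variable (h : IsRenewalReward P S X)
include h

open Classical Pointwise in
/-- Exponential tightness under exponential moments of every order of the rewards. -/
lemma expTight_of_forall_lintegral_lt_top
    (hX : ∀ σ : ℝ, 0 < σ → ∫⁻ ω, eexp (σ * ‖X 0 ω‖) ∂P < ⊤) : ExpTight P S X := by
  have := h.isProbabilityMeasure
  intro a ha
  obtain ⟨κ, hκ, hκn⟩ := exists_iterConv_fst_le h.ae_pos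
  obtain ⟨M, hM0, hM⟩ : ∃ M : ℝ, 0 ≤ M ∧ a + 2 ≤ κ * M :=
    ⟨(a + 2) / κ, by positivity, (mul_div_cancel₀ _ hκ.ne').ge⟩
  -- With this weight an error above t/(k + 1) costs (M + 3 + a + k)t. After the factor e^m with m ≤
  -- Mt + 1 there remains e^{-(a + 1)t - k}, summable in k.
  set σ : ℕ → ℝ := fun k => (k + 1) * (M + 3 + a + k)
  have hσ : ∀ k, 0 < σ k := fun k => by simp only [σ]; positivity
  choose C hC hCint using fun k => exists_compact_lintegral_eexp_le (h.measurable_reward 0)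
    (hX (σ k) (hσ k))
  set H : ℕ → Set E := fun k => closure (convexHull ℝ (insert 0 (C k)))
  have hHc : ∀ k, IsCompact (H k) := fun k => isCompact_closure_convexHull ((hC k).insert 0)
  have hH0 : ∀ k, (0 : E) ∈ H k := fun k =>
    subset_closure (subset_convexHull ℝ _ (Set.mem_insert _ _))
  have hHC : ∀ k, C k ⊆ H k := fun k x hx =>
    subset_closure (subset_convexHull ℝ _ (Set.mem_insert_of_mem _ hx))
  have hHconv : ∀ k, Convex ℝ (H k) := fun k => (convex_convexHull ℝ _).closure
  refine ⟨⋂ k : ℕ, Metric.cthickening (1 / ((k : ℝ) + 1)) ((M + 1) • H k),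
    isCompact_iInter_cthickening fun k => (hHc k).smul (M + 1), ?_⟩
  set f : ℕ → ℝ × E → ℝ := fun k z => if z.2 ∈ C k then 0 else σ k * ‖z.2‖
  have hf : ∀ k, Measurable (f k) := fun k =>
    Measurable.ite ((hC k).isClosed.measurableSet.preimage measurable_snd) measurable_const
      (measurable_snd.norm.const_mul _)
  have hf0 : ∀ k z, 0 ≤ f k z := fun k z => by
    simp only [f]
    split_ifs
    · exact le_rfl
    · exact mul_nonneg (hσ k).le (norm_nonneg _)
  set D : ENNReal := 1 + ∑' k : ℕ, eexp (-1) ^ k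
  have hD : D ≠ ⊤ := by
    refine ENNReal.add_ne_top.2 ⟨ENNReal.one_ne_top, ?_⟩
    rw [ENNReal.tsum_geometric]
    refine ENNReal.inv_ne_top.2 (tsub_pos_of_lt ?_).ne'
    rw [← eexp_zero, eexp_lt_eexp]; norm_num
  apply limsup_logProb_le
  filter_upwards [eventually_const_mul_eexp_le hD (a := -(a + 1)) (b := -a) (by linarith),
    eventually_ge_atTop 1] with t ht ht1
  refine le_trans ?_ ht
  have ht0 : 0 < t := by linarith
  obtain ⟨m, hm1, hm2⟩ : ∃ m : ℕ, M * t ≤ m ∧ (m : ℝ) ≤ M * t + 1 :=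
    ⟨⌈M * t⌉₊, Nat.le_ceil _, (Nat.ceil_lt_add_one (by positivity)).le⟩
  -- Rewards outside C k are replaced by 0. The truncated sum, having at most (M + 1)t terms, stays
  -- in the dilated hull, and what was removed has norm at most t/(k + 1).
  have hsub : {ω | t⁻¹ • cumulativeReward S X t ω ∈
      (⋂ k : ℕ, Metric.cthickening (1 / ((k : ℝ) + 1)) ((M + 1) • H k))ᶜ} ⊆
      {ω | walk S X m ω ∈ {z : ℝ × E | z.1 ≤ t}} ∪ ⋃ k : ℕ, {ω | σ k * t / (k + 1) ≤
        ∑ i ∈ Finset.range m, f k (S i ω, X i ω)} := by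
    intro ω hω
    by_contra hnot
    simp only [Set.mem_union, Set.mem_iUnion, Set.mem_ofPred_eq, not_or, not_exists,
      not_le] at hnot
    obtain ⟨hlt, hsum⟩ := hnot
    refine hω (Set.mem_iInter.2 fun k => ?_)
    obtain ⟨n, hnm, h1, h2⟩ := exists_renewal_index ht0.le hlt
    rw [cumulativeReward_eq_walk h.pos h1 h2, walk_snd]
    set y : ℕ → E := fun i => if X i ω ∈ C k then X i ω else 0
    refine Metric.mem_cthickening_of_dist_le _ (t⁻¹ • ∑ i ∈ Finset.range n, y i) _ _ ?_ ?_
    · have hnr : (n : ℝ) ≤ (M + 1) * t := by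
        have : (n : ℝ) ≤ m := by exact_mod_cast hnm.le
        linarith
      obtain ⟨x, hx, hxe⟩ := sum_mem_smul_of_convex (hHconv k) (hH0 k) n (y := y) (fun i _ => by
        simp only [y]
        split_ifs with hi
        · exact hHC k hi
        · exact hH0 k) hnr
      refine ⟨x, hx, ?_⟩
      simp only at hxe ⊢
      rw [← hxe, smul_smul]
      congr 1
      field_simp
    · rw [dist_eq_norm, ← smul_sub, ← Finset.sum_sub_distrib, norm_smul, norm_inv,
        Real.norm_eq_abs, abs_of_pos ht0, inv_mul_le_iff₀ ht0]
      have h3 : σ k * ‖∑ i ∈ Finset.range n, (X i ω - y i)‖ ≤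
          ∑ i ∈ Finset.range m, f k (S i ω, X i ω) := by
        calc _ ≤ σ k * ∑ i ∈ Finset.range n, ‖X i ω - y i‖ := by
              have := hσ k
              gcongr
              exact norm_sum_le _ _
          _ = ∑ i ∈ Finset.range n, f k (S i ω, X i ω) := by
              rw [Finset.mul_sum]
              refine Finset.sum_congr rfl fun i _ => ?_
              simp only [f, y]
              split_ifs <;> simp
          _ ≤ _ := Finset.sum_le_sum_of_subset_of_nonneg
              (Finset.range_mono hnm.le) fun i _ _ => hf0 k _
      have h4 := h3.trans (hsum k).le
      rw [mul_div_assoc] at h4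
      have h5 := le_of_mul_le_mul_left h4 (hσ k)
      rwa [mul_one_div]
  refine (measure_mono hsub).trans ((measure_union_le _ _).trans ?_)
  rw [h.measure_walk m (measurableSet_le measurable_fst measurable_const)]
  have hfirst : iterConv (stepLaw P (S 0) (X 0)) m {z : ℝ × E | z.1 ≤ t} ≤
      1 * eexp (-(a + 1) * t) := by
    rw [one_mul]
    refine (hκn t m).trans (eexp_le_eexp.2 ?_)
    have h1 : κ * (M * t) ≤ κ * m := by gcongr
    have h2 : (a + 2) * t ≤ κ * M * t := by gcongr
    linarith
  have hsecond : P (⋃ k : ℕ, {ω | σ k * t / (k + 1) ≤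
      ∑ i ∈ Finset.range m, f k (S i ω, X i ω)}) ≤
      (∑' k : ℕ, eexp (-1) ^ k) * eexp (-(a + 1) * t) := by
    refine (measure_iUnion_le _).trans ?_
    rw [← ENNReal.tsum_mul_right]
    refine ENNReal.tsum_le_tsum fun k => ?_
    refine (h.measure_le_sum_step (hf k) m _).trans ?_
    calc _ ≤ eexp (-(σ k * t / (k + 1))) * eexp 1 ^ m := by
          gcongr
          exact hCint k
      _ ≤ eexp (-1) ^ k * eexp (-(a + 1) * t) := by
          rw [← eexp_nat_mul, ← eexp_nat_mul, ← eexp_add, ← eexp_add, eexp_le_eexp]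
          have h1 : σ k * t / (k + 1) = (M + 3 + a + k) * t := by
            simp only [σ]; field_simp
          have h2 : (k : ℝ) * 1 ≤ k * t := by gcongr
          rw [h1]
          nlinarith
  simp only [D]
  rw [add_mul]
  exact add_le_add hfirst hsecond

/-- Markov's inequality with e^{σS} for every σ. -/
lemma ellSup_eq_top (hS : ∀ σ : ℝ, 0 < σ → ∫⁻ ω, eexp (σ * S 0 ω) ∂P < ⊤) :
    ellSup P (S 0) = ⊤ := by
  rw [EReal.eq_top_iff_forall_lt]
  intro y
  set σ := |y| + 2
  have hσ : 0 < σ := by positivity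
  have hm : Measurable fun ω => eexp (σ * S 0 ω) :=
    measurable_eexp.comp ((h.measurable_time 0).const_mul σ)
  have h1 : limsup (fun r : ℝ => ((r⁻¹ : ℝ) : EReal) * ENNReal.log (P {ω | r < S 0 ω})) atTop ≤
      ((-(|y| + 1) : ℝ) : EReal) := by
    refine limsup_le_of_le (h := ?_)
    filter_upwards [eventually_const_mul_eexp_le (hS σ hσ).ne (a := -σ) (b := -(|y| + 1))
      (by simp only [σ]; linarith), eventually_gt_atTop 0] with r hr hr0
    rw [inv_mul_log_le_iff hr0]
    refine le_trans ?_ hr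
    have h2 := mul_meas_ge_le_lintegral hm (eexp (σ * r)) (μ := P)
    calc P {ω | r < S 0 ω} = eexp (-(σ * r)) * (eexp (σ * r) * P {ω | r < S 0 ω}) := by
          rw [← mul_assoc, eexp_neg_mul_self, one_mul]
      _ ≤ eexp (-(σ * r)) * ∫⁻ ω, eexp (σ * S 0 ω) ∂P := by
          gcongr
          refine le_trans ?_ h2
          gcongr
          intro hω
          rw [eexp_le_eexp]
          have : r < S 0 _ := hω
          gcongr
      _ = _ := by rw [mul_comm, neg_mul]
  rw [ellSup]
  refine lt_of_lt_of_le ?_ (EReal.neg_le_neg_iff.2 h1)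
  rw [← EReal.coe_neg, EReal.coe_lt_coe_iff]
  linarith [le_abs_self y]

/-- A lower semicontinuous rate function governing the lower bound is good as soon as the laws are
exponentially tight. -/
lemma compactLevelSets_rateInf_of_expTight (ht : ExpTight P S X) :
    CompactLevelSets (rateInf P (S 0) (X 0)) := by
  intro a
  obtain ⟨K, hK, hKt⟩ := ht (|a| + 1) (by positivity)
  refine hK.of_isClosed_subset ((rateOf_lowerSemicontinuous (h.measurable_time 0)
    (h.measurable_reward 0) ellInf_nonneg).isClosed_preimage _) fun w hw => ?_
  by_contra hwK
  -- The complement of K is open. A point of it with rate at most a would force a decay rate at most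
  -- a there, against |a| + 1.
  have h1 := (h.lowerBound_of_isOpen hK.isClosed.isOpen_compl).trans
    ((liminf_le_limsup).trans hKt)
  rw [EReal.coe_neg, EReal.neg_le_neg_iff] at h1
  have h2 := EReal.coe_le_coe_iff.1 ((h1.trans (iInf₂_le w hwK)).trans hw)
  linarith [le_abs_self a]

end IsRenewalReward
end InfiniteDimension

end RenewalReward

end

/-! ### Assembly of the main theorem -/

theorem theorem1 {Ω E : Type*} [MeasurableSpace Ω] (P : Measure Ω) [IsProbabilityMeasure P]
    [NormedAddCommGroup E] [NormedSpace ℝ E] [CompleteSpace E]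
    [TopologicalSpace.SeparableSpace E] [MeasurableSpace E] [BorelSpace E]
    (S : ℕ → Ω → ℝ) (X : ℕ → Ω → E)
    (hS : ∀ i, Measurable (S i)) (hX : ∀ i, Measurable (X i))
    (hpos : ∀ i ω, 0 < S i ω)
    (hindep : iIndepFun (fun i ω => (S i ω, X i ω)) P)
    (hident : ∀ i, IdentDistrib (fun ω => (S i ω, X i ω)) (fun ω => (S 0 ω, X 0 ω)) P P) :
    -- (a)
    ((∀ w, 0 ≤ RenewalReward.rateInf P (S 0) (X 0) w) ∧
      LowerSemicontinuous (RenewalReward.rateInf P (S 0) (X 0)) ∧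
      RenewalReward.ERealConvex (RenewalReward.rateInf P (S 0) (X 0)) ∧
      (∀ w, 0 ≤ RenewalReward.rateSup P (S 0) (X 0) w) ∧
      LowerSemicontinuous (RenewalReward.rateSup P (S 0) (X 0)) ∧
      RenewalReward.ERealConvex (RenewalReward.rateSup P (S 0) (X 0))) ∧
    -- (b)
    (∀ G : Set E, IsOpen G →
      RenewalReward.LowerBound P S X (RenewalReward.rateInf P (S 0) (X 0)) G) ∧
    -- (c)
    (∀ F : Set E, IsCompact F →
      RenewalReward.UpperBound P S X (RenewalReward.rateSup P (S 0) (X 0)) F) ∧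
    -- (d)
    (RenewalReward.ellSup P (S 0) < ⊤ ∨ RenewalReward.rateSup P (S 0) (X 0) 0 < ⊤ →
      ∀ F : Set E, MeasurableSet F → Convex ℝ F →
        (IsOpen F ∨ IsClosed F ∨ FiniteDimensional ℝ E) →
        RenewalReward.UpperBound P S X (RenewalReward.rateSup P (S 0) (X 0)) F) ∧
    -- (e)
    (FiniteDimensional ℝ E →
      (∃ ζ σ : ℝ, ζ ≤ 0 ∧ 0 < σ ∧
        ∫⁻ ω, ENNReal.ofReal (Real.exp (ζ * S 0 ω + σ * ‖X 0 ω‖)) ∂P < ⊤) →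
      RenewalReward.ExpTight P S X ∧
      RenewalReward.CompactLevelSets (RenewalReward.rateInf P (S 0) (X 0)) ∧
      RenewalReward.CompactLevelSets (RenewalReward.rateSup P (S 0) (X 0)) ∧
      ∀ F : Set E, IsClosed F →
        RenewalReward.UpperBound P S X (RenewalReward.rateSup P (S 0) (X 0)) F) ∧
    -- (f)
    (¬ FiniteDimensional ℝ E →
      (∀ σ : ℝ, 0 < σ →
        ∫⁻ ω, ENNReal.ofReal (Real.exp (σ * S 0 ω + σ * ‖X 0 ω‖)) ∂P < ⊤) →
      RenewalReward.rateInf P (S 0) (X 0) = RenewalReward.upsilon P (S 0) (X 0) 1 ∧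
      RenewalReward.rateSup P (S 0) (X 0) = RenewalReward.upsilon P (S 0) (X 0) 1 ∧
      RenewalReward.CompactLevelSets (RenewalReward.upsilon P (S 0) (X 0) 1) ∧
      ∀ F : Set E, IsClosed F →
        RenewalReward.UpperBound P S X (RenewalReward.rateSup P (S 0) (X 0)) F) := by
  have : SecondCountableTopology E := UniformSpace.secondCountable_of_separable E
  have h : RenewalReward.IsRenewalReward P S X := ⟨hS, hX, hpos, hindep, hident⟩
  have hi : 0 ≤ RenewalReward.ellInf P (S 0) := RenewalReward.ellInf_nonneg
  have hs : 0 ≤ RenewalReward.ellSup P (S 0) := RenewalReward.ellSup_nonneg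
  refine ⟨⟨RenewalReward.rateOf_nonneg (hS 0) (hX 0) hi,
    RenewalReward.rateOf_lowerSemicontinuous (hS 0) (hX 0) hi,
    RenewalReward.rateOf_convex (hS 0) (hX 0) hi,
    RenewalReward.rateOf_nonneg (hS 0) (hX 0) hs,
    RenewalReward.rateOf_lowerSemicontinuous (hS 0) (hX 0) hs,
    RenewalReward.rateOf_convex (hS 0) (hX 0) hs⟩,
    fun G hG => h.lowerBound_of_isOpen hG, fun F hF => h.upperBound_of_isCompact hF, ?_, ?_, ?_⟩
  · intro hfin F hF hconv hcase
    refine h.upperBound_of_convexlyExhausted hF ?_ hfin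
    rcases hcase with hopen | hclosed | hdim
    · exact RenewalReward.convexlyExhausted_of_isOpen hopen hconv
    · exact RenewalReward.convexlyExhausted_of_isClosed hclosed hconv
    · exact RenewalReward.convexlyExhausted_of_finiteDimensional hconv
  · rintro hdim ⟨ζ, σ, -, hσ, hfin⟩
    obtain ⟨ζ', hζ', hlt⟩ := h.exists_lintegral_eexp_lt_one hfin
    have ht := h.expTight_of_finiteDimensional hζ' hσ hlt
    exact ⟨ht, h.compactLevelSets_rateOf hζ' hσ hlt.le hi,
      h.compactLevelSets_rateOf hζ' hσ hlt.le hs,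
      fun F hF => h.upperBound_of_isClosed_of_expTight ht hF⟩
  · intro _ hfin
    have hℓs : RenewalReward.ellSup P (S 0) = ⊤ := h.ellSup_eq_top fun σ hσ =>
      (lintegral_mono fun ω => RenewalReward.eexp_le_eexp.2
        (le_add_of_nonneg_right (mul_nonneg hσ.le (norm_nonneg _)))).trans_lt (hfin σ hσ)
    have hℓi : RenewalReward.ellInf P (S 0) = ⊤ :=
      top_le_iff.1 (hℓs ▸ RenewalReward.ellSup_le_ellInf)
    have ht := h.expTight_of_forall_lintegral_lt_top fun σ hσ =>
      (lintegral_mono fun ω => RenewalReward.eexp_le_eexp.2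
        (le_add_of_nonneg_left (mul_nonneg hσ.le (hpos 0 ω).le))).trans_lt (hfin σ hσ)
    have hrate : RenewalReward.rateInf P (S 0) (X 0) = RenewalReward.upsilon P (S 0) (X 0) 1 := by
      funext w
      simp [RenewalReward.rateInf, RenewalReward.rateOf, hℓi]
    refine ⟨hrate, ?_, hrate ▸ h.compactLevelSets_rateInf_of_expTight ht,
      fun F hF => h.upperBound_of_isClosed_of_expTight ht hF⟩
    funext w
    simp [RenewalReward.rateSup, RenewalReward.rateOf, hℓs]
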